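/- For integers $q\ge 1$ and $m,n$, let $$\mathcal K(m,n;q)=\frac{1}{q^{1/2}}\sum_{\substack{1\le b\le q\\ \gcd(b,q)=1}} e\!\left(\frac{mb+n\overline b}{q}\right),\qquad e(x)=e^{2\pi i x},$$ where $\overline b$ is an integer with $b\overline b\equiv 1 \pmod q$. There is an absolute constant $c>0$ such that the following holds. For every $\varepsilon>0$ there are constants $H(\varepsilon)>0$ and $C(\varepsilon)>0$, depending only on $\varepsilon$, such that for every odd prime $p$, every integer $k>H(\varepsilon)$, every real $X$ with $q^{\varepsilon}<X\le q$, where $q=p^k$, and every integer $a$ with $\gcd(a,p)=1$, $$\left|\sum_{\substack{\ell\le X\\ \ell\ \mathrm{prime}}}\mathcal K(\ell,a;q)\right|\le C(\varepsilon)\, X\, q^{-c\varepsilon^3}.$$ -/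

import Mathlib

/-- The real additive character `e(x) = exp(2πix)`. -/
noncomputable def expTwoPiI (x : ℝ) : ℂ :=
  Complex.exp (2 * (Real.pi : ℂ) * Complex.I * (x : ℂ))

/-- The normalized Kloosterman sum
`K(m,n;q) = q^{-1/2} ∑* e((m b + n b̄) / q)`, where `b` runs through the reduced residues
`0 ≤ b < q`, `gcd(b,q) = 1`, and `b̄` is the representative in `[0,q)` of the inverse of `b`
modulo `q` (the summand depends only on the classes of `b` and `b̄` modulo `q`). -/
noncomputable def kloostermanSum (m n : ℤ) (q : ℕ) : ℂ :=
  ((1 / Real.sqrt (q : ℝ) : ℝ) : ℂ) *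
    ∑ b ∈ (Finset.range q).filter (fun b : ℕ => Nat.Coprime b q),
      expTwoPiI (((m : ℝ) * (b : ℝ) + (n : ℝ) * ((((b : ZMod q)⁻¹).val : ℕ) : ℝ)) / (q : ℝ))

/-! Write `q = p^k`. Stationary phase makes the Kloosterman sum explicit. For `m` in a fixed nonzero
class `r` modulo `p`, write `m = r f²` with `f ≡ 1 (mod p)`. The substitution `b ↦ b/f` turns the
phase `mb + a/b` into `f·(rb + a/b)`, so the set of stationary points does not depend on `m` and `m
↦ K(m, a; q)` is a combination, of total weight at most `2p`, of functions `ψ(c √(m/r))`. Products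
`K(mt₁) · conj K(mt₂)` have the same shape, with `c` replaced by a difference `c₁ - c₂`; since `c² ≈
4rta`, this difference is not too divisible by `p` unless `t₁ ≡ t₂` modulo a high power of `p`.

It remains to find cancellation in very short sums of `ψ(c √m)`. Put `P = p^g` with `k ≈ 16ng` and
shift `m` by `P² x y`, `0 ≤ x, y < P`. Because `P^(2(8n+1)) = 0` in `ℤ/q`, the power series of `√(1
- 4z)`, whose coefficients are Catalan numbers, terminates, and the phase is `∑ a_j x^j y^j` with `j
≤ 8n`. Vinogradov's double Hölder argument bounds the sum over `x` and `y` by the square of a mean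
value `J` times a product over `j` of sums `∑_w |∑_v ψ(a_j v w)|`. The degrees `5n ≤ j ≤ 7n`, where
`a_j` has additive order neither too small nor too large, each save `P^(n-1)`, in total about
`P^(2n²)`; the two factors `J` lose only `P^(n²/2)`. Taking the `4s²`-th root with `s = 448n²`
leaves a saving `P^(-θ)`, `θ = savingExp n ≍ n^(-2)` (`polynomial_bilinear_bound`,
`branch_interval_bound`). The mean value estimate itself comes from Linnik's `p`-adic recursion
(`meanValue_add_le`), with a broad/narrow dichotomy in place of a count of singular solutions.

Linear and bilinear bounds over intervals (`kloosterman_interval_bounds`) are the Type I and Type II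
input of Vaughan's identity (`HasIntervalBounds.prime_sum_le`), which works once `X ≥ P^17`. As `q^ε
≥ P^(16nε)`, one takes `n ≍ 1/ε`; a saving `P^(-θ/4)` with `q ≤ P^(16n+2)` is then a power
`q^(-cε³)`. -/

namespace KloostermanPrimes

open Finset

/-! ### Counting and orthogonality -/

/-- The number of representations of `v` as a difference of two values of `f` is largest at
`v = 0`. -/
lemma card_sub_eq_le {τ G : Type*} [AddCommGroup G] [DecidableEq G] (T : Finset τ) (f : τ → G)
    (v : G) :
    #{z ∈ T ×ˢ T | f z.1 - f z.2 = v} ≤ #{z ∈ T ×ˢ T | f z.1 = f z.2} := by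
  classical
  set r : G → ℕ := fun a => #{t ∈ T | f t = a} with hr
  -- The count is an autocorrelation of the multiplicity function `r`, to which Cauchy–Schwarz
  -- applies.
  have key : ∀ w : G, #{z ∈ T ×ˢ T | f z.1 - f z.2 = w} = ∑ a ∈ T.image f, r a * r (a - w) := by
    intro w
    rw [card_filter, sum_product]
    have h1 : ∀ x ∈ T, (∑ y ∈ T, if f x - f y = w then 1 else 0) = r (f x - w) := by
      intro x _
      simp only [hr]
      rw [card_filter]
      refine sum_congr rfl fun y _ => ?_
      congr 1
      simp only [eq_iff_iff]
      constructor
      · rintro rfl; abel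
      · intro h; rw [h]; abel
    rw [sum_congr rfl h1, ← sum_fiberwise_of_maps_to (g := f) (t := T.image f)
      (fun x hx => mem_image_of_mem f hx)]
    refine sum_congr rfl fun a _ => ?_
    rw [sum_congr rfl (g := fun _ => r (a - w)) (fun x hx => by rw [(mem_filter.1 hx).2]),
      sum_const, smul_eq_mul]
  have h0 : #{z ∈ T ×ˢ T | f z.1 = f z.2} = ∑ a ∈ T.image f, r a * r a := by
    have := key 0
    simpa only [sub_eq_zero, sub_zero] using this
  rw [key, h0]
  have h2 : ∑ a ∈ T.image f, r (a - v) * r (a - v) ≤ ∑ a ∈ T.image f, r a * r a := by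
    -- Translating the support by `v` cannot increase the sum of squares: `r` vanishes off the image
    -- of `f`.
    have : ∑ a ∈ (T.image f).image (fun a => a - v), r a * r a ≤ ∑ a ∈ T.image f, r a * r a := by
      rw [← sum_filter_add_sum_filter_not _ (fun a => a ∈ T.image f)]
      have hz : ∑ a ∈ ((T.image f).image (fun a => a - v)).filter (fun a => ¬ a ∈ T.image f),
          r a * r a = 0 := by
        refine sum_eq_zero fun a ha => ?_
        have : r a = 0 := by
          rw [hr]
          simp only [card_eq_zero, filter_eq_empty_iff]
          intro t ht h
          exact (mem_filter.1 ha).2 (h ▸ mem_image_of_mem f ht)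
        simp [this]
      rw [hz, add_zero]
      exact sum_le_sum_of_subset fun a ha => (mem_filter.1 ha).2
    rwa [sum_image (fun a _ b _ h => by simpa using h)] at this
  have h3 : 2 * ∑ a ∈ T.image f, r a * r (a - v) ≤
      ∑ a ∈ T.image f, r a * r a + ∑ a ∈ T.image f, r (a - v) * r (a - v) := by
    rw [mul_sum, ← sum_add_distrib]
    refine sum_le_sum fun a _ => ?_
    nlinarith [two_mul_le_add_sq (r a) (r (a - v))]
  lia

/-- Parseval: open the square and use orthogonality of characters. -/
lemma sum_addChar_norm_sq {G τ : Type*} [AddCommGroup G] [Fintype G] [DecidableEq G]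
    (T : Finset τ) (f : τ → G) :
    ∑ ψ : AddChar G ℂ, ‖∑ t ∈ T, ψ (f t)‖ ^ 2 =
      Fintype.card G * (#{z ∈ T ×ˢ T | f z.1 = f z.2} : ℝ) := by
  have h : (∑ ψ : AddChar G ℂ, ((‖∑ t ∈ T, ψ (f t)‖ : ℂ)) ^ 2) =
      Fintype.card G * (#{z ∈ T ×ˢ T | f z.1 = f z.2} : ℂ) := by
    have h1 : ∀ ψ : AddChar G ℂ, ((‖∑ t ∈ T, ψ (f t)‖ : ℂ)) ^ 2 =
        ∑ z ∈ T ×ˢ T, ψ (f z.1 - f z.2) := by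
      intro ψ
      rw [← Complex.mul_conj', map_sum, sum_mul_sum, sum_product]
      refine sum_congr rfl fun x _ => sum_congr rfl fun y _ => ?_
      rw [sub_eq_add_neg, AddChar.map_add_eq_mul, AddChar.map_neg_eq_conj]
    simp_rw [h1]
    rw [sum_comm]
    simp_rw [AddChar.sum_apply_eq_ite, sub_eq_zero]
    rw [← sum_filter, sum_const, nsmul_eq_mul, mul_comm]
  exact_mod_cast h

lemma addChar_map_sum {G ι : Type*} [AddCommGroup G] (ψ : AddChar G ℂ) (T : Finset ι)
    (f : ι → G) : ψ (∑ i ∈ T, f i) = ∏ i ∈ T, ψ (f i) := by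
  classical
  induction T using Finset.induction_on with
  | empty => simp
  | insert a T ha ih => rw [sum_insert ha, prod_insert ha, AddChar.map_add_eq_mul, ih]

lemma prod_sum_addChar {G ι : Type*} [AddCommGroup G] [Fintype ι] [DecidableEq ι]
    (ψ : AddChar G ℂ) (A : ι → Finset ℤ) (f : ℤ → G) :
    ∏ i, ∑ x ∈ A i, ψ (f x) = ∑ x ∈ Fintype.piFinset A, ψ (∑ i, f (x i)) := by
  rw [prod_univ_sum]
  refine sum_congr rfl fun x _ => ?_
  rw [addChar_map_sum]

lemma pow_sum_addChar {G : Type*} [AddCommGroup G] (s : ℕ)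
    (ψ : AddChar G ℂ) (A : Finset ℤ) (f : ℤ → G) :
    (∑ x ∈ A, ψ (f x)) ^ s =
      ∑ x ∈ Fintype.piFinset (fun _ : Fin s => A), ψ (∑ i, f (x i)) := by
  rw [← prod_sum_addChar]; simp

/-! ### Power sums -/

/-- The point `(x, x², …, x^d)`. -/
def moment (d : ℕ) (x : ℤ) : Fin d → ℤ := fun j => x ^ (j.1 + 1)

/-- The number of solutions of `∑ xᵢ^j = ∑ yᵢ^j` (`1 ≤ j ≤ d`) with `x, y ∈ A^s`. -/
noncomputable def powerEnergy (s d : ℕ) (A : Finset ℤ) : ℕ :=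
  #{z ∈ Fintype.piFinset (fun _ : Fin s => A) ×ˢ Fintype.piFinset (fun _ : Fin s => A) |
    ∑ i, moment d (z.1 i) = ∑ i, moment d (z.2 i)}

/-- Vinogradov's mean value, as a count of solutions in `[0, P)`. -/
noncomputable def meanValue (s d P : ℕ) : ℕ := powerEnergy s d (Ico (0 : ℤ) P)

/-- Translation invariance of the Vinogradov system: by the binomial theorem, power sums of the
translates are combinations of the original ones. -/
lemma sum_sub_pow_eq {ι : Type*} [Fintype ι] {d : ℕ} {x y : ι → ℤ}
    (h : ∑ i, moment d (x i) = ∑ i, moment d (y i)) (w : ℤ) {n : ℕ} (hn : n ≤ d) :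
    ∑ i, (x i - w) ^ n = ∑ i, (y i - w) ^ n := by
  have h' : ∀ m ≤ d, ∑ i, x i ^ m = ∑ i, y i ^ m := by
    intro m hm
    rcases m with _ | m
    · simp
    · have := congrFun h ⟨m, hm⟩
      simpa [moment, Finset.sum_apply] using this
  simp_rw [sub_eq_add_neg, add_pow]
  rw [sum_comm, sum_comm (s := univ (α := ι))]
  refine sum_congr rfl fun m hm => ?_
  rw [← sum_mul, ← sum_mul, ← sum_mul, ← sum_mul, h' m (by simp at hm; lia)]

/-- Power sums determine a vector modulo `p^d` within given distinct classes modulo `p > d`. -/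
lemma dvd_sub_of_powerSums {p d : ℕ} (hp : p.Prime) (hdp : d < p) {x y : Fin d → ℤ}
    (hinj : Function.Injective fun i => ((x i : ℤ) : ZMod p))
    (hxy : ∀ i, (p : ℤ) ∣ y i - x i)
    (h : ∀ j : Fin d, (p : ℤ) ^ d ∣ ∑ i, y i ^ (j.1 + 1) - ∑ i, x i ^ (j.1 + 1)) (i : Fin d) :
    (p : ℤ) ^ d ∣ y i - x i := by
  have : Fact p.Prime := ⟨hp⟩
  have hp0 : (p : ℤ) ≠ 0 := by exact_mod_cast hp.ne_zero
  -- Hensel lifting: with `y = x + p^e t`, only the terms linear in `t` survive modulo `p^(e+1)`.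
  have key : ∀ e : ℕ, 1 ≤ e → e ≤ d → ∀ i, (p : ℤ) ^ e ∣ y i - x i := by
    intro e he
    induction e, he using Nat.le_induction with
    | base => intro _ i; simpa using hxy i
    | succ e he ih =>
      intro hed
      choose t ht using ih (by lia)
      have hy : ∀ i, y i = x i + (p : ℤ) ^ e * t i := fun i => by rw [← ht]; ring
      have hv : (fun i => ((t i : ℤ) : ZMod p)) = 0 := by
        -- The linear terms form a Vandermonde system in the distinct residues `xᵢ`; the factors `j
        -- + 1` are invertible modulo `p` because `d < p`.
        apply Matrix.eq_zero_of_forall_pow_sum_mul_pow_eq_zero hinj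
        intro j
        have h1 : (p : ℤ) ^ (e + 1) ∣ (p : ℤ) ^ e * ((j.1 + 1) * ∑ i, t i * x i ^ j.1) := by
          have h2 : (p : ℤ) ^ (e + 1) ∣ ∑ i, (y i ^ (j.1 + 1) - x i ^ (j.1 + 1)) := by
            rw [sum_sub_distrib]
            exact (pow_dvd_pow _ hed).trans (h j)
          have h3 : (p : ℤ) ^ (e + 1) ∣ ∑ i, (y i ^ (j.1 + 1) - x i ^ (j.1 + 1) -
              (p : ℤ) ^ e * ((j.1 + 1) * (t i * x i ^ j.1))) := by
            refine dvd_sum fun i _ => ?_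
            obtain ⟨k, hk⟩ := Polynomial.powAddExpansion (x i) ((p : ℤ) ^ e * t i) (j.1 + 1)
            rw [hy, hk]
            have : (p : ℤ) ^ (e + 1) ∣ (p : ℤ) ^ e * (p : ℤ) ^ e := by
              rw [← pow_add]; exact pow_dvd_pow _ (by lia)
            refine this.trans ⟨k * t i ^ 2, ?_⟩
            push_cast [Nat.add_sub_cancel]
            ring
          rw [sum_sub_distrib, ← mul_sum, ← mul_sum] at h3
          exact (dvd_sub_right h2).1 h3
        rw [pow_succ] at h1
        have h4 := (mul_dvd_mul_iff_left (pow_ne_zero e hp0)).1 h1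
        rcases (Nat.prime_iff_prime_int.1 hp).dvd_or_dvd h4 with h5 | h5
        · exfalso
          have : p ∣ j.1 + 1 := by exact_mod_cast h5
          have := Nat.le_of_dvd (by lia) this
          have := j.2
          lia
        · have := (ZMod.intCast_zmod_eq_zero_iff_dvd _ p).2 h5
          push_cast at this
          exact this
      intro i
      have : (p : ℤ) ∣ t i := (ZMod.intCast_zmod_eq_zero_iff_dvd _ p).1 (congrFun hv i)
      rw [ht, pow_succ]
      exact mul_dvd_mul_left _ this
  rcases Nat.eq_zero_or_pos d with rfl | hd
  · exact i.elim0
  · exact key d hd le_rfl i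

/-- The elements of `[0, P)` in a given class modulo `p`. -/
noncomputable def residueClass (p P : ℕ) (u : ZMod p) : Finset ℤ :=
  {x ∈ Ico (0 : ℤ) P | ((x : ℤ) : ZMod p) = u}

lemma prod_pow_sub (p d : ℕ) : ∏ j : Fin d, p ^ (d - (j.1 + 1)) = p ^ (d * (d - 1) / 2) := by
  rw [prod_pow_eq_pow_sum]
  congr 1
  rw [Fin.sum_univ_eq_sum_range (fun j => d - (j + 1)) d]
  have := sum_range_reflect (fun j => j) d
  rw [← sum_range_id, ← this]
  refine sum_congr rfl fun j _ => by lia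

/-- Linnik's lemma. -/
lemma card_congruence_solutions_le {p d P : ℕ} (hp : p.Prime) (hdp : d < p) (hP : P ≤ p ^ d)
    {u : Fin d → ZMod p} (hu : Function.Injective u) (w : ℤ) (c : Fin d → ℤ) :
    #{x ∈ Fintype.piFinset (fun i => residueClass p P (u i)) |
      ∀ j : Fin d, (p : ℤ) ^ (j.1 + 1) ∣ ∑ i, (x i - w) ^ (j.1 + 1) - c j} ≤
      p ^ (d * (d - 1) / 2) := by
  classical
  have hp0 : (p : ℤ) ≠ 0 := by exact_mod_cast hp.ne_zero
  have hpp : (0 : ℤ) < p := by exact_mod_cast hp.pos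
  -- The `j`-th power sum is prescribed modulo `p^j`; `F` records the missing digits up to modulus
  -- `p^d`. The digits determine `x` modulo `p^d` by `dvd_sub_of_powerSums`, hence determine `x`,
  -- since `P ≤ p^d`.
  set F : (Fin d → ℤ) → (Fin d → ℤ) := fun x j =>
    ((∑ i, (x i - w) ^ (j.1 + 1) - c j) / (p : ℤ) ^ (j.1 + 1)) % (p : ℤ) ^ (d - (j.1 + 1)) with hF
  set B : Finset (Fin d → ℤ) :=
    Fintype.piFinset fun j : Fin d => Ico (0 : ℤ) ((p ^ (d - (j.1 + 1)) : ℕ) : ℤ) with hB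
  have hBc : #B = p ^ (d * (d - 1) / 2) := by
    rw [hB, Fintype.card_piFinset, ← prod_pow_sub]
    refine prod_congr rfl fun j _ => ?_
    rw [Int.card_Ico, sub_zero, Int.toNat_natCast]
  rw [← hBc]
  refine card_le_card_of_injOn F (fun x hx => ?_) ?_
  · simp only [hB, hF, mem_coe, Fintype.mem_piFinset, mem_Ico]
    intro j
    push_cast
    exact ⟨Int.emod_nonneg _ (by positivity), Int.emod_lt_of_pos _ (by positivity)⟩
  · intro x hx y hy hxy
    simp only [coe_filter, Fintype.mem_piFinset, residueClass, mem_filter, mem_Ico,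
      Set.mem_ofPred_eq] at hx hy
    have hcls : ∀ i, (p : ℤ) ∣ y i - x i := fun i => by
      rw [← ZMod.intCast_zmod_eq_zero_iff_dvd, Int.cast_sub, (hx.1 i).2, (hy.1 i).2, sub_self]
    have hd : ∀ i, (p : ℤ) ^ d ∣ (y i - w) - (x i - w) := by
      refine dvd_sub_of_powerSums hp hdp ?_ (fun i => by simpa using hcls i) ?_
      · intro i i' hii
        apply hu
        simp only [Int.cast_sub] at hii
        rw [← (hx.1 i).2, ← (hx.1 i').2]
        exact sub_left_injective hii
      · intro j
        have h1 := congrFun hxy j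
        simp only [hF] at h1
        have h2 : (p : ℤ) ^ (d - (j.1 + 1)) ∣
            (∑ i, (y i - w) ^ (j.1 + 1) - c j) / (p : ℤ) ^ (j.1 + 1) -
            (∑ i, (x i - w) ^ (j.1 + 1) - c j) / (p : ℤ) ^ (j.1 + 1) :=
          Int.ModEq.dvd h1
        obtain ⟨a, ha⟩ := hx.2 j
        obtain ⟨b, hb⟩ := hy.2 j
        rw [ha, hb, Int.mul_ediv_cancel_left _ (by positivity),
          Int.mul_ediv_cancel_left _ (by positivity)] at h2
        have h3 : ∑ i, (y i - w) ^ (j.1 + 1) - ∑ i, (x i - w) ^ (j.1 + 1) =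
            (p : ℤ) ^ (j.1 + 1) * (b - a) := by linear_combination hb - ha
        rw [h3]
        have h4 : (p : ℤ) ^ d = (p : ℤ) ^ (j.1 + 1) * (p : ℤ) ^ (d - (j.1 + 1)) := by
          rw [← pow_add]; congr 1; have := j.2; lia
        rw [h4]
        exact mul_dvd_mul_left _ h2
    funext i
    have h5 := hd i
    have h6 : (P : ℤ) ≤ (p : ℤ) ^ d := by exact_mod_cast hP
    have h7 : y i - w - (x i - w) = 0 := by
      refine Int.eq_zero_of_abs_lt_dvd h5 ?_
      rw [abs_lt]
      constructor <;> linarith [(hx.1 i).1.1, (hx.1 i).1.2, (hy.1 i).1.1, (hy.1 i).1.2]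
    linarith

lemma card_residueClass_le {p : ℕ} (hp : 0 < p) (P : ℕ) (u : ZMod p) :
    #(residueClass p P u) ≤ P / p + 1 := by
  have : NeZero p := ⟨hp.ne'⟩
  have hpp : (0 : ℤ) < p := by exact_mod_cast hp
  have : #(Ico (0 : ℤ) ((P / p + 1 : ℕ) : ℤ)) = P / p + 1 := by
    rw [Int.card_Ico, sub_zero, Int.toNat_natCast]
  rw [← this]
  refine card_le_card_of_injOn (fun x => x / (p : ℤ)) (fun x hx => ?_) ?_
  · simp only [residueClass, coe_filter, mem_Ico, Set.mem_ofPred_eq] at hx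
    simp only [coe_Ico, Set.mem_Ico]
    refine ⟨Int.ediv_nonneg hx.1.1 hpp.le, ?_⟩
    push_cast
    have := Int.ediv_le_ediv hpp hx.1.2.le
    lia
  · intro x hx y hy hxy
    simp only [residueClass, coe_filter, mem_Ico, Set.mem_ofPred_eq] at hx hy
    have h : (x : ZMod p) = y := by rw [hx.2, hy.2]
    have h1 := (ZMod.intCast_eq_intCast_iff' _ _ _).1 h
    simp only at hxy
    rw [← Int.mul_ediv_add_emod x p, ← Int.mul_ediv_add_emod y p, hxy, h1]

/-- Writing `x = u + p x'`, translation and dilation invariance turn solutions in one class into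
solutions of the same system in the shorter range `[0, P/p + 1)`. -/
lemma powerEnergy_residueClass_le {p : ℕ} (hp : 0 < p) (s d P : ℕ) (u : ZMod p) :
    powerEnergy s d (residueClass p P u) ≤ meanValue s d (P / p + 1) := by
  have : NeZero p := ⟨hp.ne'⟩
  have hpp : (0 : ℤ) < p := by exact_mod_cast hp
  have hmod : ∀ x : ℤ, (x : ZMod p) = u → x = u.val + (p : ℤ) * (x / p) := by
    intro x hx
    conv_lhs => rw [← Int.emod_add_mul_ediv x p]
    rw [← ZMod.val_intCast, hx]
  refine card_le_card_of_injOn (fun z => (fun i => z.1 i / (p : ℤ), fun i => z.2 i / (p : ℤ)))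
    (fun z hz => ?_) ?_
  · simp only [residueClass, coe_filter, mem_product, Fintype.mem_piFinset, mem_filter, mem_Ico,
      Set.mem_ofPred_eq] at hz ⊢
    have hr : ∀ x : ℤ, 0 ≤ x → x < P → 0 ≤ x / p ∧ x / p < ((P / p + 1 : ℕ) : ℤ) := by
      intro x hx0 hx1
      refine ⟨Int.ediv_nonneg hx0 hpp.le, ?_⟩
      push_cast
      have := Int.ediv_le_ediv hpp hx1.le
      lia
    refine ⟨⟨fun i => hr _ (hz.1.1 i).1.1 (hz.1.1 i).1.2,
      fun i => hr _ (hz.1.2 i).1.1 (hz.1.2 i).1.2⟩, ?_⟩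
    funext j
    have h1 := sum_sub_pow_eq hz.2 (u.val : ℤ) (n := j.1 + 1) j.2
    have h2 : ∀ x : Fin s → ℤ, (∀ i, (x i : ZMod p) = u) →
        ∑ i, (x i - u.val) ^ (j.1 + 1) = (p : ℤ) ^ (j.1 + 1) * ∑ i, (x i / p) ^ (j.1 + 1) := by
      intro x hx
      rw [mul_sum]
      refine sum_congr rfl fun i _ => ?_
      rw [← mul_pow]
      congr 1
      linarith [hmod (x i) (hx i)]
    rw [h2 _ (fun i => (hz.1.1 i).2), h2 _ (fun i => (hz.1.2 i).2)] at h1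
    simpa [moment, Finset.sum_apply] using mul_left_cancel₀ (by positivity) h1
  · intro z hz z' hz' h
    simp only [residueClass, coe_filter, mem_product, Fintype.mem_piFinset, mem_filter, mem_Ico,
      Set.mem_ofPred_eq] at hz hz'
    rw [Prod.mk.injEq] at h
    refine Prod.ext ?_ ?_ <;> funext i
    · rw [hmod _ (hz.1.1 i).2, hmod _ (hz'.1.1 i).2]
      have := congrFun h.1 i
      rw [show z.1 i / (p : ℤ) = z'.1 i / p from this]
    · rw [hmod _ (hz.1.2 i).2, hmod _ (hz'.1.2 i).2]
      have := congrFun h.2 i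
      rw [show z.2 i / (p : ℤ) = z'.2 i / p from this]

open Classical in
/-- Either one term dominates a sum, or many terms are large. -/
lemma norm_sum_pow_le_broad_add_narrow {ι : Type*} [Fintype ι] {d : ℕ} (hd : 1 ≤ d) (s : ℕ)
    (z : ι → ℂ) :
    ‖∑ u, z u‖ ^ (2 * (d + s)) ≤ (2 * d : ℝ) ^ (2 * (d + s)) * ∑ u, ‖z u‖ ^ (2 * (d + s)) +
      (2 * Fintype.card ι : ℝ) ^ (2 * d) * ∑ u : Fin d → ι with Function.Injective u,
        (∏ i, ‖z (u i)‖ ^ 2) * ‖∑ v, z v‖ ^ (2 * s) := by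
  classical
  set A := ‖∑ u, z u‖ with hA
  have hA0 : 0 ≤ A := norm_nonneg _
  set p := Fintype.card ι with hp
  -- The terms outside `B` contribute at most `A / 2`. With at least `d` elements in `B`, `d`
  -- distinct terms are large; with fewer, a power mean over `B` gives the first term of the bound.
  set B : Finset ι := {u | A ≤ 2 * p * ‖z u‖} with hB
  rcases le_or_gt d #B with h | h
  · obtain ⟨e⟩ : Nonempty (Fin d ↪ B) := by
      apply Function.Embedding.nonempty_of_card_le
      simpa using h
    set u : Fin d → ι := fun i => (e i : ι) with hu
    have hui : Function.Injective u := fun i j hij => e.injective (Subtype.ext hij)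
    have h1 : A ^ (2 * d) ≤ (2 * p : ℝ) ^ (2 * d) * ∏ i, ‖z (u i)‖ ^ 2 := by
      calc A ^ (2 * d) = ∏ _i : Fin d, A ^ 2 := by rw [prod_const, card_univ, Fintype.card_fin,
              ← pow_mul]
        _ ≤ ∏ i : Fin d, (2 * p * ‖z (u i)‖) ^ 2 := by
            refine prod_le_prod (fun _ _ => by positivity) fun i _ => ?_
            have : A ≤ 2 * p * ‖z (u i)‖ := (mem_filter.1 (e i).2).2
            gcongr
        _ = _ := by
            rw [prod_congr rfl (fun i _ => mul_pow (2 * (p : ℝ)) ‖z (u i)‖ 2), prod_mul_distrib,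
              prod_const, card_univ, Fintype.card_fin, ← pow_mul]
    have h2 : (∏ i, ‖z (u i)‖ ^ 2) * A ^ (2 * s) ≤ ∑ u : Fin d → ι with Function.Injective u,
        (∏ i, ‖z (u i)‖ ^ 2) * A ^ (2 * s) :=
      single_le_sum (f := fun u : Fin d → ι => (∏ i, ‖z (u i)‖ ^ 2) * A ^ (2 * s))
        (fun _ _ => by positivity) (mem_filter.2 ⟨mem_univ u, hui⟩)
    have h3 : A ^ (2 * (d + s)) ≤ (2 * p : ℝ) ^ (2 * d) * ((∏ i, ‖z (u i)‖ ^ 2) * A ^ (2 * s)) := by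
      rw [mul_add, pow_add, ← mul_assoc]
      gcongr
    refine h3.trans (le_trans ?_ (le_add_of_nonneg_left (by positivity)))
    gcongr
  · refine le_trans ?_ (le_add_of_nonneg_right (by positivity))
    rcases Nat.eq_zero_or_pos p with h0 | h0
    · have : IsEmpty ι := Fintype.card_eq_zero_iff.1 h0
      have : A = 0 := by simp [hA]
      rw [this, zero_pow (by lia)]
      positivity
    have hp0 : (0 : ℝ) < p := by exact_mod_cast h0
    have h1 : A ≤ ∑ u ∈ B, ‖z u‖ + ∑ u ∈ univ.filter (fun u => ¬ A ≤ 2 * p * ‖z u‖), ‖z u‖ := by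
      rw [hB, sum_filter_add_sum_filter_not]
      exact norm_sum_le _ _
    have h2 : ∑ u ∈ univ.filter (fun u => ¬ A ≤ 2 * p * ‖z u‖), ‖z u‖ ≤ A / 2 := by
      calc _ ≤ ∑ u ∈ univ.filter (fun u => ¬ A ≤ 2 * p * ‖z u‖), A / (2 * p) := by
            refine sum_le_sum fun u hu => ?_
            have := (mem_filter.1 hu).2
            rw [le_div_iff₀ (by positivity)]
            linarith
        _ ≤ p * (A / (2 * p)) := by
            rw [sum_const, nsmul_eq_mul]
            have : #(univ.filter (fun u => ¬ A ≤ 2 * p * ‖z u‖)) ≤ p := card_le_univ _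
            gcongr
        _ = A / 2 := by field_simp
    have h3 : A ≤ 2 * ∑ u ∈ B, ‖z u‖ := by linarith
    have h4 := pow_sum_le_card_mul_sum_pow (s := B) (f := fun u => ‖z u‖)
      (fun _ _ => norm_nonneg _) (2 * (d + s) - 1)
    rw [show 2 * (d + s) - 1 + 1 = 2 * (d + s) by lia] at h4
    have hd1 : (1 : ℝ) ≤ d := by exact_mod_cast hd
    have hBd : (#B : ℝ) ≤ d := by exact_mod_cast h.le
    calc A ^ (2 * (d + s)) ≤ (2 * ∑ u ∈ B, ‖z u‖) ^ (2 * (d + s)) := by gcongr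
      _ = 2 ^ (2 * (d + s)) * (∑ u ∈ B, ‖z u‖) ^ (2 * (d + s)) := mul_pow _ _ _
      _ ≤ 2 ^ (2 * (d + s)) * ((d : ℝ) ^ (2 * (d + s)) * ∑ u, ‖z u‖ ^ (2 * (d + s))) := by
          gcongr
          refine h4.trans ?_
          gcongr
          · exact (pow_le_pow_left₀ (by positivity) hBd _).trans
              (pow_le_pow_right₀ hd1 (by lia))
          · exact subset_univ _
      _ = _ := by rw [mul_pow]; ring

/-- After translation by a representative of `w`, the last `s` variables are divisible by `p` and
contribute multiples of `p^j` to the `j`-th power sum. The first `d` variables therefore satisfy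
Linnik's congruences. Once they are fixed, the others solve a system with prescribed difference,
which by `card_sub_eq_le` has no more solutions than the homogeneous one. -/
lemma card_mixed_solutions_le {p d s P : ℕ} (hp : p.Prime) (hdp : d < p) (hP : P ≤ p ^ d)
    {u : Fin d → ZMod p} (hu : Function.Injective u) (w : ZMod p)
    {T : Finset ((Fin d → ℤ) × (Fin s → ℤ))}
    (hT : T = Fintype.piFinset (fun i => residueClass p P (u i)) ×ˢ
      Fintype.piFinset (fun _ : Fin s => residueClass p P w)) :
    #{z ∈ T ×ˢ T | (∑ i, moment d (z.1.1 i)) + (∑ i, moment d (z.1.2 i)) =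
        (∑ i, moment d (z.2.1 i)) + (∑ i, moment d (z.2.2 i))} ≤
      (P / p + 1) ^ d * p ^ (d * (d - 1) / 2) * meanValue s d (P / p + 1) := by
  classical
  have : NeZero p := ⟨hp.ne_zero⟩
  set X := Fintype.piFinset (fun i => residueClass p P (u i)) with hX
  set w₀ : ℤ := (w.val : ℤ) with hw₀
  set C : Finset ((Fin d → ℤ) × (Fin d → ℤ)) := {x ∈ X ×ˢ X | ∀ j : Fin d,
    (p : ℤ) ^ (j.1 + 1) ∣ ∑ i, (x.2 i - w₀) ^ (j.1 + 1) - ∑ i, (x.1 i - w₀) ^ (j.1 + 1)} with hC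
  have hCc : #C ≤ (P / p + 1) ^ d * p ^ (d * (d - 1) / 2) := by
    have hXc : #X ≤ (P / p + 1) ^ d := by
      rw [hX, Fintype.card_piFinset]
      calc _ ≤ ∏ _i : Fin d, (P / p + 1) := prod_le_prod' fun i _ => card_residueClass_le hp.pos _ _
        _ = _ := by simp
    rw [hC, card_filter, sum_product]
    calc _ ≤ ∑ x ∈ X, p ^ (d * (d - 1) / 2) := by
          refine sum_le_sum fun x _ => ?_
          rw [← card_filter]
          exact card_congruence_solutions_le hp hdp hP hu w₀
            (fun j => ∑ i, (x i - w₀) ^ (j.1 + 1))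
      _ ≤ _ := by
          rw [sum_const, smul_eq_mul]
          gcongr
  have hres : ∀ x : ℤ, (x : ZMod p) = w → (p : ℤ) ∣ x - w₀ := by
    intro x hx
    rw [← ZMod.intCast_zmod_eq_zero_iff_dvd, Int.cast_sub, hx, hw₀]
    simp
  have hmain := card_le_mul_card_image_of_maps_to
    (s := {z ∈ T ×ˢ T | (∑ i, moment d (z.1.1 i)) + (∑ i, moment d (z.1.2 i)) =
        (∑ i, moment d (z.2.1 i)) + (∑ i, moment d (z.2.2 i))}) (t := C)
    (f := fun z => (z.1.1, z.2.1)) ?_ (meanValue s d (P / p + 1)) ?_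
  · refine hmain.trans ?_
    rw [mul_comm]
    gcongr
  · intro z hz
    simp only [mem_filter, mem_product, hT] at hz
    refine mem_filter.2 ⟨mem_product.2 ⟨hz.1.1.1, hz.1.2.1⟩, fun j => ?_⟩
    have h1 : ∑ i, moment d (Sum.elim z.1.1 z.1.2 i) = ∑ i, moment d (Sum.elim z.2.1 z.2.2 i) := by
      simpa [Fintype.sum_sum_type] using hz.2
    have h2 := sum_sub_pow_eq h1 w₀ (n := j.1 + 1) j.2
    simp only [Fintype.sum_sum_type, Sum.elim_inl, Sum.elim_inr] at h2
    have h3 : ∑ i, (z.2.1 i - w₀) ^ (j.1 + 1) - ∑ i, (z.1.1 i - w₀) ^ (j.1 + 1) =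
        ∑ i, (z.1.2 i - w₀) ^ (j.1 + 1) - ∑ i, (z.2.2 i - w₀) ^ (j.1 + 1) := by
      linarith
    rw [h3]
    refine dvd_sub (dvd_sum fun i _ => pow_dvd_pow_of_dvd (hres _ ?_) _)
      (dvd_sum fun i _ => pow_dvd_pow_of_dvd (hres _ ?_) _)
    · exact (mem_filter.1 (Fintype.mem_piFinset.1 hz.1.1.2 i)).2
    · exact (mem_filter.1 (Fintype.mem_piFinset.1 hz.1.2.2 i)).2
  · rintro ⟨x, x'⟩ _
    refine le_trans ?_ (powerEnergy_residueClass_le hp.pos s d P w)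
    refine le_trans ?_ (card_sub_eq_le (Fintype.piFinset (fun _ : Fin s => residueClass p P w))
      (fun y => ∑ i, moment d (y i)) (∑ i, moment d (x' i) - ∑ i, moment d (x i)))
    refine card_le_card_of_injOn (fun z => (z.1.2, z.2.2)) (fun z hz => ?_) ?_
    · simp only [coe_filter, mem_filter, mem_product, hT, Set.mem_ofPred_eq, Prod.mk.injEq] at hz ⊢
      refine ⟨⟨hz.1.1.1.2, hz.1.1.2.2⟩, ?_⟩
      rw [← hz.2.1, ← hz.2.2, sub_eq_sub_iff_add_eq_add, add_comm, hz.1.2, add_comm]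
    · rintro ⟨⟨a, b⟩, ⟨a', b'⟩⟩ hz ⟨⟨e, g⟩, ⟨e', g'⟩⟩ hz' h
      simp only [coe_filter, mem_filter, Set.mem_ofPred_eq, Prod.mk.injEq] at hz hz' h ⊢
      exact ⟨⟨hz.2.1.trans hz'.2.1.symm, h.1⟩, ⟨hz.2.2.trans hz'.2.2.symm, h.2⟩⟩

/-- The recursion step in Vinogradov's mean value theorem. -/
lemma meanValue_add_le {p d s P : ℕ} (hp : p.Prime) (hd : 1 ≤ d) (hs : 1 ≤ s) (hdp : d < p)
    (hP : P ≤ p ^ d) :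
    (meanValue (d + s) d P : ℝ) ≤
      ((2 * d : ℝ) ^ (2 * (d + s)) * (p * ((P / p + 1 : ℕ) : ℝ) ^ (2 * d)) +
      (2 * p : ℝ) ^ (2 * d) * (p ^ d * (p ^ (2 * s) *
        (((P / p + 1 : ℕ) : ℝ) ^ d * p ^ (d * (d - 1) / 2))))) * meanValue s d (P / p + 1) := by
  classical
  have : NeZero p := ⟨hp.ne_zero⟩
  set M := P / p + 1 with hM
  -- This modulus exceeds every power sum that occurs, so equations in `ℤ` can be tested in the
  -- finite group `(ℤ/N)^d` and averaging over its characters replaces integration.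
  set N := (d + s) * P ^ d + 1 with hN
  let c : (Fin d → ℤ) →+ (Fin d → ZMod N) :=
    { toFun := fun v j => (v j : ZMod N)
      map_zero' := by funext j; simp
      map_add' := fun v w => by funext j; simp }
  have hc : ∀ v w : Fin d → ℤ, (∀ j, 0 ≤ v j ∧ v j < N) → (∀ j, 0 ≤ w j ∧ w j < N) →
      c v = c w → v = w := by
    intro v w hv hw h
    funext j
    have h1 : ((v j : ℤ) : ZMod N) = w j := congrFun h j
    rw [ZMod.intCast_eq_intCast_iff'] at h1
    rwa [Int.emod_eq_of_lt (hv j).1 (hv j).2, Int.emod_eq_of_lt (hw j).1 (hw j).2] at h1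
  set f : ℤ → (Fin d → ZMod N) := fun x => c (moment d x) with hf
  have hmom : ∀ x ∈ Ico (0 : ℤ) P, ∀ j, 0 ≤ moment d x j ∧ moment d x j ≤ (P : ℤ) ^ d := by
    intro x hx j
    rw [mem_Ico] at hx
    refine ⟨pow_nonneg hx.1 _, ?_⟩
    calc x ^ (j.1 + 1) ≤ (P : ℤ) ^ (j.1 + 1) := pow_le_pow_left₀ hx.1 hx.2.le _
      _ ≤ (P : ℤ) ^ d := pow_le_pow_right₀ (by lia) j.2
  have hsum : ∀ (m : ℕ) (x : Fin m → ℤ), (∀ i, x i ∈ Ico (0 : ℤ) P) → ∀ j,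
      0 ≤ (∑ i, moment d (x i)) j ∧ (∑ i, moment d (x i)) j ≤ m * (P : ℤ) ^ d := by
    intro m x hx j
    rw [Finset.sum_apply]
    refine ⟨sum_nonneg fun i _ => (hmom _ (hx i) j).1, ?_⟩
    calc _ ≤ ∑ i : Fin m, (P : ℤ) ^ d := sum_le_sum fun i _ => (hmom _ (hx i) j).2
      _ = _ := by simp
  set S : AddChar (Fin d → ZMod N) ℂ → ℂ := fun ψ => ∑ x ∈ Ico (0 : ℤ) P, ψ (f x) with hS
  set R : AddChar (Fin d → ZMod N) ℂ → ZMod p → ℂ :=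
    fun ψ u => ∑ x ∈ residueClass p P u, ψ (f x) with hR
  have hSR : ∀ ψ, S ψ = ∑ u, R ψ u := fun ψ => by
    simp only [hS, hR, residueClass]
    rw [sum_fiberwise]
  have hcf : ∀ (m : ℕ) (x : Fin m → ℤ), ∑ i, f (x i) = c (∑ i, moment d (x i)) := fun m x => by
    rw [map_sum]
  set g : ℝ := (Fintype.card (Fin d → ZMod N) : ℝ) with hg
  have hg0 : 0 < g := by rw [hg]; exact_mod_cast Fintype.card_pos
  have hmem : ∀ u : ZMod p, ∀ x ∈ residueClass p P u, x ∈ Ico (0 : ℤ) P :=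
    fun u x hx => (mem_filter.1 hx).1
  have h1 : g * meanValue (d + s) d P ≤ ∑ ψ, ‖S ψ‖ ^ (2 * (d + s)) := by
    have h11 : ∀ ψ, ‖S ψ‖ ^ (2 * (d + s)) =
        ‖∑ x ∈ Fintype.piFinset (fun _ : Fin (d + s) => Ico (0 : ℤ) P), ψ (∑ i, f (x i))‖ ^ 2 := by
      intro ψ
      rw [← pow_sum_addChar, norm_pow, ← pow_mul, mul_comm 2]
    simp_rw [h11]
    rw [sum_addChar_norm_sq]
    refine mul_le_mul_of_nonneg_left ?_ hg0.le
    have : meanValue (d + s) d P ≤ _ := card_le_card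
      (s := {z ∈ Fintype.piFinset (fun _ : Fin (d + s) => Ico (0 : ℤ) P) ×ˢ
        Fintype.piFinset (fun _ : Fin (d + s) => Ico (0 : ℤ) P) |
        ∑ i, moment d (z.1 i) = ∑ i, moment d (z.2 i)})
      (t := {z ∈ Fintype.piFinset (fun _ : Fin (d + s) => Ico (0 : ℤ) P) ×ˢ
        Fintype.piFinset (fun _ : Fin (d + s) => Ico (0 : ℤ) P) |
        ∑ i, f (z.1 i) = ∑ i, f (z.2 i)})
      (monotone_filter_right _ fun z _ hz => by
        rw [hcf, hcf, hz])
    exact_mod_cast this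
  have h2 : ∀ u : ZMod p, ∑ ψ, ‖R ψ u‖ ^ (2 * (d + s)) ≤
      (M : ℝ) ^ (2 * d) * (g * meanValue s d M) := by
    intro u
    have h21 : ∀ ψ, ‖R ψ u‖ ^ (2 * (d + s)) ≤ (M : ℝ) ^ (2 * d) *
        ‖∑ x ∈ Fintype.piFinset (fun _ : Fin s => residueClass p P u), ψ (∑ i, f (x i))‖ ^ 2 := by
      intro ψ
      rw [← pow_sum_addChar, norm_pow, ← pow_mul, mul_comm s, mul_add, pow_add]
      gcongr
      calc ‖R ψ u‖ ≤ ∑ x ∈ residueClass p P u, ‖ψ (f x)‖ := norm_sum_le _ _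
        _ = #(residueClass p P u) := by simp [AddChar.norm_apply]
        _ ≤ M := by exact_mod_cast card_residueClass_le hp.pos P u
    refine (sum_le_sum fun ψ _ => h21 ψ).trans ?_
    rw [← mul_sum, sum_addChar_norm_sq]
    gcongr
    refine le_trans ?_ (powerEnergy_residueClass_le hp.pos s d P u)
    refine card_le_card (monotone_filter_right _ fun z hz h => ?_)
    rw [hcf, hcf] at h
    rw [mem_product, Fintype.mem_piFinset, Fintype.mem_piFinset] at hz
    have hb : ∀ x : Fin s → ℤ, (∀ i, x i ∈ residueClass p P u) → ∀ j,
        0 ≤ (∑ i, moment d (x i)) j ∧ (∑ i, moment d (x i)) j < N := by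
      intro x hx j
      have := hsum s x (fun i => hmem u _ (hx i)) j
      refine ⟨this.1, ?_⟩
      rw [hN]; push_cast
      have : (0 : ℤ) ≤ d * (P : ℤ) ^ d := by positivity
      linarith
    exact hc _ _ (hb _ hz.1) (hb _ hz.2) h
  have h3 : ∀ u : Fin d → ZMod p, Function.Injective u → ∀ w : ZMod p,
      ∑ ψ, (∏ i, ‖R ψ (u i)‖ ^ 2) * ‖R ψ w‖ ^ (2 * s) ≤
        g * ((M : ℝ) ^ d * p ^ (d * (d - 1) / 2) * meanValue s d M) := by
    intro u hu w
    have h31 : ∀ ψ, (∏ i, ‖R ψ (u i)‖ ^ 2) * ‖R ψ w‖ ^ (2 * s) =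
        ‖∑ z ∈ Fintype.piFinset (fun i => residueClass p P (u i)) ×ˢ
          Fintype.piFinset (fun _ : Fin s => residueClass p P w),
            ψ (∑ i, f (z.1 i) + ∑ i, f (z.2 i))‖ ^ 2 := by
      intro ψ
      simp_rw [AddChar.map_add_eq_mul]
      rw [sum_product]
      simp only
      rw [← sum_mul_sum, ← prod_sum_addChar, ← pow_sum_addChar, norm_mul, norm_pow,
        norm_prod, mul_pow, ← pow_mul, mul_comm s, prod_pow]
    simp_rw [h31]
    rw [sum_addChar_norm_sq]
    gcongr
    have := card_mixed_solutions_le (s := s) hp hdp hP hu w rfl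
    have hcast : (M : ℝ) ^ d * p ^ (d * (d - 1) / 2) * meanValue s d M =
        ((M ^ d * p ^ (d * (d - 1) / 2) * meanValue s d M : ℕ) : ℝ) := by push_cast; rfl
    rw [hcast]
    refine Nat.cast_le.2 (le_trans (card_le_card (monotone_filter_right _ fun z hz h => ?_)) this)
    rw [hcf, hcf, hcf, hcf, ← map_add, ← map_add] at h
    simp only [mem_product, Fintype.mem_piFinset] at hz
    have hb : ∀ (x : Fin d → ℤ) (y : Fin s → ℤ), (∀ i, x i ∈ residueClass p P (u i)) →
        (∀ i, y i ∈ residueClass p P w) → ∀ j,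
        0 ≤ (∑ i, moment d (x i) + ∑ i, moment d (y i)) j ∧
          (∑ i, moment d (x i) + ∑ i, moment d (y i)) j < N := by
      intro x y hx hy j
      have h1 := hsum d x (fun i => hmem _ _ (hx i)) j
      have h2 := hsum s y (fun i => hmem _ _ (hy i)) j
      rw [Pi.add_apply]
      refine ⟨add_nonneg h1.1 h2.1, ?_⟩
      rw [hN]; push_cast
      linarith [h1.2, h2.2]
    exact hc _ _ (hb _ _ hz.1.1 hz.1.2) (hb _ _ hz.2.1 hz.2.2) h
  have h4 : ∀ u : Fin d → ZMod p, Function.Injective u →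
      ∑ ψ, (∏ i, ‖R ψ (u i)‖ ^ 2) * ‖S ψ‖ ^ (2 * s) ≤
        (p : ℝ) ^ (2 * s) * (g * ((M : ℝ) ^ d * p ^ (d * (d - 1) / 2) * meanValue s d M)) := by
    intro u hu
    -- Hölder over the classes `w` puts the remaining `2s` factors into a single class, as `h3`
    -- requires.
    have h41 : ∀ ψ, (∏ i, ‖R ψ (u i)‖ ^ 2) * ‖S ψ‖ ^ (2 * s) ≤
        (p : ℝ) ^ (2 * s - 1) * ∑ w, (∏ i, ‖R ψ (u i)‖ ^ 2) * ‖R ψ w‖ ^ (2 * s) := by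
      intro ψ
      rw [← mul_sum, mul_left_comm]
      gcongr
      have := pow_sum_le_card_mul_sum_pow (s := univ) (f := fun w => ‖R ψ w‖)
        (fun _ _ => norm_nonneg _) (2 * s - 1)
      rw [show 2 * s - 1 + 1 = 2 * s by lia, card_univ, ZMod.card] at this
      refine le_trans ?_ this
      gcongr
      rw [hSR]
      exact norm_sum_le _ _
    refine (sum_le_sum fun ψ _ => h41 ψ).trans ?_
    rw [← mul_sum, sum_comm]
    calc _ ≤ (p : ℝ) ^ (2 * s - 1) * ∑ w : ZMod p,
          g * ((M : ℝ) ^ d * p ^ (d * (d - 1) / 2) * meanValue s d M) := by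
          gcongr with w
          exact h3 u hu w
      _ = _ := by
          rw [sum_const, card_univ, ZMod.card, nsmul_eq_mul, ← mul_assoc, ← pow_succ,
            show 2 * s - 1 + 1 = 2 * s by lia]
  have h5 : g * meanValue (d + s) d P ≤
      (2 * d : ℝ) ^ (2 * (d + s)) * ∑ u : ZMod p, (M : ℝ) ^ (2 * d) * (g * meanValue s d M) +
      (2 * p : ℝ) ^ (2 * d) * ∑ u : Fin d → ZMod p with Function.Injective u,
        (p : ℝ) ^ (2 * s) * (g * ((M : ℝ) ^ d * p ^ (d * (d - 1) / 2) * meanValue s d M)) := by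
    refine h1.trans ?_
    have h51 : ∀ ψ, ‖S ψ‖ ^ (2 * (d + s)) ≤
        (2 * d : ℝ) ^ (2 * (d + s)) * ∑ u, ‖R ψ u‖ ^ (2 * (d + s)) +
        (2 * p : ℝ) ^ (2 * d) * ∑ u : Fin d → ZMod p with Function.Injective u,
          (∏ i, ‖R ψ (u i)‖ ^ 2) * ‖S ψ‖ ^ (2 * s) := fun ψ => by
      have := norm_sum_pow_le_broad_add_narrow hd s (R ψ)
      rw [← hSR, ZMod.card] at this
      convert this
    refine (sum_le_sum fun ψ _ => h51 ψ).trans ?_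
    rw [sum_add_distrib, ← mul_sum, ← mul_sum, sum_comm, sum_comm (s := univ) (t := univ.filter _)]
    gcongr with u _ u hu
    · exact h2 u
    · exact h4 u (mem_filter.1 hu).2
  have h6 : (#{u : Fin d → ZMod p | Function.Injective u} : ℝ) ≤ (p : ℝ) ^ d := by
    have : #{u : Fin d → ZMod p | Function.Injective u} ≤ p ^ d := by
      refine (card_le_univ _).trans ?_
      simp [ZMod.card]
    exact_mod_cast this
  rw [sum_const, sum_const, card_univ, ZMod.card, nsmul_eq_mul, nsmul_eq_mul] at h5
  have h7 : g * meanValue (d + s) d P ≤ g * (((2 * d : ℝ) ^ (2 * (d + s)) *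
      (p * (M : ℝ) ^ (2 * d)) + (2 * p : ℝ) ^ (2 * d) * (p ^ d * (p ^ (2 * s) *
        ((M : ℝ) ^ d * p ^ (d * (d - 1) / 2))))) * meanValue s d M) := by
    refine h5.trans ?_
    have hsplit : ∀ a b c e : ℝ, g * ((a * (p * b) + c * (p ^ d * e)) * meanValue s d M) =
        a * (p * (b * (g * meanValue s d M))) + c * (p ^ d * (g * (e * meanValue s d M))) := by
      intros; ring
    rw [hsplit]
    refine add_le_add le_rfl ?_
    have hassoc : (p : ℝ) ^ (2 * s) * (g * ((M : ℝ) ^ d * p ^ (d * (d - 1) / 2) *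
        meanValue s d M)) = g * (p ^ (2 * s) * ((M : ℝ) ^ d * p ^ (d * (d - 1) / 2)) *
        meanValue s d M) := by ring
    rw [hassoc]
    gcongr
  exact le_of_mul_le_mul_left h7 hg0

/-! ### Iterating the mean value recursion. -/

/-- Linnik's lemma needs `p > d` and `p^d ≥ P`, while the exponents need `p ≪ P^(1/d)`. Bertrand's
postulate supplies both. -/
lemma exists_prime_rpow_bounds {d : ℕ} (hd : 1 ≤ d) {P : ℕ} (hP : 1 ≤ P) :
    ∃ p : ℕ, p.Prime ∧ d < p ∧ (P : ℝ) ^ (1 / d : ℝ) ≤ p ∧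
      (p : ℝ) ≤ 2 * (d + 3) * (P : ℝ) ^ (1 / d : ℝ) := by
  set Y := (P : ℝ) ^ (1 / d : ℝ) with hY
  have hP1 : (1 : ℝ) ≤ P := by exact_mod_cast hP
  have hY1 : 1 ≤ Y := Real.one_le_rpow hP1 (by positivity)
  obtain ⟨p, hp, h1, h2⟩ := Nat.exists_prime_lt_and_le_two_mul (⌈Y⌉₊ + d + 1) (by lia)
  have h3 := Nat.ceil_lt_add_one (a := Y) (by linarith)
  have h4 := Nat.le_ceil Y
  refine ⟨p, hp, by lia, ?_, ?_⟩
  · have : ((⌈Y⌉₊ : ℕ) : ℝ) ≤ p := by exact_mod_cast (by lia : ⌈Y⌉₊ ≤ p)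
    linarith
  · have : (p : ℝ) ≤ 2 * (⌈Y⌉₊ + d + 1) := by exact_mod_cast h2
    have hd0 : (0 : ℝ) ≤ d := by positivity
    nlinarith

/-- With `p ≍ Y = P^(1/d)` the recursion passes to length `≪ Y^(d-1)`, which shrinks the excess `δ`
by the factor `1 - 1/d`. The broad/narrow inequality costs an extra `p^(2d) ≍ P²`, hence the `+ 2`.
The assumption `d² ≤ s` makes the narrow term no larger than the broad one. -/
lemma meanValue_rpow_step {d s : ℕ} (hd : 1 ≤ d) (hs : d ^ 2 ≤ s) {δ : ℝ} (hδ : 0 ≤ δ)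
    (h : ∃ C : ℝ, 0 < C ∧ ∀ P : ℕ, 1 ≤ P →
      (meanValue s d P : ℝ) ≤ C * (P : ℝ) ^ (2 * s - d * (d + 1) / 2 + δ)) :
    ∃ C : ℝ, 0 < C ∧ ∀ P : ℕ, 1 ≤ P →
      (meanValue (d + s) d P : ℝ) ≤
        C * (P : ℝ) ^ (2 * ((d + s : ℕ) : ℝ) - d * (d + 1) / 2 + ((1 - 1 / d) * δ + 2)) := by
  obtain ⟨C, hC, hJ⟩ := h
  have hd1 : (1 : ℝ) ≤ d := by exact_mod_cast hd
  have hsd : (d : ℝ) ^ 2 ≤ s := by exact_mod_cast hs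
  have hs1 : 1 ≤ s := le_trans (Nat.one_le_pow _ _ hd) hs
  set E : ℝ := 2 * s - d * (d + 1) / 2 + δ with hE
  have hE0 : 0 ≤ E := by nlinarith
  set c : ℝ := 2 * (d + 3) with hc
  set e := d * (d - 1) / 2 with he
  have he2 : (2 : ℝ) * e = d * (d - 1) := by
    have h1 : 2 * e = d * (d - 1) := by
      rw [he]; exact Nat.mul_div_cancel' (Nat.even_mul_pred_self d).two_dvd
    have h2 : ((2 * e : ℕ) : ℝ) = ((d * (d - 1) : ℕ) : ℝ) := by rw [h1]
    push_cast [Nat.cast_sub hd] at h2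
    exact h2
  set K₁ : ℝ := (2 * d : ℝ) ^ (2 * (d + s)) * (c * 2 ^ (2 * d)) with hK₁
  set K₂ : ℝ := (2 * c) ^ (2 * d) * (c ^ d * (c ^ (2 * s) * (2 ^ d * c ^ e))) with hK₂
  refine ⟨(K₁ + K₂) * (C * 2 ^ E), by positivity, fun P hP => ?_⟩
  obtain ⟨p, hp, hdp, hYp, hpY⟩ := exists_prime_rpow_bounds hd hP
  set Y := (P : ℝ) ^ (1 / d : ℝ) with hY
  have hP1 : (1 : ℝ) ≤ P := by exact_mod_cast hP
  have hY1 : 1 ≤ Y := Real.one_le_rpow hP1 (by positivity)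
  have hY0 : 0 < Y := by linarith
  have hYd : Y ^ d = P := by
    rw [hY, ← Real.rpow_natCast, ← Real.rpow_mul (by positivity)]
    rw [one_div_mul_cancel (by positivity), Real.rpow_one]
  have hp0 : (0 : ℝ) < p := by exact_mod_cast hp.pos
  have hPp : P ≤ p ^ d := by
    have : (P : ℝ) ≤ (p : ℝ) ^ d := by rw [← hYd]; gcongr
    exact_mod_cast this
  set M := P / p + 1 with hM
  have hMY : (M : ℝ) ≤ 2 * Y ^ (d - 1) := by
    have h1 : ((P / p : ℕ) : ℝ) ≤ P / p := Nat.cast_div_le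
    have h2 : (P : ℝ) / p ≤ Y ^ (d - 1) := by
      rw [div_le_iff₀ hp0, ← hYd]
      calc Y ^ d = Y ^ (d - 1) * Y := by rw [← pow_succ]; congr 1; lia
        _ ≤ _ := by gcongr
    have h3 : (1 : ℝ) ≤ Y ^ (d - 1) := one_le_pow₀ hY1
    rw [hM]; push_cast; linarith
  have hJM : (meanValue s d M : ℝ) ≤ C * 2 ^ E * Y ^ ((d - 1) * E) := by
    refine (hJ M (by lia)).trans ?_
    rw [mul_assoc]
    gcongr
    calc (M : ℝ) ^ E ≤ (2 * Y ^ (d - 1)) ^ E := Real.rpow_le_rpow (by positivity) hMY hE0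
      _ = 2 ^ E * Y ^ ((d - 1) * E) := by
        rw [Real.mul_rpow (by positivity) (by positivity), ← Real.rpow_natCast Y,
          ← Real.rpow_mul hY0.le, Nat.cast_sub hd, Nat.cast_one]
  set a := 2 * d + d + 2 * s + (d - 1) * d + e with ha
  have hfac : (2 * d : ℝ) ^ (2 * (d + s)) * (p * (M : ℝ) ^ (2 * d)) +
      (2 * p : ℝ) ^ (2 * d) * (p ^ d * (p ^ (2 * s) * ((M : ℝ) ^ d * p ^ e))) ≤
      (K₁ + K₂) * Y ^ a := by
    rw [add_mul]
    refine add_le_add ?_ ?_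
    · calc _ ≤ (2 * d : ℝ) ^ (2 * (d + s)) * ((c * Y) * (2 * Y ^ (d - 1)) ^ (2 * d)) := by gcongr
        _ = K₁ * Y ^ (1 + (d - 1) * (2 * d)) := by
          rw [hK₁, mul_pow (2 : ℝ) (Y ^ (d - 1)), ← pow_mul, pow_add, pow_one]; ring
        _ ≤ K₁ * Y ^ a := by
          refine mul_le_mul_of_nonneg_left (pow_le_pow_right₀ hY1 ?_) (by positivity)
          rw [ha]
          have : (d - 1) * d ≤ s := le_trans (by rw [pow_two]; gcongr; lia) hs
          have : (d - 1) * (2 * d) = 2 * ((d - 1) * d) := by ring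
          lia
    · calc _ ≤ (2 * (c * Y)) ^ (2 * d) * ((c * Y) ^ d * ((c * Y) ^ (2 * s) *
            ((2 * Y ^ (d - 1)) ^ d * (c * Y) ^ e))) := by gcongr
        _ = K₂ * Y ^ a := by
          rw [hK₂, ha]
          simp only [mul_pow, pow_add, ← pow_mul]
          ring
  have hrec := meanValue_add_le (d := d) (s := s) (P := P) hp hd hs1 hdp hPp
  rw [← hM, ← he] at hrec
  calc (meanValue (d + s) d P : ℝ) ≤ ((K₁ + K₂) * Y ^ a) * (C * 2 ^ E * Y ^ ((d - 1) * E)) := by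
        refine hrec.trans ?_
        gcongr
    _ = (K₁ + K₂) * (C * 2 ^ E) * Y ^ (a + (d - 1) * E) := by
        rw [Real.rpow_add hY0, Real.rpow_natCast]; ring
    _ = _ := by
        congr 1
        rw [hY, ← Real.rpow_mul (by positivity)]
        congr 1
        rw [one_div_mul_eq_div, div_eq_iff (by positivity), ha, hE]
        push_cast [Nat.cast_sub hd]
        have : ((1 - 1 / (d : ℝ)) * δ) * d = (d - 1) * δ := by field_simp
        linear_combination he2 / 2 - this

lemma meanValue_le_pow (s d P : ℕ) : meanValue s d P ≤ P ^ (2 * s) := by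
  refine (card_filter_le _ _).trans (le_of_eq ?_)
  rw [card_product, Fintype.card_piFinset, prod_const, Int.card_Ico, sub_zero, Int.toNat_natCast,
    card_univ, Fintype.card_fin, two_mul, pow_add]

/-- The map `δ ↦ (1 - 1/d)δ + 2` has fixed point `2d`; the iteration starts from the trivial excess
`d(d+1)/2` at `s = d²`. -/
lemma meanValue_rpow_bound {d : ℕ} (hd : 1 ≤ d) (l : ℕ) :
    ∃ C : ℝ, 0 < C ∧ ∀ P : ℕ, 1 ≤ P → (meanValue (d * l + d ^ 2) d P : ℝ) ≤
      C * (P : ℝ) ^ (2 * ((d * l + d ^ 2 : ℕ) : ℝ) - d * (d + 1) / 2 +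
        ((1 - 1 / d : ℝ) ^ l * (d * (d + 1) / 2) + 2 * d * (1 - (1 - 1 / d : ℝ) ^ l))) := by
  have hd1 : (1 : ℝ) ≤ d := by exact_mod_cast hd
  induction l with
  | zero =>
    refine ⟨1, one_pos, fun P hP => ?_⟩
    have h := meanValue_le_pow (d * 0 + d ^ 2) d P
    have h2 : (meanValue (d * 0 + d ^ 2) d P : ℝ) ≤ (P : ℝ) ^ (2 * (d * 0 + d ^ 2)) := by
      exact_mod_cast h
    refine h2.trans (le_of_eq ?_)
    rw [one_mul, ← Real.rpow_natCast]
    congr 1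
    push_cast
    ring
  | succ l ih =>
    have hr0 : 0 ≤ 1 - 1 / (d : ℝ) := by
      rw [sub_nonneg, div_le_one (by linarith)]; exact hd1
    have hr1 : 1 - 1 / (d : ℝ) ≤ 1 := by
      have : 0 ≤ 1 / (d : ℝ) := by positivity
      linarith
    have hr : (1 - 1 / (d : ℝ)) ^ l ≤ 1 := pow_le_one₀ hr0 hr1
    have := meanValue_rpow_step hd (s := d * l + d ^ 2) (by lia)
      (add_nonneg (mul_nonneg (pow_nonneg hr0 l) (by positivity))
        (mul_nonneg (by positivity) (by linarith))) ih
    rw [show d + (d * l + d ^ 2) = d * (l + 1) + d ^ 2 by ring] at this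
    have hexp : ∀ r : ℝ, (1 - 1 / (d : ℝ)) * (r * (d * (d + 1) / 2) + 2 * d * (1 - r)) + 2 =
        r * (1 - 1 / (d : ℝ)) * (d * (d + 1) / 2) + 2 * d * (1 - r * (1 - 1 / (d : ℝ))) := by
      intro r; field_simp; ring
    simp_rw [pow_succ, ← hexp]
    exact this

/-- Vinogradov's mean value theorem with a loss of `P^(n²/4)` for degree `8n`. -/
theorem vinogradov_mean_value {n : ℕ} (hn : 128 ≤ n) :
    ∃ C : ℝ, 0 < C ∧ ∀ P : ℕ, 1 ≤ P → (meanValue (448 * n ^ 2) (8 * n) P : ℝ) ≤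
      C * (P : ℝ) ^ (896 * (n : ℝ) ^ 2 - 8 * n * (8 * n + 1) / 2 + (n : ℝ) ^ 2 / 4) := by
  -- With `d = 8n`, `6d` iterations make the factor `(1 - 1/d)^(6d)` at most `e^(-6) < 1/300` and
  -- give `s = 6d² + d² = 448n²`.
  obtain ⟨C, hC, h⟩ := meanValue_rpow_bound (d := 8 * n) (by lia) (6 * (8 * n))
  refine ⟨C, hC, fun P hP => ?_⟩
  have h1 := h P hP
  rw [show 8 * n * (6 * (8 * n)) + (8 * n) ^ 2 = 448 * n ^ 2 by ring] at h1
  refine h1.trans ?_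
  have hP1 : (1 : ℝ) ≤ P := by exact_mod_cast hP
  have hn1 : (128 : ℝ) ≤ n := by exact_mod_cast hn
  refine mul_le_mul_of_nonneg_left (Real.rpow_le_rpow_of_exponent_le hP1 ?_) hC.le
  · push_cast
    have hr0 : 0 ≤ 1 - 1 / (8 * n : ℝ) := by
      rw [sub_nonneg, div_le_one (by linarith)]; linarith
    have h2 : (1 - 1 / (8 * n : ℝ)) ^ (6 * (8 * n)) ≤ 1 / 300 := by
      have h3 : 1 - 1 / (8 * n : ℝ) ≤ Real.exp (-(1 / (8 * n : ℝ))) :=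
        Real.one_sub_le_exp_neg _
      calc _ ≤ (Real.exp (-(1 / (8 * n : ℝ)))) ^ (6 * (8 * n)) := by gcongr
        _ = Real.exp (-6) := by
          rw [← Real.exp_nat_mul]
          congr 1
          push_cast
          field_simp
        _ ≤ 1 / 300 := by
          rw [Real.exp_neg, ← one_div]
          apply one_div_le_one_div_of_le (by norm_num)
          have h4 : (2.7 : ℝ) ≤ Real.exp 1 := by linarith [Real.exp_one_gt_d9]
          calc (300 : ℝ) ≤ 2.7 ^ 6 := by norm_num
            _ ≤ (Real.exp 1) ^ 6 := by gcongr
            _ = Real.exp 6 := by rw [← Real.exp_nat_mul]; norm_num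
    have h5 : 0 ≤ (1 - 1 / (8 * n : ℝ)) ^ (6 * (8 * n)) := pow_nonneg hr0 _
    -- The excess is at most about `32n²/300 + 16n`; since `n ≥ 128`, the second term is at most
    -- `n²/8`.
    nlinarith

/-! ### Vinogradov's double Hölder argument -/

lemma norm_sum_addChar_pow {G : Type*} [AddCommGroup G] [Finite G] (ψ : AddChar G ℂ)
    (A : Finset ℤ) (f : ℤ → G) (s : ℕ) :
    ((‖∑ x ∈ A, ψ (f x)‖ ^ (2 * s) : ℝ) : ℂ) =
      ∑ z ∈ Fintype.piFinset (fun _ : Fin s => A) ×ˢ Fintype.piFinset (fun _ : Fin s => A),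
        ψ (∑ i, f (z.1 i) - ∑ i, f (z.2 i)) := by
  rw [mul_comm, pow_mul, ← norm_pow, pow_sum_addChar, Complex.ofReal_pow, ← Complex.mul_conj',
    map_sum, sum_mul_sum, sum_product]
  refine sum_congr rfl fun x _ => sum_congr rfl fun y _ => ?_
  rw [sub_eq_add_neg, AddChar.map_add_eq_mul, AddChar.map_neg_eq_conj]

/-- The box containing all differences of sums of `s` points on the moment curve. -/
noncomputable def momentBox (s d P : ℕ) : Finset (Fin d → ℤ) :=
  Fintype.piFinset fun j : Fin d => Icc (-((s * P ^ (j.1 + 1) : ℕ) : ℤ)) (s * P ^ (j.1 + 1) : ℕ)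

/-- All differences lie in the box, and by `card_sub_eq_le` each value is taken at most as often as
zero, that is, `meanValue` times. -/
lemma sum_differences_le (s d P : ℕ) (h : (Fin d → ℤ) → ℝ) (hh : ∀ v, 0 ≤ h v) :
    ∑ z ∈ Fintype.piFinset (fun _ : Fin s => Ico (0 : ℤ) P) ×ˢ
      Fintype.piFinset (fun _ : Fin s => Ico (0 : ℤ) P),
      h (∑ i, moment d (z.1 i) - ∑ i, moment d (z.2 i)) ≤
    meanValue s d P * ∑ v ∈ momentBox s d P, h v := by
  classical
  have hmom : ∀ x : Fin s → ℤ, x ∈ Fintype.piFinset (fun _ : Fin s => Ico (0 : ℤ) P) → ∀ j,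
      0 ≤ (∑ i, moment d (x i)) j ∧ (∑ i, moment d (x i)) j ≤ s * (P : ℤ) ^ (j.1 + 1) := by
    intro x hx j
    rw [Fintype.mem_piFinset] at hx
    rw [Finset.sum_apply]
    refine ⟨sum_nonneg fun i _ => pow_nonneg (mem_Ico.1 (hx i)).1 _, ?_⟩
    calc _ ≤ ∑ i : Fin s, (P : ℤ) ^ (j.1 + 1) := sum_le_sum fun i _ =>
            pow_le_pow_left₀ (mem_Ico.1 (hx i)).1 (mem_Ico.1 (hx i)).2.le _
      _ = _ := by simp
  rw [← sum_fiberwise_of_maps_to (t := momentBox s d P)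
    (g := fun z => ∑ i, moment d (z.1 i) - ∑ i, moment d (z.2 i)), mul_sum]
  · refine sum_le_sum fun v _ => ?_
    rw [sum_congr rfl (g := fun _ => h v) (fun z hz => by rw [(mem_filter.1 hz).2]), sum_const,
      nsmul_eq_mul]
    refine mul_le_mul_of_nonneg_right ?_ (hh v)
    exact_mod_cast card_sub_eq_le _ (fun x : Fin s → ℤ => ∑ i, moment d (x i)) v
  · intro z hz
    rw [mem_product] at hz
    refine Fintype.mem_piFinset.2 fun j => ?_
    have h1 := hmom _ hz.1 j
    have h2 := hmom _ hz.2 j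
    rw [mem_Icc, Pi.sub_apply]
    push_cast
    constructor <;> linarith

/-- The bilinear form `∑ⱼ aⱼ vⱼ wⱼ`. -/
def diagPairing {R : Type*} [CommRing R] {d : ℕ} (a : Fin d → R) (v w : Fin d → ℤ) : R :=
  ∑ j, a j * v j * w j

lemma diagPairing_comm {R : Type*} [CommRing R] {d : ℕ} (a : Fin d → R) (v w : Fin d → ℤ) :
    diagPairing a v w = diagPairing a w v :=
  sum_congr rfl fun j _ => by ring

lemma diagPairing_sub_left {R : Type*} [CommRing R] {d : ℕ} (a : Fin d → R)
    (v v' w : Fin d → ℤ) :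
    diagPairing a (v - v') w = diagPairing a v w - diagPairing a v' w := by
  simp only [diagPairing, ← sum_sub_distrib, Pi.sub_apply, Int.cast_sub]
  exact sum_congr rfl fun j _ => by ring

lemma diagPairing_sum_left {R ι : Type*} [CommRing R] {d : ℕ} (a : Fin d → R) (T : Finset ι)
    (v : ι → Fin d → ℤ) (w : Fin d → ℤ) :
    diagPairing a (∑ i ∈ T, v i) w = ∑ i ∈ T, diagPairing a (v i) w := by
  simp only [diagPairing]
  rw [sum_comm]
  refine sum_congr rfl fun j _ => ?_
  rw [Finset.sum_apply, Int.cast_sum, mul_sum, sum_mul]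

lemma norm_sum_diagPairing_pow {R : Type*} [CommRing R] [Finite R] (ψ : AddChar R ℂ) {d : ℕ}
    (a : Fin d → R) (s P : ℕ) (w : Fin d → ℤ) :
    ((‖∑ x ∈ Ico (0 : ℤ) P, ψ (diagPairing a (moment d x) w)‖ ^ (2 * s) : ℝ) : ℂ) =
      ∑ z ∈ Fintype.piFinset (fun _ : Fin s => Ico (0 : ℤ) P) ×ˢ
        Fintype.piFinset (fun _ : Fin s => Ico (0 : ℤ) P),
        ψ (diagPairing a (∑ i, moment d (z.1 i) - ∑ i, moment d (z.2 i)) w) := by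
  rw [norm_sum_addChar_pow]
  simp_rw [diagPairing_sub_left, diagPairing_sum_left]

/-- Hölder in `y` opens a `2s`-th power in `x`, replacing the curve point by a difference of sums of
`s` points. A second Hölder and `sum_differences_le` let that vector run over the whole box at the
cost of one mean value. Opening the `2s`-th power in `y` does the same for the other vector. Both
vectors now run over product boxes and the diagonal form separates into one bilinear sum per
coordinate. -/
theorem double_sum_pow_le {R : Type*} [CommRing R] [Finite R] (ψ : AddChar R ℂ) {d : ℕ}
    (a : Fin d → R) {s : ℕ} (hs : 1 ≤ s) (P : ℕ) :
    ‖∑ x ∈ Ico (0 : ℤ) P, ∑ y ∈ Ico (0 : ℤ) P,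
        ψ (diagPairing a (moment d x) (moment d y))‖ ^ (2 * s * (2 * s)) ≤
      (P : ℝ) ^ (2 * ((2 * s - 1) * (2 * s))) * (meanValue s d P : ℝ) ^ 2 *
      ∏ j : Fin d, ∑ w ∈ Icc (-((s * P ^ (j.1 + 1) : ℕ) : ℤ)) (s * P ^ (j.1 + 1) : ℕ),
        ‖∑ v ∈ Icc (-((s * P ^ (j.1 + 1) : ℕ) : ℤ)) (s * P ^ (j.1 + 1) : ℕ),
          ψ (a j * v * w)‖ := by
  classical
  set I := Ico (0 : ℤ) P with hI
  have hIc : #I = P := by rw [hI, Int.card_Ico, sub_zero, Int.toNat_natCast]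
  set Z := Fintype.piFinset (fun _ : Fin s => I) ×ˢ Fintype.piFinset (fun _ : Fin s => I) with hZ
  have hZc : #Z = P ^ (2 * s) := by
    rw [hZ, card_product, Fintype.card_piFinset, prod_const, hIc, card_univ, Fintype.card_fin,
      two_mul, pow_add]
  set D : (Fin s → ℤ) × (Fin s → ℤ) → (Fin d → ℤ) :=
    fun z => ∑ i, moment d (z.1 i) - ∑ i, moment d (z.2 i) with hD
  set J : ℝ := (meanValue s d P : ℝ) with hJ
  set F : (Fin d → ℤ) → ℂ := fun v => ∑ y ∈ I, ψ (diagPairing a v (moment d y)) with hF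
  set T := ‖∑ x ∈ I, ∑ y ∈ I, ψ (diagPairing a (moment d x) (moment d y))‖ with hT
  have hs2 : 2 * s - 1 + 1 = 2 * s := by lia
  have step1 : T ^ (2 * s) ≤ (P : ℝ) ^ (2 * s - 1) * ∑ z ∈ Z, ‖F (D z)‖ := by
    have h1 : T ^ (2 * s) ≤ (P : ℝ) ^ (2 * s - 1) *
        ∑ y ∈ I, ‖∑ x ∈ I, ψ (diagPairing a (moment d x) (moment d y))‖ ^ (2 * s) := by
      have := pow_sum_le_card_mul_sum_pow (s := I)
        (f := fun y => ‖∑ x ∈ I, ψ (diagPairing a (moment d x) (moment d y))‖)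
        (fun _ _ => norm_nonneg _) (2 * s - 1)
      rw [hs2, hIc] at this
      refine le_trans ?_ this
      rw [hT, sum_comm]
      gcongr
      exact norm_sum_le _ _
    refine h1.trans (mul_le_mul_of_nonneg_left ?_ (by positivity))
    have h2 : ((∑ y ∈ I, ‖∑ x ∈ I, ψ (diagPairing a (moment d x) (moment d y))‖ ^ (2 * s) : ℝ) : ℂ)
        = ∑ z ∈ Z, F (D z) := by
      rw [Complex.ofReal_sum]
      rw [sum_congr rfl fun y _ => norm_sum_diagPairing_pow ψ a s P (moment d y), sum_comm]
    have h3 : ∑ y ∈ I, ‖∑ x ∈ I, ψ (diagPairing a (moment d x) (moment d y))‖ ^ (2 * s) =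
        ‖∑ z ∈ Z, F (D z)‖ := by
      rw [← h2, Complex.norm_real, Real.norm_of_nonneg]
      exact sum_nonneg fun _ _ => by positivity
    rw [h3]
    exact norm_sum_le _ _
  have step2 : (∑ z ∈ Z, ‖F (D z)‖) ^ (2 * s) ≤
      ((P : ℝ) ^ (2 * s)) ^ (2 * s - 1) * (J * ∑ v ∈ momentBox s d P, ‖F v‖ ^ (2 * s)) := by
    have := pow_sum_le_card_mul_sum_pow (s := Z) (f := fun z => ‖F (D z)‖)
      (fun _ _ => norm_nonneg _) (2 * s - 1)
    rw [hs2, hZc, Nat.cast_pow] at this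
    refine this.trans (mul_le_mul_of_nonneg_left ?_ (by positivity))
    exact sum_differences_le s d P (fun v => ‖F v‖ ^ (2 * s)) (fun _ => by positivity)
  have step3 : ∑ v ∈ momentBox s d P, ‖F v‖ ^ (2 * s) ≤
      J * ∏ j : Fin d, ∑ w ∈ Icc (-((s * P ^ (j.1 + 1) : ℕ) : ℤ)) (s * P ^ (j.1 + 1) : ℕ),
        ‖∑ v ∈ Icc (-((s * P ^ (j.1 + 1) : ℕ) : ℤ)) (s * P ^ (j.1 + 1) : ℕ),
          ψ (a j * v * w)‖ := by
    have h2 : ((∑ v ∈ momentBox s d P, ‖F v‖ ^ (2 * s) : ℝ) : ℂ)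
        = ∑ z ∈ Z, ∑ v ∈ momentBox s d P, ψ (diagPairing a v (D z)) := by
      rw [Complex.ofReal_sum]
      simp_rw [hF, fun (v : Fin d → ℤ) (y : ℤ) => diagPairing_comm a v (moment d y)]
      rw [sum_congr rfl fun v _ => norm_sum_diagPairing_pow ψ a s P v, sum_comm]
      exact sum_congr rfl fun z _ => sum_congr rfl fun v _ => by rw [diagPairing_comm]
    have h3 : ∑ v ∈ momentBox s d P, ‖F v‖ ^ (2 * s) =
        ‖∑ z ∈ Z, ∑ v ∈ momentBox s d P, ψ (diagPairing a v (D z))‖ := by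
      rw [← h2, Complex.norm_real, Real.norm_of_nonneg]
      exact sum_nonneg fun _ _ => by positivity
    have h4 : ∀ w : Fin d → ℤ, ‖∑ v ∈ momentBox s d P, ψ (diagPairing a v w)‖ =
        ∏ j : Fin d, ‖∑ v ∈ Icc (-((s * P ^ (j.1 + 1) : ℕ) : ℤ)) (s * P ^ (j.1 + 1) : ℕ),
          ψ (a j * v * w j)‖ := by
      intro w
      rw [← norm_prod, prod_univ_sum]
      simp_rw [diagPairing, addChar_map_sum]
      rfl
    rw [h3]
    refine (norm_sum_le _ _).trans ?_
    refine (sum_differences_le s d P (fun w => ‖∑ v ∈ momentBox s d P, ψ (diagPairing a v w)‖)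
      (fun _ => norm_nonneg _)).trans ?_
    refine mul_le_mul_of_nonneg_left (le_of_eq ?_) (by positivity)
    simp_rw [h4]
    rw [prod_univ_sum]
    rfl
  calc T ^ (2 * s * (2 * s)) = (T ^ (2 * s)) ^ (2 * s) := pow_mul _ _ _
    _ ≤ ((P : ℝ) ^ (2 * s - 1) * ∑ z ∈ Z, ‖F (D z)‖) ^ (2 * s) := by gcongr
    _ = ((P : ℝ) ^ (2 * s - 1)) ^ (2 * s) * (∑ z ∈ Z, ‖F (D z)‖) ^ (2 * s) := mul_pow _ _ _
    _ ≤ ((P : ℝ) ^ (2 * s - 1)) ^ (2 * s) * (((P : ℝ) ^ (2 * s)) ^ (2 * s - 1) * (J * (J * _))) := by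
        gcongr
        refine step2.trans ?_
        gcongr
    _ = _ := by
        rw [two_mul ((2 * s - 1) * (2 * s)), pow_add, pow_mul, mul_comm (2 * s - 1) (2 * s),
          pow_mul, ← pow_mul, ← pow_mul, mul_comm (2 * s - 1) (2 * s)]
        ring

/-! ### The bilinear sums `∑_w |∑_v ψ(a v w)|` -/

lemma card_Icc_modEq_le (B : ℕ) {D : ℕ} (hD : 0 < D) (c : ℤ) :
    (#{v ∈ Icc (-(B : ℤ)) B | v ≡ c [ZMOD D]} : ℝ) ≤ (2 * B + 1 : ℝ) / D + 1 := by
  have hD' : (0 : ℤ) < D := by exact_mod_cast hD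
  have h1 : Icc (-(B : ℤ)) B = Ioc (-(B : ℤ) - 1) B := by
    ext; simp only [mem_Icc, mem_Ioc]; lia
  have h2 := Int.Ioc_filter_modEq_card (-(B : ℤ) - 1) B hD' c
  rw [h1]
  have h3 : ((#{v ∈ Ioc (-(B : ℤ) - 1) B | v ≡ c [ZMOD D]} : ℤ) : ℚ) ≤ (2 * B + 1 : ℚ) / D + 1 := by
    rw [h2]
    have hD0 : (0 : ℚ) < D := by exact_mod_cast hD
    have ha := Int.floor_le (((B : ℤ) - c : ℚ) / (D : ℤ))
    have hb := Int.lt_floor_add_one (((-(B : ℤ) - 1 : ℤ) - c : ℚ) / (D : ℤ))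
    push_cast at ha hb ⊢
    rw [max_le_iff]
    constructor
    · have : (2 * B + 1 : ℚ) / D = ((B : ℚ) - c) / D - ((-B - 1 : ℚ) - c) / D := by
        field_simp; ring
      linarith
    · positivity
  have h4 : (((#{v ∈ Ioc (-(B : ℤ) - 1) B | v ≡ c [ZMOD D]} : ℚ) : ℝ)) ≤
      (((2 * B + 1 : ℚ) / D + 1 : ℚ) : ℝ) := Rat.cast_le.2 (by exact_mod_cast h3)
  push_cast at h4
  exact h4

/-- By Cauchy–Schwarz it suffices to treat the square of the inner sum. It is periodic in `w` modulo
the additive order `D` of `a`, and over a full period orthogonality leaves only pairs `v ≡ v' (mod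
D)`. Faithfulness of `ψ` makes `D` the exact period. -/
lemma sum_bilinear_le {R : Type*} [CommRing R] [Finite R] {ψ : AddChar R ℂ}
    (hψ : ∀ z, ψ z = 1 → z = 0) (a : R) (B : ℕ) :
    ∑ w ∈ Icc (-(B : ℤ)) B, ‖∑ v ∈ Icc (-(B : ℤ)) B, ψ (a * v * w)‖ ≤
      (2 * B + 1) * ((2 * B + 1 : ℝ) / addOrderOf a + 1) * √(addOrderOf a) := by
  classical
  set D := addOrderOf a with hD
  have hDpos : 0 < D := addOrderOf_pos a
  set I := Icc (-(B : ℤ)) B with hI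
  have hIc : (#I : ℝ) = 2 * B + 1 := by
    have : #I = 2 * B + 1 := by rw [hI, Int.card_Icc]; lia
    rw [this]; push_cast; ring
  set K : ℝ := (2 * B + 1 : ℝ) / D + 1 with hK
  have hK0 : 0 ≤ K := by positivity
  set h : ℤ → ℝ := fun w => ‖∑ v ∈ I, ψ (a * v * w)‖ ^ 2 with hh
  have haD : a * (D : ℤ) = 0 := by
    have := addOrderOf_nsmul_eq_zero a
    rw [nsmul_eq_mul, mul_comm] at this
    exact_mod_cast this
  have hper : ∀ w : ℤ, h w = h (w % D) := by
    intro w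
    simp only [hh]
    congr 2
    refine sum_congr rfl fun v _ => ?_
    congr 1
    conv_lhs => rw [← Int.emod_add_mul_ediv w D]
    push_cast at haD ⊢
    linear_combination (v : R) * ((w / (D : ℤ) : ℤ) : R) * haD
  have hblock : ∑ r ∈ range D, h r ≤ D * ((2 * B + 1) * K) := by
    have h1 : ((∑ r ∈ range D, h r : ℝ) : ℂ) =
        ∑ v ∈ I, ∑ v' ∈ I, if v' ≡ v [ZMOD D] then (D : ℂ) else 0 := by
      rw [Complex.ofReal_sum]
      have h2 : ∀ r : ℕ, ((h r : ℝ) : ℂ) =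
          ∑ v ∈ I, ∑ v' ∈ I, (ψ (a * ((v - v' : ℤ) : R))) ^ r := by
        intro r
        simp only [hh]
        rw [Complex.ofReal_pow, ← Complex.mul_conj', map_sum, sum_mul_sum]
        refine sum_congr rfl fun v _ => sum_congr rfl fun v' _ => ?_
        rw [← AddChar.map_neg_eq_conj, ← AddChar.map_add_eq_mul, ← AddChar.map_nsmul_eq_pow]
        congr 1
        rw [nsmul_eq_mul]
        push_cast
        ring
      simp_rw [h2]
      rw [sum_comm]
      refine sum_congr rfl fun v _ => ?_
      rw [sum_comm]
      refine sum_congr rfl fun v' _ => ?_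
      have h3 : a * ((v - v' : ℤ) : R) = 0 ↔ v' ≡ v [ZMOD D] := by
        rw [Int.modEq_iff_dvd, hD, addOrderOf_dvd_iff_zsmul_eq_zero, zsmul_eq_mul, mul_comm]
      split_ifs with h4
      · rw [h3.2 h4]; simp
      · have h5 : ψ (a * ((v - v' : ℤ) : R)) ≠ 1 := fun h => h4 (h3.1 (hψ _ h))
        have h6 : ψ (a * ((v - v' : ℤ) : R)) ^ D = 1 := by
          have : a * ((D : ℕ) : R) = 0 := by exact_mod_cast haD
          rw [← AddChar.map_nsmul_eq_pow, nsmul_eq_mul, ← mul_assoc, mul_comm _ a, this, zero_mul,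
            AddChar.map_zero_eq_one]
        have h7 := mul_neg_geom_sum (ψ (a * ((v - v' : ℤ) : R))) D
        rw [h6, sub_self] at h7
        exact (mul_eq_zero.1 h7).resolve_left (sub_ne_zero.2 h5.symm)
    have h8 : ∑ r ∈ range D, h r = ∑ v ∈ I, ∑ v' ∈ I, if v' ≡ v [ZMOD D] then (D : ℝ) else 0 := by
      apply Complex.ofReal_injective
      rw [h1]
      push_cast
      refine sum_congr rfl fun v _ => sum_congr rfl fun v' _ => ?_
      split_ifs <;> simp
    rw [h8]
    calc _ ≤ ∑ v ∈ I, K * D := by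
          refine sum_le_sum fun v _ => ?_
          rw [← sum_filter, sum_const, nsmul_eq_mul]
          gcongr
          exact card_Icc_modEq_le B hDpos v
      _ = _ := by rw [sum_const, nsmul_eq_mul, hIc]; ring
  have hsq : ∑ w ∈ I, h w ≤ K * (D * ((2 * B + 1) * K)) := by
    have h1 : ∑ w ∈ I, h w = ∑ r ∈ range D, ∑ w ∈ I with w % (D : ℤ) = (r : ℤ), h w := by
      rw [← sum_fiberwise_of_maps_to (s := I) (t := range D) (g := fun w => (w % D).toNat)]
      · refine sum_congr rfl fun r _ => sum_congr (filter_congr fun w _ => ?_) fun _ _ => rfl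
        have := Int.emod_nonneg w (by exact_mod_cast hDpos.ne' : (D : ℤ) ≠ 0)
        lia
      · intro w _
        have := Int.emod_nonneg w (by exact_mod_cast hDpos.ne' : (D : ℤ) ≠ 0)
        have := Int.emod_lt_of_pos w (by exact_mod_cast hDpos : (0 : ℤ) < D)
        rw [mem_range]; lia
    rw [h1]
    calc _ ≤ ∑ r ∈ range D, K * h r := by
          refine sum_le_sum fun r hr => ?_
          rw [sum_congr rfl (g := fun _ => h r)
            (fun w hw => by rw [hper w, (mem_filter.1 hw).2]), sum_const, nsmul_eq_mul]
          refine mul_le_mul_of_nonneg_right ?_ (by simp only [hh]; positivity)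
          refine le_trans (le_of_eq ?_) (card_Icc_modEq_le B hDpos r)
          congr 2
          refine filter_congr fun w _ => ?_
          rw [Int.ModEq, Int.emod_eq_of_lt (a := (r : ℤ)) (by positivity)
            (by exact_mod_cast mem_range.1 hr)]
      _ ≤ _ := by rw [← mul_sum]; gcongr
  refine le_of_sq_le_sq ?_ (by positivity)
  calc (∑ w ∈ I, ‖∑ v ∈ I, ψ (a * v * w)‖) ^ 2 ≤ #I * ∑ w ∈ I, h w := sq_sum_le_card_mul_sum_sq
    _ ≤ (2 * B + 1) * (K * (D * ((2 * B + 1) * K))) := by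
        rw [hIc]; gcongr
    _ = _ := by
        rw [mul_pow, Real.sq_sqrt (by positivity)]; ring

lemma catalan_le_four_pow (n : ℕ) : catalan n ≤ 4 ^ n := by
  rw [catalan_eq_centralBinom_div]
  exact (Nat.div_le_self _ _).trans (Nat.centralBinom_le_four_pow n)

/-! ### Additive orders of the coefficients and the bilinear estimate. -/

lemma addOrderOf_le_of_pow_mul {p k e : ℕ} (hp : 0 < p) (he : e ≤ k) (b : ZMod (p ^ k)) :
    addOrderOf (b * (p : ZMod (p ^ k)) ^ e) ≤ p ^ (k - e) := by
  refine Nat.le_of_dvd (pow_pos hp _) (addOrderOf_dvd_of_nsmul_eq_zero ?_)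
  rw [nsmul_eq_mul, Nat.cast_pow, mul_left_comm, ← pow_add, Nat.sub_add_cancel he]
  have : ((p : ZMod (p ^ k))) ^ k = 0 := by exact_mod_cast ZMod.natCast_self (p ^ k)
  rw [this, mul_zero]

/-- A multiplier killing `a` also kills the other factors once the unit is removed and `c` is
exchanged for `p^g`. The integer `κ` stays in the inequality because a Catalan number may be
divisible by `p`. -/
lemma pow_le_addOrderOf_mul {p k g e κ : ℕ} (hp : 0 < p) {c u : ZMod (p ^ k)} (hu : IsUnit u)
    (hκ : 0 < κ) (hc : ∀ x, c * x = 0 → (p : ZMod (p ^ k)) ^ g * x = 0) :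
    p ^ k ≤ p ^ (g + e) * (addOrderOf (c * u * κ * (p : ZMod (p ^ k)) ^ e) * κ) := by
  have : NeZero (p ^ k) := ⟨(pow_pos hp k).ne'⟩
  set a := c * u * κ * (p : ZMod (p ^ k)) ^ e with ha
  set D := addOrderOf a with hD
  have h1 : (D : ZMod (p ^ k)) * a = 0 := by
    rw [← nsmul_eq_mul]; exact addOrderOf_nsmul_eq_zero a
  have h2 : c * ((D : ZMod (p ^ k)) * κ * p ^ e) = 0 := by
    apply hu.mul_right_eq_zero.1
    rw [← h1, ha]; ring
  have h3 := hc _ h2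
  have h4 : ((p ^ (g + e) * (D * κ) : ℕ) : ZMod (p ^ k)) = 0 := by
    rw [← h3]; push_cast; ring
  exact Nat.le_of_dvd (by have := addOrderOf_pos a; positivity)
    ((ZMod.natCast_eq_zero_iff _ _).1 h4)

/-- The saving exponent in the bilinear estimate of degree `8n`. -/
noncomputable def savingExp (n : ℕ) : ℝ := 1 / (802816 * (n : ℝ) ^ 2)

lemma sum_ite_Icc_eq {n : ℕ} (hn : 1 ≤ n) :
    ∑ j : Fin (8 * n), (if 5 * n ≤ j.1 + 1 ∧ j.1 + 1 ≤ 7 * n then n - 1 else 0) =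
      (2 * n + 1) * (n - 1) := by
  rw [Fin.sum_univ_eq_sum_range
    (fun j => if 5 * n ≤ j + 1 ∧ j + 1 ≤ 7 * n then n - 1 else 0) (8 * n), ← sum_filter, sum_const,
    smul_eq_mul]
  congr 1
  have : {j ∈ range (8 * n) | 5 * n ≤ j + 1 ∧ j + 1 ≤ 7 * n} = Icc (5 * n - 1) (7 * n - 1) := by
    ext j; simp only [mem_filter, mem_range, mem_Icc]; lia
  rw [this, Nat.card_Icc]; lia

lemma sum_two_mul_succ (d : ℕ) : ∑ j : Fin d, 2 * (j.1 + 1) = d * (d + 1) := by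
  rw [Fin.sum_univ_eq_sum_range (fun j => 2 * (j + 1)) d]
  induction d with
  | zero => simp
  | succ d ih => rw [sum_range_succ, ih]; ring

/-- The sum is `≪ N²/√D + N√D` with `N ≍ P^J` and `D` the order of the coefficient. For `J ≤ 7n` one
has `√D ≫ P^(n-1)`, which gives the saving in the first term. As `√D ≤ P^(8n+1-J)`, the second term
saves as much when `9n ≤ 2J`, hence the range from `5n`. Other degrees use the trivial bound. -/
lemma bilinear_factor_le {n : ℕ} (hn : 1 ≤ n) {s p g k : ℕ} (hs : 1 ≤ s) (hp : p.Prime)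
    (hk1 : 16 * n * g ≤ k) (hk2 : k ≤ (16 * n + 2) * g) {c : ZMod (p ^ k)}
    (hc : ∀ x, c * x = 0 → (p : ZMod (p ^ k)) ^ g * x = 0) {u : ZMod (p ^ k)} (hu : IsUnit u)
    {κ J : ℕ} (hκ : 0 < κ) (hκ4 : κ ≤ 4 ^ (8 * n)) {a : ZMod (p ^ k)}
    (ha : a = c * u * κ * (p : ZMod (p ^ k)) ^ (2 * g * J)) {ψ : AddChar (ZMod (p ^ k)) ℂ}
    (hψ : ∀ z, ψ z = 1 → z = 0) :
    (∑ w ∈ Icc (-((s * (p ^ g) ^ J : ℕ) : ℤ)) (s * (p ^ g) ^ J : ℕ),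
        ‖∑ v ∈ Icc (-((s * (p ^ g) ^ J : ℕ) : ℤ)) (s * (p ^ g) ^ J : ℕ), ψ (a * v * w)‖) *
      (p ^ g : ℝ) ^ (if 5 * n ≤ J ∧ J ≤ 7 * n then n - 1 else 0) ≤
      9 * s ^ 2 * 2 ^ (8 * n + 1) * (p ^ g : ℝ) ^ (2 * J) := by
  have : NeZero (p ^ k) := ⟨(pow_pos hp.pos k).ne'⟩
  set P : ℝ := (p : ℝ) ^ g with hP
  have hP1 : 1 ≤ P := one_le_pow₀ (by exact_mod_cast hp.one_le)
  set B := s * (p ^ g) ^ J with hB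
  have hs1 : (1 : ℝ) ≤ s := by exact_mod_cast hs
  have hBR : (B : ℝ) = s * P ^ J := by rw [hB, hP]; push_cast; ring
  have hN : (2 * B + 1 : ℝ) ≤ 3 * s * P ^ J := by
    rw [hBR]
    have h1 : 1 ≤ P ^ J := one_le_pow₀ hP1
    nlinarith
  have h2n : (1 : ℝ) ≤ 2 ^ (8 * n) := one_le_pow₀ (by norm_num)
  split_ifs with hJ
  · have hW := sum_bilinear_le hψ a B
    set D := addOrderOf a with hD
    have hD0 : 0 < D := addOrderOf_pos a
    have hDr : (0 : ℝ) < D := by exact_mod_cast hD0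
    have hDup : (D : ℝ) ≤ (P ^ (8 * n + 1 - J)) ^ 2 := by
      have h1 : D ≤ p ^ (k - 2 * g * J) := by
        rw [hD, ha]
        refine addOrderOf_le_of_pow_mul hp.pos ?_ _
        calc 2 * g * J ≤ 2 * g * (7 * n) := by gcongr; exact hJ.2
          _ ≤ 16 * n * g := by nlinarith
          _ ≤ k := hk1
      have h2 : k - 2 * g * J ≤ g * (8 * n + 1 - J) * 2 := by
        have h3 : g * (8 * n + 1 - J) * 2 + 2 * g * J = (16 * n + 2) * g := by
          obtain ⟨t, ht⟩ := Nat.exists_eq_add_of_le (show J ≤ 8 * n + 1 by lia)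
          rw [show 8 * n + 1 - J = t by lia, show 16 * n + 2 = 2 * (8 * n + 1) by ring, ht]; ring
        lia
      have h4 : D ≤ p ^ (g * (8 * n + 1 - J) * 2) := h1.trans (Nat.pow_le_pow_right hp.pos h2)
      rw [hP, ← pow_mul, ← pow_mul, ← mul_assoc]
      exact_mod_cast h4
    have hDlow : (P ^ (n - 1)) ^ 2 ≤ D * (2 ^ (8 * n)) ^ 2 := by
      have h1 := pow_le_addOrderOf_mul (e := 2 * g * J) hp.pos hu hκ hc
      rw [← ha, ← hD] at h1
      have h2 : (2 * n - 2) * g + (g + 2 * g * J) ≤ k := by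
        refine le_trans ?_ hk1
        have h3 : (2 * n - 2) * g + (g + 2 * g * J) = (2 * n - 2 + 1 + 2 * J) * g := by ring
        rw [h3]
        gcongr
        lia
      have h4 : p ^ ((2 * n - 2) * g) * p ^ (g + 2 * g * J) ≤ p ^ (g + 2 * g * J) * (D * κ) := by
        rw [← pow_add]
        exact (Nat.pow_le_pow_right hp.pos h2).trans h1
      rw [mul_comm] at h4
      have h5 := Nat.le_of_mul_le_mul_left h4 (pow_pos hp.pos _)
      have h6 : p ^ ((2 * n - 2) * g) ≤ D * (2 ^ (8 * n)) ^ 2 := by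
        refine h5.trans ?_
        gcongr
        rw [← pow_mul, mul_comm (8 * n), pow_mul]
        exact hκ4
      rw [hP, ← pow_mul, ← pow_mul, show g * ((n - 1) * 2) = (2 * n - 2) * g by
        rw [mul_comm]; congr 1; lia]
      exact_mod_cast h6
    have hsq0 : 0 < √(D : ℝ) := Real.sqrt_pos.2 hDr
    have hsqup : √(D : ℝ) ≤ P ^ (8 * n + 1 - J) := Real.sqrt_le_iff.2 ⟨by positivity, hDup⟩
    have hsqlow : P ^ (n - 1) ≤ √(D : ℝ) * 2 ^ (8 * n) := by
      rw [← Real.sqrt_sq (show (0 : ℝ) ≤ 2 ^ (8 * n) by positivity), ← Real.sqrt_mul (by positivity)]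
      exact Real.le_sqrt_of_sq_le hDlow
    have e1 : (2 * B + 1 : ℝ) * ((2 * B + 1) / D + 1) * √(D : ℝ) * P ^ (n - 1) ≤
        (3 * s * P ^ J) ^ 2 * 2 ^ (8 * n) + (3 * s * P ^ J) * (P ^ (8 * n + 1 - J) * P ^ (n - 1)) := by
      have e2 : (2 * B + 1 : ℝ) * ((2 * B + 1) / D + 1) * √(D : ℝ) * P ^ (n - 1) =
          (2 * B + 1 : ℝ) ^ 2 * (P ^ (n - 1) / √(D : ℝ)) +
            (2 * B + 1) * (√(D : ℝ) * P ^ (n - 1)) := by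
        have : √(D : ℝ) / D = 1 / √(D : ℝ) := by
          rw [div_eq_div_iff hDr.ne' hsq0.ne', one_mul, Real.mul_self_sqrt hDr.le]
        calc _ = (2 * B + 1 : ℝ) ^ 2 * (P ^ (n - 1) * (√(D : ℝ) / D)) +
            (2 * B + 1) * (√(D : ℝ) * P ^ (n - 1)) := by ring
          _ = _ := by rw [this]; ring
      rw [e2]
      have e3 : P ^ (n - 1) / √(D : ℝ) ≤ 2 ^ (8 * n) := by
        rw [div_le_iff₀ hsq0, mul_comm]; exact hsqlow
      gcongr
    refine (mul_le_mul_of_nonneg_right hW (by positivity)).trans (e1.trans ?_)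
    have e4 : P ^ (8 * n + 1 - J) * P ^ (n - 1) ≤ P ^ J := by
      rw [← pow_add]
      exact pow_le_pow_right₀ hP1 (by lia)
    calc _ ≤ (3 * s * P ^ J) ^ 2 * 2 ^ (8 * n) + (3 * s * P ^ J) * P ^ J := by gcongr
      _ ≤ (3 * s * P ^ J) ^ 2 * 2 ^ (8 * n) + (3 * s * P ^ J) * (3 * s * P ^ J) * 2 ^ (8 * n) := by
          have : P ^ J ≤ (3 * s * P ^ J) * 2 ^ (8 * n) := by
            have h0 : 0 < P ^ J := by positivity
            calc P ^ J = 1 * P ^ J * 1 := by ring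
              _ ≤ (3 * s) * P ^ J * 2 ^ (8 * n) := by gcongr; linarith
          rw [mul_assoc (3 * s * P ^ J) (3 * s * P ^ J)]
          gcongr
      _ = _ := by rw [pow_succ 2 (8 * n), mul_comm 2 J, pow_mul P J 2]; ring
  · rw [pow_zero, mul_one]
    have hcard : (#(Icc (-(B : ℤ)) B) : ℝ) = 2 * B + 1 := by
      have : #(Icc (-(B : ℤ)) B) = 2 * B + 1 := by rw [Int.card_Icc]; lia
      rw [this]; push_cast; ring
    calc _ ≤ ∑ w ∈ Icc (-(B : ℤ)) B, (2 * B + 1 : ℝ) := by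
          refine sum_le_sum fun w _ => (norm_sum_le _ _).trans (le_of_eq ?_)
          simp only [AddChar.norm_apply, sum_const, nsmul_eq_mul, mul_one]
          exact hcard
      _ = (2 * B + 1 : ℝ) ^ 2 := by rw [sum_const, nsmul_eq_mul, hcard]; ring
      _ ≤ (3 * s * P ^ J) ^ 2 := by gcongr
      _ = 9 * s ^ 2 * 1 * P ^ (2 * J) := by rw [mul_comm 2 J, pow_mul P J 2]; ring
      _ ≤ _ := by
          gcongr
          exact one_le_pow₀ (by norm_num)

/-- The bookkeeping of exponents: with `m = 4s²` the total is `2m + n²/2 - (2n+1)(n-1) ≤ 2m - n²`.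
The `m`-th root turns `n²` into `n²/m = 1/(802816 n²)`, because `4 · 448² = 802816`. -/
lemma le_rpow_of_double_sum {n s : ℕ} (hn : 128 ≤ n) (hs : s = 448 * n ^ 2)
    {T J V P C₀ K : ℝ} (hP1 : 1 ≤ P) (hC₀ : 0 < C₀) (hK : 0 < K) (hJ0 : 0 ≤ J)
    (hmain : T ^ (2 * s * (2 * s)) ≤ P ^ (2 * ((2 * s - 1) * (2 * s))) * J ^ 2 * V)
    (hJ : J ≤ C₀ * P ^ (896 * (n : ℝ) ^ 2 - 8 * n * (8 * n + 1) / 2 + (n : ℝ) ^ 2 / 4))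
    (hV : V * P ^ ((2 * n + 1) * (n - 1)) ≤ K ^ (8 * n) * P ^ (8 * n * (8 * n + 1))) :
    T ≤ (C₀ ^ 2 * K ^ (8 * n) + 1) * P ^ (2 - savingExp n) := by
  have hs1 : 1 ≤ s := by rw [hs]; nlinarith
  have hsr : (s : ℝ) = 448 * n ^ 2 := by rw [hs]; push_cast; ring
  clear hs
  have hP0 : 0 < P := by linarith
  have hn1 : (128 : ℝ) ≤ n := by exact_mod_cast hn
  obtain ⟨C₁, hC₁⟩ : ∃ C₁ : ℝ, C₁ = C₀ ^ 2 * K ^ (8 * n) := ⟨_, rfl⟩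
  have hC₁pos : 0 < C₁ := by rw [hC₁]; positivity
  obtain ⟨E, hE⟩ : ∃ E : ℝ,
    E = 896 * (n : ℝ) ^ 2 - 8 * n * (8 * n + 1) / 2 + (n : ℝ) ^ 2 / 4 := ⟨_, rfl⟩
  rw [← hE] at hJ
  rw [← hC₁]
  obtain ⟨A, hA⟩ : ∃ A : ℝ, A = (8 * n * (8 * n + 1) : ℝ) - (2 * n + 1) * (n - 1) := ⟨_, rfl⟩
  have hV' : V ≤ K ^ (8 * n) * P ^ A := by
    rw [hA, Real.rpow_sub hP0, ← mul_div_assoc, le_div_iff₀ (by positivity)]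
    have e1 : ((2 * n + 1) * (n - 1) : ℝ) = (((2 * n + 1) * (n - 1) : ℕ) : ℝ) := by
      push_cast [Nat.cast_sub (show 1 ≤ n by lia)]; ring
    have e2 : (8 * n * (8 * n + 1) : ℝ) = ((8 * n * (8 * n + 1) : ℕ) : ℝ) := by
      push_cast; ring
    rw [e1, e2, Real.rpow_natCast, Real.rpow_natCast]
    exact hV
  obtain ⟨r, hr⟩ : ∃ r : ℕ, r = 2 * ((2 * s - 1) * (2 * s)) := ⟨_, rfl⟩
  have hrr : (r : ℝ) = 2 * ((2 * s - 1) * (2 * s)) := by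
    rw [hr]; push_cast [Nat.cast_sub (show 1 ≤ 2 * s by lia)]; ring
  obtain ⟨m, hm⟩ : ∃ m : ℕ, m = 2 * s * (2 * s) := ⟨_, rfl⟩
  have hm0 : m ≠ 0 := by rw [hm]; positivity
  have hmr : (m : ℝ) = 802816 * (n : ℝ) ^ 4 := by rw [hm]; push_cast; rw [hsr]; ring
  rw [← hr, ← hm] at hmain
  have hpow : T ^ m ≤ C₁ * P ^ (2 * (m : ℝ) - (n : ℝ) ^ 2) := by
    have h1 : P ^ r * J ^ 2 * V ≤ P ^ r * (C₀ * P ^ E) ^ 2 * (K ^ (8 * n) * P ^ A) := by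
      refine mul_le_mul_of_nonneg ?_ hV' (by positivity) (by positivity)
      exact mul_le_mul_of_nonneg_left (pow_le_pow_left₀ hJ0 hJ 2) (by positivity)
    have h2 : P ^ r * (C₀ * P ^ E) ^ 2 * (K ^ (8 * n) * P ^ A) = C₁ * P ^ (r + E * 2 + A) := by
      rw [Real.rpow_add hP0, Real.rpow_add hP0, Real.rpow_mul hP0.le, Real.rpow_two,
        Real.rpow_natCast, hC₁]
      ring
    refine hmain.trans (h1.trans (h2.le.trans ?_))
    refine mul_le_mul_of_nonneg_left (Real.rpow_le_rpow_of_exponent_le hP1 ?_) hC₁pos.le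
    rw [hrr, hmr, hE, hA, hsr]
    nlinarith
  refine le_of_pow_le_pow_left₀ hm0 (by positivity) (hpow.trans ?_)
  rw [mul_pow, ← Real.rpow_natCast (P ^ (2 - savingExp n)), ← Real.rpow_mul hP0.le]
  have e3 : (2 - savingExp n) * (m : ℝ) = 2 * (m : ℝ) - (n : ℝ) ^ 2 := by
    rw [savingExp, hmr]; field_simp
  rw [e3]
  refine mul_le_mul_of_nonneg_right ?_ (by positivity)
  calc C₁ ≤ C₁ + 1 := by linarith
    _ ≤ (C₁ + 1) ^ m := le_self_pow₀ (by linarith) hm0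

/-- The bilinear exponential sum estimate. -/
theorem polynomial_bilinear_bound {n : ℕ} (hn : 128 ≤ n) :
    ∃ C : ℝ, 0 < C ∧ ∀ p g k : ℕ, p.Prime → 16 * n * g ≤ k → k ≤ (16 * n + 2) * g →
      ∀ c : ZMod (p ^ k), (∀ x, c * x = 0 → (p : ZMod (p ^ k)) ^ g * x = 0) →
      ∀ u : Fin (8 * n) → ZMod (p ^ k), (∀ j, IsUnit (u j)) →
      ∀ ψ : AddChar (ZMod (p ^ k)) ℂ, (∀ z, ψ z = 1 → z = 0) →
      ‖∑ x ∈ Ico (0 : ℤ) (p ^ g : ℕ), ∑ y ∈ Ico (0 : ℤ) (p ^ g : ℕ),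
        ψ (diagPairing (fun j => c * u j * (catalan j.1 : ZMod (p ^ k)) *
          (p : ZMod (p ^ k)) ^ (2 * g * (j.1 + 1))) (moment _ x) (moment _ y))‖ ≤
      C * (p ^ g : ℝ) ^ (2 - savingExp n) := by
  obtain ⟨C₀, hC₀, hJ⟩ := vinogradov_mean_value hn
  obtain ⟨s, hs⟩ : ∃ s : ℕ, s = 448 * n ^ 2 := ⟨_, rfl⟩
  rw [← hs] at hJ
  have hs1 : 1 ≤ s := by rw [hs]; nlinarith
  have hs1' : (1 : ℝ) ≤ s := by exact_mod_cast hs1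
  obtain ⟨K, hK⟩ : ∃ K : ℝ, K = 9 * s ^ 2 * 2 ^ (8 * n + 1) := ⟨_, rfl⟩
  have hKpos : 0 < K := by rw [hK]; positivity
  refine ⟨C₀ ^ 2 * K ^ (8 * n) + 1, by positivity, fun p g k hp hk1 hk2 c hc u hu ψ hψ => ?_⟩
  have : NeZero (p ^ k) := ⟨(pow_pos hp.pos k).ne'⟩
  set a : Fin (8 * n) → ZMod (p ^ k) := fun j => c * u j * (catalan j.1 : ZMod (p ^ k)) *
          (p : ZMod (p ^ k)) ^ (2 * g * (j.1 + 1)) with ha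
  have hcat : ∀ j : ℕ, 0 < catalan j := by
    intro j
    have h1 := succ_mul_catalan_eq_centralBinom j
    have h2 := Nat.centralBinom_pos j
    rcases Nat.eq_zero_or_pos (catalan j) with h | h
    · rw [h] at h1; lia
    · exact h
  set P : ℝ := (p : ℝ) ^ g with hP
  have hP1 : 1 ≤ P := one_le_pow₀ (by exact_mod_cast hp.one_le)
  have hP0 : 0 < P := by linarith
  have hcastP : ((p ^ g : ℕ) : ℝ) = P := by rw [hP]; push_cast; rfl
  have hmain := double_sum_pow_le ψ a hs1 (p ^ g)
  set T := ‖∑ x ∈ Ico (0 : ℤ) (p ^ g : ℕ), ∑ y ∈ Ico (0 : ℤ) (p ^ g : ℕ),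
    ψ (diagPairing a (moment _ x) (moment _ y))‖ with hT
  set W : Fin (8 * n) → ℝ := fun j =>
    ∑ w ∈ Icc (-((s * (p ^ g) ^ (j.1 + 1) : ℕ) : ℤ)) (s * (p ^ g) ^ (j.1 + 1) : ℕ),
      ‖∑ v ∈ Icc (-((s * (p ^ g) ^ (j.1 + 1) : ℕ) : ℤ)) (s * (p ^ g) ^ (j.1 + 1) : ℕ),
          ψ (a j * v * w)‖ with hW
  have hprod : (∏ j, W j) * P ^ ((2 * n + 1) * (n - 1)) ≤
      K ^ (8 * n) * P ^ (8 * n * (8 * n + 1)) := by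
    rw [← sum_ite_Icc_eq (by lia), ← prod_pow_eq_pow_sum, ← prod_mul_distrib]
    calc _ ≤ ∏ j : Fin (8 * n), K * P ^ (2 * (j.1 + 1)) := by
          refine prod_le_prod (fun j _ => mul_nonneg (sum_nonneg fun _ _ => norm_nonneg _)
            (by positivity)) fun j _ => ?_
          rw [hK]
          exact bilinear_factor_le (by lia) hs1 hp hk1 hk2 hc (hu j) (hcat j.1)
            ((catalan_le_four_pow j.1).trans (Nat.pow_le_pow_right (by norm_num) j.2.le)) rfl hψ
      _ = _ := by
          rw [prod_mul_distrib, prod_const, card_univ, Fintype.card_fin, prod_pow_eq_pow_sum,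
            sum_two_mul_succ]
  have hJP := hJ (p ^ g) (Nat.one_le_pow _ _ hp.pos)
  rw [hcastP] at hJP hmain
  exact le_rpow_of_double_sum hn hs hP1 hC₀ hKpos (by positivity) hmain hJP hprod

/-! ### Square roots in `ℤ/p^k` -/

/-- The truncation of the power series of `√(1 - 4z)`. -/
def truncSqrt {R : Type*} [CommRing R] (N : ℕ) (z : R) : R :=
  1 - 2 * ∑ j ∈ range N, (catalan j : R) * z ^ (j + 1)

/-- The Catalan recurrence says that the truncated generating series `S` satisfies `S² = S - z` up
to terms killed by `z^(N+1) = 0`; then `(1 - 2S)² = 1 - 4z`. -/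
lemma truncSqrt_sq {R : Type*} [CommRing R] {N : ℕ} {z : R} (hz : z ^ (N + 1) = 0) :
    truncSqrt N z ^ 2 = 1 - 4 * z := by
  set S := ∑ j ∈ range N, (catalan j : R) * z ^ (j + 1) with hS
  suffices h : S ^ 2 = S - z by
    rw [truncSqrt, ← hS]; linear_combination 4 * h
  rcases N with _ | M
  · simp only [range_zero, sum_empty] at hS
    rw [zero_add, pow_one] at hz
    rw [hS, hz]; ring
  have h1 : S ^ 2 = ∑ x ∈ range (M + 1) ×ˢ range (M + 1),
      ((catalan x.1 * catalan x.2 : ℕ) : R) * z ^ (x.1 + x.2 + 2) := by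
    rw [sq, hS, sum_mul_sum, sum_product]
    refine sum_congr rfl fun i _ => sum_congr rfl fun j _ => ?_
    push_cast; ring
  have h2 : ∑ x ∈ range (M + 1) ×ˢ range (M + 1),
      ((catalan x.1 * catalan x.2 : ℕ) : R) * z ^ (x.1 + x.2 + 2) =
      ∑ x ∈ range (M + 1) ×ˢ range (M + 1) with x.1 + x.2 < M,
      ((catalan x.1 * catalan x.2 : ℕ) : R) * z ^ (x.1 + x.2 + 2) := by
    rw [sum_filter]
    refine sum_congr rfl fun x _ => ?_
    split_ifs with h
    · rfl
    · rw [pow_eq_zero_of_le (by lia) hz, mul_zero]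
  have h3 : ∑ x ∈ range (M + 1) ×ˢ range (M + 1) with x.1 + x.2 < M,
      ((catalan x.1 * catalan x.2 : ℕ) : R) * z ^ (x.1 + x.2 + 2) =
      ∑ m ∈ range M, (catalan (m + 1) : R) * z ^ (m + 2) := by
    rw [← sum_fiberwise_of_maps_to (t := range M) (g := fun x : ℕ × ℕ => x.1 + x.2)
      (fun x hx => mem_range.2 (mem_filter.1 hx).2)]
    refine sum_congr rfl fun m hm => ?_
    rw [catalan_succ', Nat.cast_sum, sum_mul]
    refine sum_congr ?_ fun x hx => ?_
    · ext x
      simp only [mem_filter, mem_product, mem_range, HasAntidiagonal.mem_antidiagonal] at hm ⊢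
      lia
    · rw [HasAntidiagonal.mem_antidiagonal] at hx
      rw [hx]
  rw [h1, h2, h3, hS, sum_range_succ', catalan_zero]
  push_cast
  ring

lemma isUnit_add_prime_mul {p k : ℕ} {u : ZMod (p ^ k)} (hu : IsUnit u) (t : ZMod (p ^ k)) :
    IsUnit (u + p * t) := by
  refine IsNilpotent.isUnit_add_left_of_commute ⟨k, ?_⟩ hu (Commute.all _ _)
  have : ((p : ZMod (p ^ k))) ^ k = 0 := by exact_mod_cast ZMod.natCast_self (p ^ k)
  rw [mul_pow, this, zero_mul]

lemma isUnit_two_zmod {p k : ℕ} (hodd : Odd p) : IsUnit (2 : ZMod (p ^ k)) := by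
  have : IsUnit ((2 : ℕ) : ZMod (p ^ k)) := by
    rw [ZMod.isUnit_iff_coprime]
    exact Nat.Coprime.pow_right k (Nat.coprime_two_left.2 hodd)
  exact_mod_cast this

lemma isUnit_intCast_zmod {p k : ℕ} (hp : p.Prime) {m : ℤ} (hm : ((m : ℤ) : ZMod p) ≠ 0) :
    IsUnit (m : ZMod (p ^ k)) := by
  rw [ZMod.coe_int_isUnit_iff_isCoprime]
  have h : IsCoprime (p : ℤ) m := by
    rw [(Nat.prime_iff_prime_int.1 hp).coprime_iff_not_dvd, ← ZMod.intCast_zmod_eq_zero_iff_dvd]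
    exact hm
  push_cast
  exact h.pow_left

/-- The sum `x + y` is `2` modulo `p`, hence a unit, so `(x + y)(x - y) = 0` forces equality. -/
lemma sq_eq_sq_unique {p k : ℕ} (hodd : Odd p) {x y s t : ZMod (p ^ k)}
    (hx : x = 1 + p * s) (hy : y = 1 + p * t) (h : x ^ 2 = y ^ 2) : x = y := by
  have h1 : (x + y) * (x - y) = 0 := by linear_combination h
  have h2 : IsUnit (x + y) := by
    have : x + y = 2 + p * (s + t) := by rw [hx, hy]; ring
    rw [this]
    exact isUnit_add_prime_mul (isUnit_two_zmod hodd) _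
  exact sub_eq_zero.1 (h2.mul_right_eq_zero.1 h1)

lemma truncSqrt_prime_mul {p k : ℕ} (N : ℕ) (t : ZMod (p ^ k)) :
    ∃ s, truncSqrt N (p * t) = 1 + p * s := by
  refine ⟨-2 * ∑ j ∈ range N, (catalan j : ZMod (p ^ k)) * (t * (p * t) ^ j), ?_⟩
  have : ∑ j ∈ range N, (catalan j : ZMod (p ^ k)) * (p * t) ^ (j + 1) =
      p * ∑ j ∈ range N, (catalan j : ZMod (p ^ k)) * (t * (p * t) ^ j) := by
    rw [mul_sum]
    exact sum_congr rfl fun j _ => by ring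
  rw [truncSqrt, this]
  ring

/-- The square root of `m / r` congruent to `1` modulo `p`, for `m ≡ r (mod p)`. -/
noncomputable def branch (p k : ℕ) (r m : ℤ) : ZMod (p ^ k) :=
  truncSqrt k ((r - m : ZMod (p ^ k)) * (4 * r : ZMod (p ^ k))⁻¹)

lemma isUnit_four_mul {p k : ℕ} (hodd : Odd p) {r : ZMod (p ^ k)}
    (hr : IsUnit r) : IsUnit (4 * r) := by
  have h2 := isUnit_two_zmod (k := k) hodd
  have : (4 : ZMod (p ^ k)) = 2 * 2 := by norm_num
  rw [this]
  exact (h2.mul h2).mul hr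

lemma exists_eq_add_prime_mul {p k : ℕ} {m r : ℤ} (h : (m : ZMod p) = r) :
    ∃ t : ℤ, (m : ZMod (p ^ k)) = r + p * t := by
  obtain ⟨t, ht⟩ := (ZMod.intCast_eq_intCast_iff_dvd_sub _ _ _).1 h.symm
  exact ⟨t, by rw [← sub_eq_iff_eq_add']; exact_mod_cast congrArg (Int.cast : ℤ → ZMod (p ^ k)) ht⟩

lemma branch_eq_one_add {p k : ℕ} {m r : ℤ} (h : (m : ZMod p) = r) :
    ∃ s, branch p k r m = 1 + p * s := by
  obtain ⟨t, ht⟩ := exists_eq_add_prime_mul (k := k) h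
  have : (r - m : ZMod (p ^ k)) * (4 * r : ZMod (p ^ k))⁻¹ =
      p * (-t * (4 * r : ZMod (p ^ k))⁻¹) := by rw [ht]; ring
  rw [branch, this]
  exact truncSqrt_prime_mul _ _

/-- One has `1 - 4·(r - m)/(4r) = m/r`, and the argument is divisible by `p`, so truncation after
`k` terms is exact. -/
lemma branch_sq {p k : ℕ} (hp : p.Prime) (hodd : Odd p) {m r : ℤ} (h : (m : ZMod p) = r)
    (hr : (r : ZMod p) ≠ 0) : (r : ZMod (p ^ k)) * branch p k r m ^ 2 = m := by
  obtain ⟨t, ht⟩ := exists_eq_add_prime_mul (k := k) h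
  have hru : IsUnit (r : ZMod (p ^ k)) := isUnit_intCast_zmod hp hr
  have h4 := isUnit_four_mul hodd hru
  rw [branch, truncSqrt_sq]
  · have := ZMod.mul_inv_of_unit _ h4
    linear_combination (m - r : ZMod (p ^ k)) * this
  · have h1 : (r - m : ZMod (p ^ k)) * (4 * r : ZMod (p ^ k))⁻¹ =
      p * (-t * (4 * r : ZMod (p ^ k))⁻¹) := by rw [ht]; ring
    have : ((p : ZMod (p ^ k))) ^ k = 0 := by exact_mod_cast ZMod.natCast_self (p ^ k)
    rw [h1, mul_pow, pow_succ (p : ZMod (p ^ k)), this, zero_mul, zero_mul]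

/-- Both sides are `1` modulo `p` and have the same square, so they agree by `sq_eq_sq_unique`. Here
truncation at `N` suffices because `p^(e(N+1)) = 0`. -/
lemma branch_shift {p k e N : ℕ} (hp : p.Prime) (hodd : Odd p) (he : 1 ≤ e)
    (hk : k ≤ e * (N + 1)) {m r : ℤ} (h : (m : ZMod p) = r) (hr : (r : ZMod p) ≠ 0) (t : ℤ) :
    branch p k r (m + p ^ e * t) = branch p k r m *
      truncSqrt N ((p : ZMod (p ^ k)) ^ e * t * -(4 * m : ZMod (p ^ k))⁻¹) := by
  have hm : (m : ZMod p) ≠ 0 := h ▸ hr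
  have hmu : IsUnit (m : ZMod (p ^ k)) := isUnit_intCast_zmod hp hm
  have hru : IsUnit (r : ZMod (p ^ k)) := isUnit_intCast_zmod hp hr
  have h4 := ZMod.mul_inv_of_unit _ (isUnit_four_mul hodd hmu)
  have hpk : ((p : ZMod (p ^ k))) ^ k = 0 := by exact_mod_cast ZMod.natCast_self (p ^ k)
  obtain ⟨e', rfl⟩ : ∃ e', e = e' + 1 := ⟨e - 1, by lia⟩
  have hm' : ((m + p ^ (e' + 1) * t : ℤ) : ZMod p) = r := by
    push_cast; simp [h]
  obtain ⟨s₁, hs₁⟩ := branch_eq_one_add (k := k) h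
  obtain ⟨s₂, hs₂⟩ := branch_eq_one_add (k := k) hm'
  obtain ⟨s₃, hs₃⟩ := truncSqrt_prime_mul (k := k) (p := p) N
    ((p : ZMod (p ^ k)) ^ e' * t * -(4 * m : ZMod (p ^ k))⁻¹)
  rw [show (p : ZMod (p ^ k)) * (p ^ e' * t * -(4 * m : ZMod (p ^ k))⁻¹) =
    p ^ (e' + 1) * t * -(4 * m : ZMod (p ^ k))⁻¹ by ring] at hs₃
  refine sq_eq_sq_unique hodd hs₂ (t := s₁ + s₃ + p * s₁ * s₃) (by rw [hs₁, hs₃]; ring) ?_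
  apply hru.mul_left_cancel
  rw [branch_sq hp hodd hm' hr, mul_pow, ← mul_assoc, branch_sq hp hodd h hr, truncSqrt_sq]
  · push_cast
    linear_combination (-(p : ZMod (p ^ k)) ^ (e' + 1) * t) * h4
  · rw [mul_assoc, mul_pow, ← pow_mul, pow_eq_zero_of_le hk hpk, zero_mul]

/-- A polynomial in the product `xy` contains only the monomials `x^j y^j`; this is the diagonal
form to which the double Hölder argument applies. -/
lemma mul_truncSqrt_eq {R : Type*} [CommRing R] (N : ℕ) (c P v : R) (x y : ℤ) :
    c * truncSqrt N (P * (x * y : ℤ) * v) =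
      c + diagPairing (fun j : Fin N => c * (-2 * v ^ (j.1 + 1)) * catalan j.1 * P ^ (j.1 + 1))
        (moment N x) (moment N y) := by
  simp only [truncSqrt, diagPairing, moment]
  rw [Fin.sum_univ_eq_sum_range (fun j => c * (-2 * v ^ (j + 1)) * catalan j * P ^ (j + 1) *
    ((x ^ (j + 1) : ℤ) : R) * ((y ^ (j + 1) : ℤ) : R)) N, mul_sub, mul_one, sub_eq_add_neg]
  congr 1
  rw [mul_sum, mul_sum, ← sum_neg_distrib]
  refine sum_congr rfl fun j _ => ?_
  push_cast
  ring

/-! ### Short sums of square roots, by shifts with products. -/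

lemma norm_sum_shift_sub_le {F : ℤ → ℂ} (hF : ∀ m, ‖F m‖ ≤ 1) {A B : ℤ} (hAB : A ≤ B) (h : ℕ) :
    ‖∑ m ∈ Ico A B, F m - ∑ m ∈ Ico A B, F (m + h)‖ ≤ 2 * h := by
  have hh : (0 : ℤ) ≤ h := by positivity
  have h1 : ∑ m ∈ Ico A B, F (m + h) = ∑ m ∈ Ico (A + h) (B + h), F m := by
    rw [← Finset.map_add_right_Ico, sum_map]; rfl
  have hb : ∀ a : ℤ, ‖∑ m ∈ Ico a (a + h), F m‖ ≤ h := fun a => by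
    refine (norm_sum_le _ _).trans ((sum_le_sum fun m _ => hF m).trans (le_of_eq ?_))
    simp
  have hsplit : ∀ a b c : ℤ, a ≤ b → b ≤ c →
      ∑ m ∈ Ico a c, F m = ∑ m ∈ Ico a b, F m + ∑ m ∈ Ico b c, F m := fun a b c hab hbc => by
    rw [← Ico_union_Ico_eq_Ico hab hbc, sum_union (Ico_disjoint_Ico_consecutive a b c)]
  have h2 := hsplit A B (B + h) hAB (by linarith)
  have h3 := hsplit A (A + h) (B + h) (by linarith) (by linarith)
  have h4 : ∑ m ∈ Ico A B, F m - ∑ m ∈ Ico A B, F (m + h) =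
      ∑ m ∈ Ico A (A + h), F m - ∑ m ∈ Ico B (B + h), F m := by
    rw [h1]; linear_combination h3 - h2
  rw [h4]
  calc _ ≤ _ := norm_sub_le _ _
    _ ≤ h + h := add_le_add (hb A) (hb B)
    _ = _ := by ring

/-- Cancellation in short sums of `ψ(c √m)`. -/
theorem branch_interval_bound {n : ℕ} (hn : 128 ≤ n) :
    ∃ C : ℝ, 0 < C ∧ ∀ p g k : ℕ, p.Prime → Odd p → 1 ≤ g → 16 * n * g ≤ k →
      k ≤ (16 * n + 2) * g →
      ∀ c : ZMod (p ^ k), (∀ x, c * x = 0 → (p : ZMod (p ^ k)) ^ g * x = 0) →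
      ∀ ψ : AddChar (ZMod (p ^ k)) ℂ, (∀ z, ψ z = 1 → z = 0) →
      ∀ r A B : ℤ, (r : ZMod p) ≠ 0 → A ≤ B →
      ‖∑ m ∈ Ico A B with ((m : ℤ) : ZMod p) = r, ψ (c * branch p k r m)‖ ≤
      C * ((B - A : ℤ) : ℝ) * (p ^ g : ℝ) ^ (-savingExp n) + 2 * (p ^ g : ℝ) ^ 4 := by
  classical
  obtain ⟨C, hC, hT⟩ := polynomial_bilinear_bound hn
  refine ⟨C, hC, fun p g k hp hodd hg hk1 hk2 c hc ψ hψ r A B hr hAB => ?_⟩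
  have : NeZero (p ^ k) := ⟨(pow_pos hp.pos k).ne'⟩
  set P : ℝ := (p : ℝ) ^ g with hP
  have hP1 : 1 ≤ P := one_le_pow₀ (by exact_mod_cast hp.one_le)
  have hP0 : 0 < P := by linarith
  set F : ℤ → ℂ := fun m => if (m : ZMod p) = r then ψ (c * branch p k r m) else 0 with hF
  have hF1 : ∀ m, ‖F m‖ ≤ 1 := fun m => by
    simp only [hF]; split_ifs <;> simp [AddChar.norm_apply]
  rw [sum_filter]
  change ‖∑ m ∈ Ico A B, F m‖ ≤ _
  set S := ∑ m ∈ Ico A B, F m with hS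
  set I := Ico (0 : ℤ) (p ^ g : ℕ) with hI
  have hIc : (#I : ℝ) = P := by
    rw [hI, Int.card_Ico, sub_zero, Int.toNat_natCast, hP]; push_cast; rfl
  have hinner : ∀ m : ℤ, ‖∑ x ∈ I, ∑ y ∈ I, F (m + p ^ (2 * g) * (x * y))‖ ≤
      C * P ^ (2 - savingExp n) := by
    intro m
    have hcls : ∀ x y : ℤ, ((m + p ^ (2 * g) * (x * y) : ℤ) : ZMod p) = m := fun x y => by
      have : (2 * g) ≠ 0 := by lia
      push_cast; simp [this]
    by_cases hm : (m : ZMod p) = r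
    · have h1 : ∀ x y : ℤ, F (m + p ^ (2 * g) * (x * y)) = ψ (c * branch p k r m) *
          ψ (diagPairing (fun j : Fin (8 * n) => c * (branch p k r m *
            (-2 * (-(4 * m : ZMod (p ^ k))⁻¹) ^ (j.1 + 1))) * catalan j.1 *
            (p : ZMod (p ^ k)) ^ (2 * g * (j.1 + 1))) (moment _ x) (moment _ y)) := by
        intro x y
        simp only [hF]
        -- Degree `8n` is enough: the shift carries `p^(2g)` and `k ≤ 2g(8n + 1)`.
        rw [if_pos (by rw [hcls, hm]), branch_shift (N := 8 * n) hp hodd (by lia)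
          (hk2.trans (le_of_eq (by ring))) hm hr, ← mul_assoc, mul_truncSqrt_eq,
          AddChar.map_add_eq_mul]
        congr 3
        funext j
        rw [← pow_mul]; ring
      simp_rw [h1, ← mul_sum]
      rw [norm_mul, AddChar.norm_apply, one_mul]
      refine hT p g k hp hk1 hk2 c hc _ (fun j => ?_) ψ hψ
      have hmu : IsUnit (m : ZMod (p ^ k)) := isUnit_intCast_zmod hp (hm ▸ hr)
      have h4 : IsUnit (4 * m : ZMod (p ^ k))⁻¹ := by
        have h5 := isUnit_four_mul hodd hmu
        exact IsUnit.of_mul_eq_one _ (ZMod.inv_mul_of_unit _ h5)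
      obtain ⟨s, hs⟩ := branch_eq_one_add (k := k) hm
      rw [hs]
      exact (isUnit_add_prime_mul isUnit_one s).mul
        ((isUnit_two_zmod hodd).neg.mul (h4.neg.pow _))
    · have h1 : ∀ x y : ℤ, F (m + p ^ (2 * g) * (x * y)) = 0 := fun x y => by
        simp only [hF]; rw [if_neg (by rw [hcls]; exact hm)]
      simp only [h1, sum_const_zero, norm_zero]
      positivity
  have hsum : ‖∑ x ∈ I, ∑ y ∈ I, ∑ m ∈ Ico A B, F (m + p ^ (2 * g) * (x * y))‖ ≤
      ((B - A : ℤ) : ℝ) * (C * P ^ (2 - savingExp n)) := by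
    have h1 : ∑ x ∈ I, ∑ y ∈ I, ∑ m ∈ Ico A B, F (m + p ^ (2 * g) * (x * y)) =
        ∑ m ∈ Ico A B, ∑ x ∈ I, ∑ y ∈ I, F (m + p ^ (2 * g) * (x * y)) := by
      rw [sum_comm (s := Ico A B)]
      exact sum_congr rfl fun x _ => sum_comm
    rw [h1]
    refine (norm_sum_le _ _).trans ((sum_le_sum fun m _ => hinner m).trans (le_of_eq ?_))
    rw [sum_const, nsmul_eq_mul, Int.card_Ico]
    congr 1
    have : ((B - A).toNat : ℤ) = B - A := Int.toNat_of_nonneg (by linarith)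
    exact_mod_cast congrArg (Int.cast : ℤ → ℝ) this
  -- Each shift `P² x y` is at most `P⁴`, so it changes the sum over the interval by at most `2P⁴`.
  have hdiff : ‖∑ x ∈ I, ∑ y ∈ I, S - ∑ x ∈ I, ∑ y ∈ I, ∑ m ∈ Ico A B,
      F (m + p ^ (2 * g) * (x * y))‖ ≤ P * (P * (2 * P ^ 4)) := by
    rw [← sum_sub_distrib]
    have h1 : ∀ x ∈ I, ∀ y ∈ I,
        ‖S - ∑ m ∈ Ico A B, F (m + p ^ (2 * g) * (x * y))‖ ≤ 2 * P ^ 4 := by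
      intro x hx y hy
      rw [hI, mem_Ico] at hx hy
      obtain ⟨a, rfl⟩ := Int.eq_ofNat_of_zero_le hx.1
      obtain ⟨b, rfl⟩ := Int.eq_ofNat_of_zero_le hy.1
      have h2 := norm_sum_shift_sub_le hF1 hAB (p ^ (2 * g) * (a * b))
      push_cast at h2
      refine h2.trans ?_
      have ha : (a : ℝ) ≤ P := by rw [hP]; exact_mod_cast hx.2.le
      have hb : (b : ℝ) ≤ P := by rw [hP]; exact_mod_cast hy.2.le
      have h3 : (p : ℝ) ^ (2 * g) = P ^ 2 := by rw [hP, ← pow_mul, mul_comm]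
      rw [h3]
      calc 2 * (P ^ 2 * (a * b)) ≤ 2 * (P ^ 2 * (P * P)) := by gcongr
        _ = _ := by ring
    refine (norm_sum_le _ _).trans ?_
    calc _ ≤ ∑ x ∈ I, P * (2 * P ^ 4) := by
          refine sum_le_sum fun x hx => ?_
          rw [← sum_sub_distrib]
          refine (norm_sum_le _ _).trans ((sum_le_sum fun y hy => h1 x hx y hy).trans ?_)
          rw [sum_const, nsmul_eq_mul, hIc]
      _ = _ := by rw [sum_const, nsmul_eq_mul, hIc]
  have hconst : ‖∑ x ∈ I, ∑ y ∈ I, S‖ = P ^ 2 * ‖S‖ := by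
    simp only [sum_const, nsmul_eq_mul, norm_mul, Complex.norm_natCast, hIc]
    ring
  have htri : P ^ 2 * ‖S‖ ≤ ((B - A : ℤ) : ℝ) * (C * P ^ (2 - savingExp n)) +
      P * (P * (2 * P ^ 4)) := by
    rw [← hconst]
    have := norm_sub_norm_le (∑ x ∈ I, ∑ y ∈ I, S)
      (∑ x ∈ I, ∑ y ∈ I, ∑ m ∈ Ico A B, F (m + p ^ (2 * g) * (x * y)))
    linarith
  have hexp : P ^ (2 - savingExp n) = P ^ 2 * P ^ (-savingExp n) := by
    rw [sub_eq_add_neg, Real.rpow_add hP0, Real.rpow_two]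
  rw [hexp] at htri
  have : P ^ 2 * ‖S‖ ≤ P ^ 2 * (C * ((B - A : ℤ) : ℝ) * P ^ (-savingExp n) + 2 * P ^ 4) := by
    refine htri.trans (le_of_eq (by ring))
  exact le_of_mul_le_mul_left this (by positivity)

/-! ### Kloosterman sums to prime power moduli -/

lemma kloostermanSum_eq (m a : ℤ) (q : ℕ) [NeZero q] :
    kloostermanSum m a q = ((1 / √(q : ℝ) : ℝ) : ℂ) *
      ∑ b : ZMod q with IsUnit b, ZMod.stdAddChar ((m : ZMod q) * b + (a : ZMod q) * b⁻¹) := by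
  rw [kloostermanSum]
  congr 1
  refine sum_nbij' (fun b => (b : ZMod q)) (fun b => b.val) ?_ ?_ ?_ ?_ ?_
  · intro b hb
    rw [mem_filter] at hb ⊢
    exact ⟨mem_univ _, (ZMod.isUnit_iff_coprime _ _).2 hb.2⟩
  · intro b hb
    rw [mem_filter] at hb ⊢
    refine ⟨mem_range.2 (ZMod.val_lt b), ?_⟩
    rw [← ZMod.isUnit_iff_coprime, ZMod.natCast_zmod_val]
    exact hb.2
  · intro b hb
    exact ZMod.val_cast_of_lt (mem_range.1 (mem_filter.1 hb).1)
  · intro b _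
    exact ZMod.natCast_zmod_val b
  · intro b _
    have h : (m : ZMod q) * b + (a : ZMod q) * (b : ZMod q)⁻¹ =
        ((m * (b : ℤ) + a * (((b : ZMod q)⁻¹).val : ℤ) : ℤ) : ZMod q) := by
      push_cast
      rw [ZMod.natCast_zmod_val]
    rw [h, ZMod.stdAddChar_coe, expTwoPiI]
    congr 1
    push_cast
    ring

lemma stdAddChar_eq_one {q : ℕ} [NeZero q] (z : ZMod q) (hz : ZMod.stdAddChar z = 1) : z = 0 := by
  rwa [← (ZMod.stdAddChar (N := q)).map_zero_eq_one, ZMod.injective_stdAddChar.eq_iff] at hz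

lemma sum_units_mul {q : ℕ} [NeZero q] {v : ZMod q} (hv : IsUnit v) (F : ZMod q → ℂ) :
    ∑ b : ZMod q with IsUnit b, F (b * v) = ∑ b : ZMod q with IsUnit b, F b := by
  have h1 := ZMod.mul_inv_of_unit _ hv
  have h2 : IsUnit v⁻¹ := IsUnit.of_mul_eq_one _ (ZMod.inv_mul_of_unit _ hv)
  refine sum_nbij' (fun b => b * v) (fun b => b * v⁻¹) ?_ ?_ ?_ ?_ ?_
  · intro b hb
    exact mem_filter.2 ⟨mem_univ _, (mem_filter.1 hb).2.mul hv⟩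
  · intro b hb
    exact mem_filter.2 ⟨mem_univ _, (mem_filter.1 hb).2.mul h2⟩
  · intro b _
    linear_combination b * h1
  · intro b _
    linear_combination b * h1
  · intro b _
    rfl

/-- The inverse of a product with a unit. -/
lemma zmod_mul_inv_of_isUnit {q : ℕ} {b v w : ZMod q} (hb : IsUnit b) (hvw : v * w = 1) :
    (b * v)⁻¹ = b⁻¹ * w := by
  have h1 := ZMod.mul_inv_of_unit _ hb
  have h2 := ZMod.inv_mul_of_unit _ (hb.mul (IsUnit.of_mul_eq_one _ hvw))
  linear_combination (-(b * v)⁻¹) * h1 + b⁻¹ * w * h2 - (b * v)⁻¹ * b * b⁻¹ * hvw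

/-- The stationary points modulo `p^(k - h)` of the phase `αb + β/b`. -/
noncomputable def stationaryPoints (p k h : ℕ) [NeZero (p ^ k)] (α β : ZMod (p ^ k)) :
    Finset (ZMod (p ^ k)) :=
  {b | IsUnit b ∧ (p : ZMod (p ^ k)) ^ h * (α * b - β * b⁻¹) = 0}

/-- The inverse of `1 + p^h t` is `1 - p^h t` because `p^(2h) = 0`, so `b ↦ b(1 + p^h t)` changes
the phase by `t p^h (αb - β/b)`. Averaging over all `t` keeps exactly the stationary `b`. -/
lemma sum_units_eq_sum_stationary {p k h : ℕ} [NeZero (p ^ k)] (hk : k ≤ 2 * h)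
    (α β : ZMod (p ^ k)) :
    ∑ b : ZMod (p ^ k) with IsUnit b, ZMod.stdAddChar (α * b + β * b⁻¹) =
      ∑ b ∈ stationaryPoints p k h α β, ZMod.stdAddChar (α * b + β * b⁻¹) := by
  set ψ := ZMod.stdAddChar (N := p ^ k) with hψ
  set F : ZMod (p ^ k) → ℂ := fun b => ψ (α * b + β * b⁻¹) with hF
  have hpk : ((p : ZMod (p ^ k))) ^ (2 * h) = 0 :=
    pow_eq_zero_of_le hk (by exact_mod_cast ZMod.natCast_self (p ^ k))
  have hvw : ∀ t : ZMod (p ^ k), (1 + (p : ZMod (p ^ k)) ^ h * t) * (1 - p ^ h * t) = 1 := by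
    intro t
    have : (p : ZMod (p ^ k)) ^ h * p ^ h = 0 := by rw [← pow_add, ← two_mul, hpk]
    linear_combination (-t ^ 2) * this
  have h1 : ∀ t : ZMod (p ^ k), ∑ b : ZMod (p ^ k) with IsUnit b, F b =
      ∑ b : ZMod (p ^ k) with IsUnit b, F b * ψ (t * (p ^ h * (α * b - β * b⁻¹))) := by
    intro t
    rw [← sum_units_mul (IsUnit.of_mul_eq_one _ (hvw t)) F]
    refine sum_congr rfl fun b hb => ?_
    simp only [hF]
    rw [zmod_mul_inv_of_isUnit (mem_filter.1 hb).2 (hvw t), ← AddChar.map_add_eq_mul]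
    congr 1
    ring
  have h2 : ∑ t : ZMod (p ^ k), ∑ b : ZMod (p ^ k) with IsUnit b, F b =
      ∑ b : ZMod (p ^ k) with IsUnit b,
        if (p : ZMod (p ^ k)) ^ h * (α * b - β * b⁻¹) = 0 then (p ^ k : ℕ) * F b else 0 := by
    rw [sum_congr rfl fun t _ => h1 t, sum_comm]
    refine sum_congr rfl fun b _ => ?_
    rw [← mul_sum, AddChar.sum_mulShift _ (ZMod.isPrimitive_stdAddChar (p ^ k)), ZMod.card]
    split_ifs
    · ring
    · simp
  rw [sum_const, card_univ, ZMod.card, nsmul_eq_mul, ← sum_filter, filter_filter, ← mul_sum] at h2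
  have h3 : ((p ^ k : ℕ) : ℂ) ≠ 0 := Nat.cast_ne_zero.2 (NeZero.ne _)
  exact mul_left_cancel₀ h3 h2

/-- After `b ↦ b/f` the factor `f` multiplies the whole phase. Being a unit, it does not affect
stationarity, so the range of summation depends on `α` and not on `m`. -/
lemma kloostermanSum_eq_stationary {p k h : ℕ} [NeZero (p ^ k)] (hk : k ≤ 2 * h) {m a : ℤ}
    {α f : ZMod (p ^ k)} (hf : IsUnit f) (hm : (m : ZMod (p ^ k)) = α * f ^ 2) :
    kloostermanSum m a (p ^ k) = ((1 / √((p ^ k : ℕ) : ℝ) : ℝ) : ℂ) *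
      ∑ b ∈ stationaryPoints p k h α a, ZMod.stdAddChar ((α * b + (a : ZMod (p ^ k)) * b⁻¹) * f) := by
  rw [kloostermanSum_eq]
  congr 1
  have hf1 := ZMod.inv_mul_of_unit _ hf
  have hf2 : IsUnit f⁻¹ := IsUnit.of_mul_eq_one _ hf1
  rw [← sum_units_mul hf2]
  have h1 : ∀ b ∈ ({b : ZMod (p ^ k) | IsUnit b} : Finset _),
      ZMod.stdAddChar ((m : ZMod (p ^ k)) * (b * f⁻¹) + (a : ZMod (p ^ k)) * (b * f⁻¹)⁻¹) =
      ZMod.stdAddChar (α * f * b + (a : ZMod (p ^ k)) * f * b⁻¹) := by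
    intro b hb
    rw [zmod_mul_inv_of_isUnit (mem_filter.1 hb).2 hf1, hm]
    congr 1
    linear_combination α * f * b * hf1
  rw [sum_congr rfl h1, sum_units_eq_sum_stationary hk]
  refine sum_congr ?_ fun b _ => by congr 1; ring
  ext b
  simp only [stationaryPoints, mem_filter, mem_univ, true_and]
  refine and_congr_right fun _ => ?_
  rw [show (p : ZMod (p ^ k)) ^ h * (α * f * b - a * f * b⁻¹) =
    (p ^ h * (α * b - a * b⁻¹)) * f by ring, hf.mul_left_eq_zero]

lemma card_pow_mul_eq_zero_le (p k h : ℕ) (hp : 0 < p) [NeZero (p ^ k)] :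
    #{u : ZMod (p ^ k) | (p : ZMod (p ^ k)) ^ h * u = 0} ≤ p ^ h := by
  have := IsAddCyclic.card_nsmul_eq_zero_le (α := ZMod (p ^ k)) (n := p ^ h) (pow_pos hp h)
  refine le_trans (le_of_eq ?_) this
  congr 1
  refine filter_congr fun u _ => ?_
  rw [nsmul_eq_mul, Nat.cast_pow]

/-- Two stationary points satisfy `p^h (b - b₀)(b + b₀) = 0`. One factor is a unit, since otherwise
`p` would divide `2b`; hence `b` is within the `p^h`-torsion of `b₀` or of `-b₀`. -/
lemma card_stationaryPoints_le {p k h : ℕ} [NeZero (p ^ k)] (hp : p.Prime) (hodd : Odd p)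
    {α β : ZMod (p ^ k)} (hα : IsUnit α) :
    #(stationaryPoints p k h α β) ≤ 2 * p ^ h := by
  classical
  rcases (stationaryPoints p k h α β).eq_empty_or_nonempty with h0 | ⟨b₀, hb₀⟩
  · rw [h0]; simp
  set Z : Finset (ZMod (p ^ k)) := {u | (p : ZMod (p ^ k)) ^ h * u = 0} with hZ
  have hsub : stationaryPoints p k h α β ⊆ Z.image (fun u => u + b₀) ∪ Z.image (fun u => u - b₀) := by
    intro b hb
    simp only [stationaryPoints, mem_filter, mem_univ, true_and] at hb hb₀
    have h1 := ZMod.mul_inv_of_unit _ hb.1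
    have h2 := ZMod.mul_inv_of_unit _ hb₀.1
    have h3 : (p : ZMod (p ^ k)) ^ h * ((b - b₀) * (b + b₀)) = 0 := by
      apply hα.mul_right_eq_zero.1
      linear_combination b * hb.2 - b₀ * hb₀.2 + p ^ h * β * (h1 - h2)
    have h4 : IsUnit (b - b₀) ∨ IsUnit (b + b₀) := by
      obtain ⟨x, rfl⟩ := ZMod.intCast_surjective b
      obtain ⟨y, rfl⟩ := ZMod.intCast_surjective b₀
      by_contra! hcon
      have hx : (((x - y : ℤ)) : ZMod p) = 0 := by
        by_contra hne
        exact hcon.1 (by exact_mod_cast isUnit_intCast_zmod (k := k) hp hne)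
      have hy : (((x + y : ℤ)) : ZMod p) = 0 := by
        by_contra hne
        exact hcon.2 (by exact_mod_cast isUnit_intCast_zmod (k := k) hp hne)
      rw [ZMod.intCast_zmod_eq_zero_iff_dvd] at hx hy
      have h5 : (p : ℤ) ∣ 2 * x := by
        have := dvd_add hx hy
        rwa [show x - y + (x + y) = 2 * x by ring] at this
      have h6 : (p : ℤ) ∣ x := by
        refine IsCoprime.dvd_of_dvd_mul_left ?_ h5
        have : Nat.Coprime p 2 := (Nat.coprime_two_left.2 hodd).symm
        exact_mod_cast Nat.isCoprime_iff_coprime.2 this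
      obtain ⟨t, rfl⟩ := h6
      have h7 : IsUnit (p : ZMod (p ^ k)) := by
        have := hb.1
        push_cast at this
        exact isUnit_of_mul_isUnit_left this
      rw [ZMod.isUnit_iff_coprime] at h7
      rcases Nat.eq_zero_or_pos k with rfl | hk
      · have : Subsingleton (ZMod (p ^ 0)) := by rw [pow_zero]; infer_instance
        exact hcon.1 (isUnit_of_subsingleton _)
      · exact hp.one_lt.ne' (Nat.Coprime.eq_one_of_dvd h7 (dvd_pow_self p hk.ne'))
    rw [mem_union, mem_image, mem_image]
    rcases h4 with h4 | h4
    · right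
      refine ⟨b + b₀, mem_filter.2 ⟨mem_univ _, ?_⟩, by ring⟩
      apply h4.mul_right_eq_zero.1
      linear_combination h3
    · left
      refine ⟨b - b₀, mem_filter.2 ⟨mem_univ _, ?_⟩, by ring⟩
      apply h4.mul_right_eq_zero.1
      linear_combination h3
  calc _ ≤ _ := card_le_card hsub
    _ ≤ #Z + #Z := (card_union_le _ _).trans (add_le_add card_image_le card_image_le)
    _ ≤ p ^ h + p ^ h := add_le_add (card_pow_mul_eq_zero_le p k h hp.pos)
        (card_pow_mul_eq_zero_le p k h hp.pos)
    _ = _ := by ring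

/-- Such a `u` is a multiple of `p^(k-h)`. The extra factor `p` covers odd `k`, where `h = (k+1)/2`
and `2(k - h) = k - 1`. -/
lemma prime_mul_sq_eq_zero {p k h : ℕ} [NeZero (p ^ k)] (hp : 0 < p) (hhk : h ≤ k)
    (hk : 2 * h ≤ k + 1) {u : ZMod (p ^ k)} (hu : (p : ZMod (p ^ k)) ^ h * u = 0) :
    (p : ZMod (p ^ k)) * u ^ 2 = 0 := by
  have h1 : ((p ^ h * u.val : ℕ) : ZMod (p ^ k)) = 0 := by
    push_cast; rw [ZMod.natCast_zmod_val, hu]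
  rw [ZMod.natCast_eq_zero_iff] at h1
  have hsplit : p ^ k = p ^ h * p ^ (k - h) := by rw [← pow_add, Nat.add_sub_cancel' hhk]
  replace h1 : p ^ h * p ^ (k - h) ∣ p ^ h * u.val := hsplit ▸ h1
  obtain ⟨w, hw⟩ := Nat.dvd_of_mul_dvd_mul_left (pow_pos hp h) h1
  have h2 : u = p ^ (k - h) * w := by
    rw [← ZMod.natCast_zmod_val u, hw]; push_cast; rfl
  have h3 : ((p : ZMod (p ^ k))) ^ (2 * (k - h) + 1) = 0 :=
    pow_eq_zero_of_le (by lia) (show (p : ZMod (p ^ k)) ^ k = 0 by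
      exact_mod_cast ZMod.natCast_self (p ^ k))
  rw [h2]
  calc _ = (p : ZMod (p ^ k)) ^ (2 * (k - h) + 1) * w ^ 2 := by ring
    _ = 0 := by rw [h3, zero_mul]

/-- The integer `z` is a unit times a power of `p` with exponent at most `g - 1`; together with the
extra `p` this divides `p^g`. -/
lemma pow_mul_eq_zero_of_not_dvd {p k : ℕ} (hp : p.Prime) {g : ℕ} :
    ∀ {z : ℤ} {x : ZMod (p ^ k)}, ¬ (p : ℤ) ^ g ∣ z → (z : ZMod (p ^ k)) * (p * x) = 0 →
      (p : ZMod (p ^ k)) ^ g * x = 0 := by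
  induction g with
  | zero => intro z x h; simp at h
  | succ g ih =>
    intro z x hz hx
    by_cases hpz : (z : ZMod p) = 0
    · obtain ⟨t, rfl⟩ := (ZMod.intCast_zmod_eq_zero_iff_dvd _ _).1 hpz
      rw [pow_succ, mul_assoc]
      refine ih (z := t) (fun h => hz ?_) ?_
      · rw [pow_succ, mul_comm]
        exact mul_dvd_mul_left _ h
      · rw [← hx]; push_cast; ring
    · have h1 := (isUnit_intCast_zmod (k := k) hp hpz).mul_right_eq_zero.1 hx
      rw [pow_succ, mul_assoc, h1, mul_zero]

/-- The bound for sums over an interval of length `L` that results from `branch_interval_bound`. -/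
noncomputable def intervalBound (C : ℝ) (n : ℕ) (P L : ℝ) : ℝ :=
  C * L * P ^ (-savingExp n) + 2 * P ^ 4

lemma intCast_ne_zero_of_gcd {a : ℤ} {p : ℕ} (hp : p.Prime) (ha : Int.gcd a p = 1) :
    (a : ZMod p) ≠ 0 := by
  rw [Ne, ZMod.intCast_zmod_eq_zero_iff_dvd]
  intro h
  have : (p : ℤ) ∣ Int.gcd a p := Int.dvd_coe_gcd h dvd_rfl
  rw [ha] at this
  exact hp.one_lt.ne' (Nat.dvd_one.1 (by exact_mod_cast this))

/-- If `p` divides `m`, then `mb - a/b` is a unit for every unit `b`. As `k ≥ 2`, the exponent `k -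
k/2` is less than `k`, so there is no stationary point. -/
lemma kloostermanSum_eq_zero {p k : ℕ} (hp : p.Prime) (hk : 2 ≤ k) {m a : ℤ}
    (ha : (a : ZMod p) ≠ 0) (hm : (m : ZMod p) = 0) : kloostermanSum m a (p ^ k) = 0 := by
  have : NeZero (p ^ k) := ⟨(pow_pos hp.pos k).ne'⟩
  have hau : IsUnit (a : ZMod (p ^ k)) := isUnit_intCast_zmod hp ha
  rw [kloostermanSum_eq_stationary (h := k - k / 2) (α := m) (f := 1) (by lia) isUnit_one
    (by ring)]
  have : stationaryPoints p k (k - k / 2) (m : ZMod (p ^ k)) a = ∅ := by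
    refine filter_eq_empty_iff.2 fun b _ hb => ?_
    obtain ⟨t, rfl⟩ := (ZMod.intCast_zmod_eq_zero_iff_dvd _ _).1 hm
    have h1 : IsUnit (b⁻¹) := IsUnit.of_mul_eq_one _ (ZMod.inv_mul_of_unit _ hb.1)
    have h2 : IsUnit (((p * t : ℤ) : ZMod (p ^ k)) * b - a * b⁻¹) := by
      have := isUnit_add_prime_mul (hau.mul h1).neg ((t : ZMod (p ^ k)) * b)
      convert this using 1
      push_cast; ring
    have h3 : ((p ^ (k - k / 2) : ℕ) : ZMod (p ^ k)) = 0 := by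
      push_cast
      exact h2.mul_left_eq_zero.1 hb.2
    rw [ZMod.natCast_eq_zero_iff, Nat.pow_dvd_pow_iff_le_right hp.one_lt] at h3
    lia
  rw [this, sum_empty, mul_zero]

/-- The total weight after stationary phase: the normalization cancels the number of stationary
points up to a factor that is at most `p`, including the loss for odd `k`. -/
lemma stationary_factor_le {p k : ℕ} [NeZero (p ^ k)] (hp : p.Prime) (hodd : Odd p)
    {α β : ZMod (p ^ k)} (hα : IsUnit α) :
    (1 / √((p ^ k : ℕ) : ℝ)) * #(stationaryPoints p k (k - k / 2) α β) ≤ 2 * p := by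
  have h1 : (#(stationaryPoints p k (k - k / 2) α β) : ℝ) ≤ 2 * (p : ℝ) ^ (k - k / 2) := by
    exact_mod_cast card_stationaryPoints_le hp hodd hα
  have hp1 : (1 : ℝ) ≤ p := by exact_mod_cast hp.one_le
  have hs : 0 < √((p ^ k : ℕ) : ℝ) := Real.sqrt_pos.2 (by exact_mod_cast pow_pos hp.pos k)
  rw [one_div_mul_eq_div, div_le_iff₀ hs]
  refine h1.trans ?_
  rw [mul_assoc]
  refine mul_le_mul_of_nonneg_left ?_ (by norm_num)
  have h2 : (p : ℝ) ^ (k - k / 2) ≤ √(((p : ℝ) * p) * (p ^ k : ℕ)) := by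
    refine Real.le_sqrt_of_sq_le ?_
    push_cast
    rw [← pow_mul, ← pow_two, ← pow_add]
    exact pow_le_pow_right₀ hp1 (by lia)
  rwa [Real.sqrt_mul (by positivity), Real.sqrt_mul_self (by positivity)] at h2

lemma norm_kloostermanSum_le {p k : ℕ} (hp : p.Prime) (hodd : Odd p) (hk : 2 ≤ k) {a : ℤ}
    (ha : (a : ZMod p) ≠ 0) (m : ℤ) : ‖kloostermanSum m a (p ^ k)‖ ≤ 2 * p := by
  have : NeZero (p ^ k) := ⟨(pow_pos hp.pos k).ne'⟩
  by_cases hm : (m : ZMod p) = 0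
  · rw [kloostermanSum_eq_zero hp hk ha hm, norm_zero]; positivity
  rw [kloostermanSum_eq_stationary (h := k - k / 2) (α := m) (f := 1) (by lia) isUnit_one
    (by ring), norm_mul, Complex.norm_real, Real.norm_of_nonneg (by positivity)]
  refine le_trans ?_ (stationary_factor_le (β := (a : ZMod (p ^ k))) hp hodd
    (isUnit_intCast_zmod (k := k) hp hm))
  refine mul_le_mul_of_nonneg_left ((norm_sum_le _ _).trans (le_of_eq ?_)) (by positivity)
  simp [AddChar.norm_apply]

/-- At a stationary point the square of the critical value is `4αβ` up to a small error. -/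
lemma stationary_value_sq {p k : ℕ} [NeZero (p ^ k)] (hp : p.Prime) {α β b : ZMod (p ^ k)}
    (hb : b ∈ stationaryPoints p k (k - k / 2) α β) :
    (p : ZMod (p ^ k)) * (α * b + β * b⁻¹) ^ 2 = p * (4 * (α * β)) := by
  have h1 := (mem_filter.1 hb).2
  have h2 := prime_mul_sq_eq_zero hp.pos (Nat.sub_le _ _) (by lia) h1.2
  -- The identity used is `(αb + β/b)² - (αb - β/b)² = 4αβ`, and `h2` kills the second square after
  -- multiplication by `p`.
  have h3 := ZMod.mul_inv_of_unit _ h1.1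
  linear_combination h2 + 4 * p * α * β * h3

lemma sum_residue_classes {p : ℕ} [NeZero p] (T : Finset ℤ) (F : ℤ → ℂ) {K : ℝ}
    (hK : ∀ r : ℤ, ‖∑ m ∈ T with ((m : ℤ) : ZMod p) = r, F m‖ ≤ K) :
    ‖∑ m ∈ T, F m‖ ≤ p * K := by
  rw [← sum_fiberwise (s := T) (g := fun m : ℤ => (m : ZMod p))]
  refine (norm_sum_le _ _).trans ?_
  calc _ ≤ ∑ r : ZMod p, K := by
        refine sum_le_sum fun r _ => ?_
        obtain ⟨r, rfl⟩ := ZMod.intCast_surjective r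
        exact hK r
    _ = _ := by rw [sum_const, card_univ, ZMod.card, nsmul_eq_mul]

/-- On each class modulo `p` the summand is a combination of `ψ(c · branch)`, and
`branch_interval_bound` applies to each term provided `c` is not too divisible by `p`. This is read
off from the squares of the critical values. The powers of `p` come from the weights and from the
number of classes. -/
theorem kloosterman_interval_bounds {n : ℕ} (hn : 128 ≤ n) :
    ∃ C : ℝ, 0 < C ∧ ∀ p g k : ℕ, p.Prime → Odd p → 1 ≤ g → 16 * n * g ≤ k →
      k ≤ (16 * n + 2) * g → ∀ a : ℤ, (a : ZMod p) ≠ 0 → ∀ A B : ℤ, A ≤ B →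
      (∀ t : ℤ, ‖∑ m ∈ Ico A B, kloostermanSum (m * t) a (p ^ k)‖ ≤
        2 * p ^ 2 * intervalBound C n (p ^ g) ((B - A : ℤ) : ℝ)) ∧
      (∀ t₁ t₂ : ℤ, ¬ (p : ℤ) ^ g ∣ t₁ - t₂ →
        ‖∑ m ∈ Ico A B, kloostermanSum (m * t₁) a (p ^ k) *
          (starRingEnd ℂ) (kloostermanSum (m * t₂) a (p ^ k))‖ ≤
        4 * p ^ 3 * intervalBound C n (p ^ g) ((B - A : ℤ) : ℝ)) := by
  classical
  obtain ⟨C, hC, hI⟩ := branch_interval_bound hn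
  refine ⟨C, hC, fun p g k hp hodd hg hk1 hk2 a ha A B hAB => ?_⟩
  have : NeZero (p ^ k) := ⟨(pow_pos hp.pos k).ne'⟩
  have : NeZero p := ⟨hp.ne_zero⟩
  have hk : 2 ≤ k := by nlinarith
  set E := intervalBound C n (p ^ g) ((B - A : ℤ) : ℝ) with hE
  have hBA : (0 : ℝ) ≤ ((B - A : ℤ) : ℝ) := by exact_mod_cast sub_nonneg.2 hAB
  have hE0 : 0 ≤ E := by rw [hE, intervalBound]; positivity
  set h := k - k / 2 with hh
  set Q : ℝ := 1 / √((p ^ k : ℕ) : ℝ) with hQ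
  have hQ0 : 0 ≤ Q := by positivity
  have hau : IsUnit (a : ZMod (p ^ k)) := isUnit_intCast_zmod hp ha
  have h4u : IsUnit (4 : ZMod (p ^ k)) := by
    have := isUnit_four_mul (k := k) hodd isUnit_one
    rwa [mul_one] at this
  have hval : ∀ r t m : ℤ, (r : ZMod p) ≠ 0 → (m : ZMod p) = r →
      kloostermanSum (m * t) a (p ^ k) = (Q : ℂ) *
        ∑ b ∈ stationaryPoints p k h (r * t : ZMod (p ^ k)) a,
          ZMod.stdAddChar (((r * t : ZMod (p ^ k)) * b + (a : ZMod (p ^ k)) * b⁻¹) *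
            branch p k r m) := by
    intro r t m hr hm
    obtain ⟨s, hs⟩ := branch_eq_one_add (k := k) hm
    refine kloostermanSum_eq_stationary (by lia) ?_ ?_
    · rw [hs]; exact isUnit_add_prime_mul isUnit_one s
    · push_cast
      rw [← branch_sq (k := k) hp hodd hm hr]; ring
  have hzero : ∀ m t : ℤ, (m : ZMod p) = 0 ∨ (t : ZMod p) = 0 →
      kloostermanSum (m * t) a (p ^ k) = 0 := fun m t hmt =>
    kloostermanSum_eq_zero hp hk ha (by push_cast; rcases hmt with h | h <;> simp [h])
  have hunit : ∀ r t : ℤ, (r : ZMod p) ≠ 0 → (t : ZMod p) ≠ 0 →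
      IsUnit (r * t : ZMod (p ^ k)) := fun r t hr ht =>
    (isUnit_intCast_zmod hp hr).mul (isUnit_intCast_zmod hp ht)
  have hinterval : ∀ c : ZMod (p ^ k), (∀ x, c * x = 0 → (p : ZMod (p ^ k)) ^ g * x = 0) →
      ∀ r : ℤ, (r : ZMod p) ≠ 0 →
      ‖∑ m ∈ Ico A B with ((m : ℤ) : ZMod p) = r, ZMod.stdAddChar (c * branch p k r m)‖ ≤ E :=
    fun c hc r hr => hI p g k hp hodd hg hk1 hk2 c hc _ stdAddChar_eq_one r A B hr hAB
  have hval1 : ∀ r t : ℤ, ∀ b ∈ stationaryPoints p k h (r * t : ZMod (p ^ k)) a,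
      (p : ZMod (p ^ k)) * ((r * t : ZMod (p ^ k)) * b + a * b⁻¹) ^ 2 =
        p * (4 * (r * t * a)) := fun r t b hb => stationary_value_sq hp hb
  constructor
  · intro t
    rw [show 2 * (p : ℝ) ^ 2 * E = p * (2 * p * E) by ring]
    refine sum_residue_classes _ _ fun r => ?_
    by_cases hrt : (r : ZMod p) = 0 ∨ (t : ZMod p) = 0
    · rw [sum_eq_zero, norm_zero]
      · positivity
      · intro m hm
        exact hzero m t (by rwa [(mem_filter.1 hm).2])
    push Not at hrt
    rw [sum_congr rfl fun m hm => hval r t m hrt.1 (mem_filter.1 hm).2, ← mul_sum, sum_comm,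
      norm_mul, Complex.norm_real, Real.norm_of_nonneg hQ0]
    refine le_trans ?_ (mul_le_mul_of_nonneg_right (stationary_factor_le (β := (a : ZMod (p ^ k)))
      hp hodd (hunit r t hrt.1 hrt.2)) hE0)
    rw [mul_assoc]
    refine mul_le_mul_of_nonneg_left ((norm_sum_le _ _).trans ?_) hQ0
    rw [← nsmul_eq_mul]
    refine sum_le_card_nsmul _ _ _ fun b hb => hinterval _ (fun x hx => ?_) r hrt.1
    -- If `cx = 0` then `p c² x = 0`, while `p c²` is `p` times the unit `4rta`.
    have h1 : (4 * (r * t * a : ZMod (p ^ k))) * (p * x) = 0 := by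
      linear_combination (-x) * hval1 r t b hb +
        p * ((r * t : ZMod (p ^ k)) * b + a * b⁻¹) * hx
    have h2 := (h4u.mul ((hunit r t hrt.1 hrt.2).mul hau)).mul_right_eq_zero.1 h1
    obtain ⟨g', rfl⟩ : ∃ g', g = g' + 1 := ⟨g - 1, by lia⟩
    rw [pow_succ, mul_assoc, h2, mul_zero]
  · intro t₁ t₂ ht
    rw [show 4 * (p : ℝ) ^ 3 * E = p * ((2 * p) * (2 * p) * E) by ring]
    refine sum_residue_classes _ _ fun r => ?_
    by_cases hrt : (r : ZMod p) = 0 ∨ (t₁ : ZMod p) = 0 ∨ (t₂ : ZMod p) = 0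
    · rw [sum_eq_zero, norm_zero]
      · positivity
      · intro m hm
        rw [← (mem_filter.1 hm).2] at hrt
        rcases hrt with h | h | h
        · rw [hzero m t₁ (Or.inl h), zero_mul]
        · rw [hzero m t₁ (Or.inr h), zero_mul]
        · rw [hzero m t₂ (Or.inr h), map_zero, mul_zero]
    push Not at hrt
    have hprod : ∀ m ∈ (Ico A B).filter (fun m : ℤ => (m : ZMod p) = r),
        kloostermanSum (m * t₁) a (p ^ k) *
          (starRingEnd ℂ) (kloostermanSum (m * t₂) a (p ^ k)) = ((Q * Q : ℝ) : ℂ) *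
        ∑ b₁ ∈ stationaryPoints p k h (r * t₁ : ZMod (p ^ k)) a,
          ∑ b₂ ∈ stationaryPoints p k h (r * t₂ : ZMod (p ^ k)) a,
          ZMod.stdAddChar ((((r * t₁ : ZMod (p ^ k)) * b₁ + (a : ZMod (p ^ k)) * b₁⁻¹) -
            ((r * t₂ : ZMod (p ^ k)) * b₂ + (a : ZMod (p ^ k)) * b₂⁻¹)) * branch p k r m) := by
      intro m hm
      rw [hval r t₁ m hrt.1 (mem_filter.1 hm).2, hval r t₂ m hrt.1 (mem_filter.1 hm).2, map_mul,
        Complex.conj_ofReal, map_sum, mul_mul_mul_comm, sum_mul_sum, Complex.ofReal_mul]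
      congr 1
      refine sum_congr rfl fun b₁ _ => sum_congr rfl fun b₂ _ => ?_
      rw [← AddChar.map_neg_eq_conj, ← AddChar.map_add_eq_mul]
      congr 1
      ring
    rw [sum_congr rfl hprod, ← mul_sum, norm_mul, Complex.norm_real,
      Real.norm_of_nonneg (mul_nonneg hQ0 hQ0), sum_comm]
    rw [sum_congr rfl fun b₁ _ => sum_comm]
    have hcount := mul_le_mul (stationary_factor_le (β := (a : ZMod (p ^ k)))
      hp hodd (hunit r t₁ hrt.1 hrt.2.1)) (stationary_factor_le (β := (a : ZMod (p ^ k)))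
      hp hodd (hunit r t₂ hrt.1 hrt.2.2)) (by positivity) (by positivity)
    refine le_trans ?_ (mul_le_mul_of_nonneg_right hcount hE0)
    rw [← hh, ← hQ, mul_mul_mul_comm, mul_assoc (Q * Q) (_ * _) E]
    refine mul_le_mul_of_nonneg_left ((norm_sum_le _ _).trans ?_) (mul_nonneg hQ0 hQ0)
    rw [mul_assoc, ← nsmul_eq_mul]
    refine sum_le_card_nsmul _ _ _ fun b₁ hb₁ => ?_
    refine (norm_sum_le _ _).trans ?_
    rw [← nsmul_eq_mul]
    refine sum_le_card_nsmul _ _ _ fun b₂ hb₂ => hinterval _ (fun x hx => ?_) r hrt.1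
    -- Here `c = c₁ - c₂`; multiplication by `p(c₁ + c₂)` gives the difference of the two squares,
    -- `4ra(t₁ - t₂)` times `p`.
    have h1 : (4 * (r * a : ZMod (p ^ k))) * (((t₁ - t₂ : ℤ) : ZMod (p ^ k)) * (p * x)) = 0 := by
      push_cast
      linear_combination (-x) * hval1 r t₁ b₁ hb₁ + x * hval1 r t₂ b₂ hb₂ +
        p * (((r * t₁ : ZMod (p ^ k)) * b₁ + a * b₁⁻¹) +
          ((r * t₂ : ZMod (p ^ k)) * b₂ + a * b₂⁻¹)) * hx
    exact pow_mul_eq_zero_of_not_dvd hp ht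
      ((h4u.mul ((isUnit_intCast_zmod hp hrt.1).mul hau)).mul_right_eq_zero.1 h1)

/-! ### Sums over primes -/

/-- **Abel's inequality** for a nonnegative antitone weight. -/
lemma norm_sum_antitone_mul_le {w : ℕ → ℝ} (hw : Antitone w) (hw0 : ∀ n, 0 ≤ w n) {f : ℕ → ℂ}
    {B : ℝ} {N : ℕ} (hB : ∀ n ≤ N, ‖∑ i ∈ Ioc 0 n, f i‖ ≤ B) :
    ‖∑ i ∈ Ioc 0 N, (w i : ℂ) * f i‖ ≤ B * w 1 := by
  have key : ∀ n : ℕ, ∑ i ∈ Ioc 0 n, (w i : ℂ) * f i = (w (n + 1) : ℂ) * ∑ i ∈ Ioc 0 n, f i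
      + ∑ j ∈ Ioc 0 n, ((w j - w (j + 1) : ℝ) : ℂ) * ∑ i ∈ Ioc 0 j, f i := by
    intro n
    induction n with
    | zero => simp
    | succ n ih =>
      simp only [sum_Ioc_succ_top (Nat.zero_le n)]
      rw [ih]
      push_cast
      ring
  have tel : ∀ n : ℕ, ∑ j ∈ Ioc 0 n, (w j - w (j + 1)) = w 1 - w (n + 1) := by
    intro n
    induction n with
    | zero => simp
    | succ n ih =>
      rw [sum_Ioc_succ_top (Nat.zero_le n), ih]
      ring
  have hB0 : 0 ≤ B := (norm_nonneg _).trans (hB 0 (Nat.zero_le _))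
  rw [key N]
  refine (norm_add_le _ _).trans ?_
  have h1 : ‖(w (N + 1) : ℂ) * ∑ i ∈ Ioc 0 N, f i‖ ≤ w (N + 1) * B := by
    rw [norm_mul, Complex.norm_real, Real.norm_of_nonneg (hw0 _)]
    exact mul_le_mul_of_nonneg_left (hB N le_rfl) (hw0 _)
  have h2 : ‖∑ j ∈ Ioc 0 N, ((w j - w (j + 1) : ℝ) : ℂ) * ∑ i ∈ Ioc 0 j, f i‖
      ≤ (w 1 - w (N + 1)) * B := by
    rw [← tel, sum_mul]
    refine norm_sum_le_of_le _ fun j hj => ?_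
    have : 0 ≤ w j - w (j + 1) := sub_nonneg.2 (hw (Nat.le_succ j))
    rw [norm_mul, Complex.norm_real, Real.norm_of_nonneg this]
    exact mul_le_mul_of_nonneg_left (hB j (mem_Ioc.1 hj).2) this
  linarith

/-- The logarithm increases, so Abel's inequality is applied to `log N - log i`; the constant part
`log N` accounts for the factor `2`. -/
lemma norm_sum_log_mul_le {f : ℕ → ℂ} {B : ℝ} {N : ℕ}
    (hB : ∀ n ≤ N, ‖∑ i ∈ Ioc 0 n, f i‖ ≤ B) :
    ‖∑ i ∈ Ioc 0 N, (Real.log i : ℂ) * f i‖ ≤ 2 * Real.log N * B := by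
  obtain rfl | hN := Nat.eq_zero_or_pos N
  · simp
  have hN' : 0 ≤ Real.log N := Real.log_natCast_nonneg N
  -- Clamping the index to `[1, N]` makes the weight nonnegative and antitone on all of `ℕ` without
  -- changing it on the range of summation.
  have hanti : Antitone fun n : ℕ => Real.log N - Real.log (min (max n 1) N : ℕ) := by
    intro a b hab
    refine sub_le_sub_left (Real.log_le_log ?_ ?_) _
    · exact_mod_cast lt_min (lt_max_of_lt_right one_pos) hN
    · exact_mod_cast min_le_min (max_le_max hab le_rfl) le_rfl
  have h0 : ∀ n : ℕ, 0 ≤ Real.log N - Real.log (min (max n 1) N : ℕ) := by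
    intro n
    refine sub_nonneg.2 (Real.log_le_log ?_ ?_)
    · exact_mod_cast lt_min (lt_max_of_lt_right one_pos) hN
    · exact_mod_cast min_le_right _ _
  have h1 := norm_sum_antitone_mul_le hanti h0 hB
  have hw1 : (min (max 1 1) N : ℕ) = 1 := by simp; lia
  simp only [hw1, Nat.cast_one, Real.log_one, sub_zero] at h1
  have h2 : ∑ i ∈ Ioc 0 N, (Real.log i : ℂ) * f i = (Real.log N : ℂ) * ∑ i ∈ Ioc 0 N, f i
      - ∑ i ∈ Ioc 0 N, ((Real.log N - Real.log (min (max i 1) N : ℕ) : ℝ) : ℂ) * f i := by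
    rw [mul_sum, ← sum_sub_distrib]
    refine sum_congr rfl fun i hi => ?_
    have : (min (max i 1) N : ℕ) = i := by have := mem_Ioc.1 hi; lia
    rw [this]; push_cast; ring
  rw [h2]
  refine (norm_sub_le _ _).trans ?_
  have h3 : ‖(Real.log N : ℂ) * ∑ i ∈ Ioc 0 N, f i‖ ≤ Real.log N * B := by
    rw [norm_mul, Complex.norm_real, Real.norm_of_nonneg hN']
    exact mul_le_mul_of_nonneg_left (hB N le_rfl) hN'
  linarith

/-- The truncation of an arithmetic function to arguments at most `U`. -/
noncomputable def truncate (f : ArithmeticFunction ℝ) (U : ℕ) : ArithmeticFunction ℝ :=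
  ⟨fun n => if n ≤ U then f n else 0, by simp⟩

lemma truncate_apply (f : ArithmeticFunction ℝ) (U n : ℕ) :
    truncate f U n = if n ≤ U then f n else 0 := rfl

open ArithmeticFunction in
/-- **Vaughan's identity.** -/
lemma vaughan_identity (U : ℕ) :
    (Λ : ArithmeticFunction ℝ) = truncate Λ U + truncate (moebius : ArithmeticFunction ℝ) U * log
      - truncate (moebius : ArithmeticFunction ℝ) U * truncate Λ U * (zeta : ArithmeticFunction ℝ)
      + (Λ - truncate Λ U) * (zeta : ArithmeticFunction ℝ)
        * ((moebius : ArithmeticFunction ℝ) - truncate (moebius : ArithmeticFunction ℝ) U) := by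
  have h1 : (Λ : ArithmeticFunction ℝ) * (zeta : ArithmeticFunction ℝ) = log :=
    vonMangoldt_mul_zeta
  have h2 : (moebius : ArithmeticFunction ℝ) * (zeta : ArithmeticFunction ℝ) = 1 :=
    coe_moebius_mul_coe_zeta
  rw [← h1]
  -- The identity reduces to `(Λ - Λ_U) * (ζ * μ - 1) = 0`.
  linear_combination (truncate Λ U - Λ) * h2

lemma sum_convolution_mul (f g : ArithmeticFunction ℝ) (κ : ℕ → ℂ) (N : ℕ) :
    ∑ n ∈ Ioc 0 N, (((f * g) n : ℝ) : ℂ) * κ n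
      = ∑ m ∈ Ioc 0 N, (f m : ℂ) * ∑ n ∈ Ioc 0 (N / m), (g n : ℂ) * κ (m * n) := by
  have h1 : ∑ n ∈ Ioc 0 N, (((f * g) n : ℝ) : ℂ) * κ n
      = ∑ x ∈ Ioc 0 N ×ˢ Ioc 0 N with x.1 * x.2 ≤ N, (f x.1 : ℂ) * (g x.2 * κ (x.1 * x.2)) := by
    simp only [ArithmeticFunction.mul_apply]
    trans ∑ n ∈ Ioc 0 N, ∑ x ∈ Ioc 0 N ×ˢ Ioc 0 N with x.1 * x.2 = n,
      (f x.1 : ℂ) * (g x.2 * κ (x.1 * x.2))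
    · refine sum_congr rfl fun n hn ↦ ?_
      simp only [mem_Ioc] at hn
      rw [Nat.divisorsAntidiagonal_eq_prod_filter_of_le hn.1.ne' hn.2, Complex.ofReal_sum, sum_mul]
      refine sum_congr rfl fun x hx => ?_
      rw [(mem_filter.1 hx).2]; push_cast; ring
    · simp_rw [sum_filter]
      rw [sum_comm]
      exact sum_congr rfl fun _ _ ↦ (by simp_all)
  rw [h1, sum_filter, sum_product]
  refine sum_congr rfl fun m hm => ?_
  have hm' := mem_Ioc.1 hm
  rw [mul_sum, ← sum_filter]
  refine sum_congr ?_ fun _ _ => rfl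
  ext n
  simp only [mem_filter, mem_Ioc, Nat.le_div_iff_mul_le hm'.1]
  constructor
  · rintro ⟨h, h'⟩; exact ⟨h.1, by rwa [mul_comm]⟩
  · rintro ⟨h, h'⟩
    have : n ≤ n * m := Nat.le_mul_of_pos_right n hm'.1
    exact ⟨⟨h, by lia⟩, by rwa [mul_comm]⟩

/-- `κ` is bounded and has linear and bilinear sums over intervals with a saving `η` (up to an
additive error `R`), the bilinear ones for pairs of dilations that are distinct modulo `P`. -/
structure HasIntervalBounds (κ : ℕ → ℂ) (P : ℕ) (D η R : ℝ) : Prop where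
  pos : 0 < P
  one_le_D : 1 ≤ D
  inv_le : 1 / (P : ℝ) ≤ η
  eta_le : η ≤ 1
  one_le_R : 1 ≤ R
  norm_sq_le : ∀ n, ‖κ n‖ ^ 2 ≤ D
  linear : ∀ t A B : ℕ, A ≤ B → ‖∑ m ∈ Ico A B, κ (m * t)‖ ≤ D * (η * (B - A) + R)
  bilinear : ∀ t₁ t₂ A B : ℕ, A ≤ B → ¬ t₁ ≡ t₂ [MOD P] →
    ‖∑ m ∈ Ico A B, κ (m * t₁) * starRingEnd ℂ (κ (m * t₂))‖ ≤ D * (η * (B - A) + R)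

lemma HasIntervalBounds.eta_pos {κ : ℕ → ℂ} {P : ℕ} {D η R : ℝ}
    (h : HasIntervalBounds κ P D η R) : 0 < η :=
  lt_of_lt_of_le (by have := h.pos; positivity) h.inv_le

lemma HasIntervalBounds.norm_le {κ : ℕ → ℂ} {P : ℕ} {D η R : ℝ}
    (h : HasIntervalBounds κ P D η R) (n : ℕ) : ‖κ n‖ ≤ D := by
  have := h.one_le_D
  refine le_of_sq_le_sq ?_ (by linarith)
  nlinarith [h.norm_sq_le n]

lemma HasIntervalBounds.linear_Ioc {κ : ℕ → ℂ} {P : ℕ} {D η R : ℝ}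
    (h : HasIntervalBounds κ P D η R) (t N : ℕ) :
    ‖∑ m ∈ Ioc 0 N, κ (t * m)‖ ≤ D * (η * N + R) := by
  have h1 := h.linear t 1 (N + 1) (by lia)
  have : Ico 1 (N + 1) = Ioc 0 N := by ext; simp; lia
  rw [this] at h1
  simpa [mul_comm] using h1

/-! ### Type I and Type II sums. -/

lemma card_filter_modEq_le {P : ℕ} (hP : 0 < P) (v N : ℕ) :
    (#{x ∈ Ioc 0 N | x ≡ v [MOD P]} : ℝ) ≤ N / P + 1 := by
  have h1 := Nat.Ioc_filter_modEq_card 0 N hP v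
  have h2 : ((#{x ∈ Ioc 0 N | x ≡ v [MOD P]} : ℤ) : ℚ) ≤ (N : ℚ) / P + 1 := by
    rw [h1, Int.cast_max]
    refine max_le ?_ (by positivity)
    have h3 := Int.floor_le (((N : ℕ) - v : ℚ) / P)
    have h4 := Int.lt_floor_add_one (((0 : ℕ) - v : ℚ) / P)
    rw [sub_div] at h3 h4
    push_cast at h3 h4 ⊢
    rw [sub_div, sub_div]
    rw [zero_div] at h4 ⊢
    linarith
  rw [Int.cast_natCast] at h2
  have h5 : (((#{x ∈ Ioc 0 N | x ≡ v [MOD P]} : ℕ) : ℚ) : ℝ) ≤ ((N : ℚ) / P + 1 : ℚ) :=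
    Rat.cast_le.2 h2
  push_cast at h5
  exact h5

lemma sum_norm_sq_eq_sum_sum {ι τ : Type*} (S : Finset ι) (T : Finset τ) (F : ι → τ → ℂ) :
    ((∑ m ∈ S, ‖∑ n ∈ T, F m n‖ ^ 2 : ℝ) : ℂ)
      = ∑ n₁ ∈ T, ∑ n₂ ∈ T, ∑ m ∈ S, F m n₁ * starRingEnd ℂ (F m n₂) := by
  have h1 : ∀ m ∈ S, ((‖∑ n ∈ T, F m n‖ ^ 2 : ℝ) : ℂ)
      = ∑ n₁ ∈ T, ∑ n₂ ∈ T, F m n₁ * starRingEnd ℂ (F m n₂) := by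
    intro m _
    rw [Complex.ofReal_pow, ← Complex.mul_conj', map_sum, sum_mul_sum]
  rw [Complex.ofReal_sum, sum_congr rfl h1, sum_comm]
  refine sum_congr rfl fun n _ => sum_comm

/-- The mean square over a dyadic block of sums over `n ≤ x / m`. -/
lemma HasIntervalBounds.mean_square_le {κ : ℕ → ℂ} {P : ℕ} {D η R : ℝ}
    (h : HasIntervalBounds κ P D η R) {x M : ℕ} (hM : 0 < M) {g : ℕ → ℝ}
    (hg : ∀ n, |g n| ≤ 1) :
    ∑ m ∈ Ico M (2 * M), ‖∑ n ∈ Ioc 0 (x / m), (g n : ℂ) * κ (m * n)‖ ^ 2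
      ≤ D * (((x / M : ℕ) : ℝ) ^ 2 * (η * M + R)
          + ((x / M : ℕ) : ℝ) * (((x / M : ℕ) : ℝ) / P + 1) * M) := by
  obtain ⟨N, hN⟩ : ∃ N, N = x / M := ⟨_, rfl⟩
  rw [← hN]
  have hD : 0 ≤ D := zero_le_one.trans h.one_le_D
  have hη := h.eta_pos
  have hR := h.one_le_R
  obtain ⟨F, hF⟩ : ∃ F : ℕ → ℕ → ℂ, F = fun m n =>
    if n ≤ x / m then (g n : ℂ) * κ (m * n) else 0 := ⟨_, rfl⟩
  have h1 : ∀ m ∈ Ico M (2 * M), ∑ n ∈ Ioc 0 (x / m), (g n : ℂ) * κ (m * n)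
      = ∑ n ∈ Ioc 0 N, F m n := by
    intro m hm
    have : x / m ≤ N := hN ▸ Nat.div_le_div_left (mem_Ico.1 hm).1 hM
    rw [hF, ← sum_filter]
    refine sum_congr ?_ fun _ _ => rfl
    ext n; simp only [mem_filter, mem_Ioc]; lia
  have h2 : ∀ n₁ ∈ Ioc 0 N, ∀ n₂ ∈ Ioc 0 N,
      ‖∑ m ∈ Ico M (2 * M), F m n₁ * starRingEnd ℂ (F m n₂)‖
        ≤ D * (η * M + R) + if n₂ ≡ n₁ [MOD P] then D * M else 0 := by
    intro n₁ hn₁ n₂ hn₂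
    have hn₁' := (mem_Ioc.1 hn₁).1
    have hn₂' := (mem_Ioc.1 hn₂).1
    -- The conditions `m n₁ ≤ x` and `m n₂ ≤ x` cut the block down to an interval `[M, E)`; the
    -- outer maximum allows it to be empty.
    obtain ⟨E, hE⟩ : ∃ E, E = max M (min (2 * M) (min (x / n₁) (x / n₂) + 1)) := ⟨_, rfl⟩
    have hset : ∀ m ∈ Ico M (2 * M), F m n₁ * starRingEnd ℂ (F m n₂)
        = if m ∈ Ico M E then
          (g n₁ * g n₂ : ℂ) * (κ (m * n₁) * starRingEnd ℂ (κ (m * n₂))) else 0 := by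
      intro m hm
      have hm' := mem_Ico.1 hm
      have hm0 : 0 < m := by lia
      have e1 : n₁ ≤ x / m ↔ m ≤ x / n₁ := by
        rw [Nat.le_div_iff_mul_le hm0, Nat.le_div_iff_mul_le hn₁', mul_comm]
      have e2 : n₂ ≤ x / m ↔ m ≤ x / n₂ := by
        rw [Nat.le_div_iff_mul_le hm0, Nat.le_div_iff_mul_le hn₂', mul_comm]
      have e3 : m ∈ Ico M E ↔ m ≤ x / n₁ ∧ m ≤ x / n₂ := by
        rw [mem_Ico]; lia
      simp only [hF, e1, e2, e3]
      by_cases c1 : m ≤ x / n₁ <;> by_cases c2 : m ≤ x / n₂ <;> simp [c1, c2]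
      ring
    have hEM : M ≤ E := by lia
    have hE2 : E ≤ 2 * M := by lia
    have hsub : {m ∈ Ico M (2 * M) | m ∈ Ico M E} = Ico M E := by
      ext m; simp only [mem_filter, mem_Ico]; lia
    rw [sum_congr rfl hset, ← sum_filter, hsub, ← mul_sum, norm_mul]
    have hgg : ‖(g n₁ * g n₂ : ℂ)‖ ≤ 1 := by
      rw [norm_mul, Complex.norm_real, Complex.norm_real]
      exact mul_le_one₀ (hg _) (norm_nonneg _) (hg _)
    have hEM' : (E : ℝ) - M ≤ M := by
      have : (E : ℝ) ≤ 2 * M := by exact_mod_cast hE2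
      linarith
    refine (mul_le_of_le_one_left (norm_nonneg _) hgg).trans ?_
    split_ifs with hc
    · have : ‖∑ m ∈ Ico M E, κ (m * n₁) * starRingEnd ℂ (κ (m * n₂))‖ ≤ ∑ m ∈ Ico M E, D := by
        refine norm_sum_le_of_le _ fun m _ => ?_
        rw [norm_mul, RCLike.norm_conj]
        nlinarith [h.norm_sq_le (m * n₁), h.norm_sq_le (m * n₂),
          sq_nonneg (‖κ (m * n₁)‖ - ‖κ (m * n₂)‖)]
      rw [sum_const, Nat.card_Ico, nsmul_eq_mul, Nat.cast_sub hEM] at this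
      have h3 : ((E : ℝ) - M) * D ≤ M * D := mul_le_mul_of_nonneg_right hEM' hD
      have : 0 ≤ D * (η * M + R) := by positivity
      linarith
    · rw [add_zero]
      refine (h.bilinear n₁ n₂ M E hEM fun h' => hc h'.symm).trans ?_
      gcongr
  have h3 := sum_norm_sq_eq_sum_sum (Ico M (2 * M)) (Ioc 0 N) F
  have h4 : ∑ m ∈ Ico M (2 * M), ‖∑ n ∈ Ioc 0 N, F m n‖ ^ 2
      ≤ ∑ n₁ ∈ Ioc 0 N, ∑ n₂ ∈ Ioc 0 N,
        (D * (η * M + R) + if n₂ ≡ n₁ [MOD P] then D * M else 0) := by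
    have h5 : ∑ m ∈ Ico M (2 * M), ‖∑ n ∈ Ioc 0 N, F m n‖ ^ 2
        = ‖((∑ m ∈ Ico M (2 * M), ‖∑ n ∈ Ioc 0 N, F m n‖ ^ 2 : ℝ) : ℂ)‖ := by
      rw [Complex.norm_real, Real.norm_of_nonneg (sum_nonneg fun _ _ => sq_nonneg _)]
    rw [h5, h3]
    exact norm_sum_le_of_le _ fun n₁ hn₁ => norm_sum_le_of_le _ fun n₂ hn₂ => h2 n₁ hn₁ n₂ hn₂
  have h6 : ∀ n₁ ∈ Ioc 0 N, ∑ n₂ ∈ Ioc 0 N,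
        (D * (η * M + R) + if n₂ ≡ n₁ [MOD P] then D * M else 0)
      ≤ N * (D * (η * M + R)) + (N / P + 1) * (D * M) := by
    intro n₁ _
    rw [sum_add_distrib, sum_const, Nat.card_Ioc, ← sum_filter, sum_const, nsmul_eq_mul,
      nsmul_eq_mul, Nat.sub_zero]
    gcongr
    exact card_filter_modEq_le h.pos n₁ N
  rw [sum_congr rfl fun m hm => by rw [h1 m hm]]
  refine (h4.trans (sum_le_sum h6)).trans (le_of_eq ?_)
  rw [sum_const, Nat.card_Ioc, nsmul_eq_mul, Nat.sub_zero]
  ring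

/-- Cauchy–Schwarz reduces to the mean square. Either `x/M ≤ U` and the block vanishes with `g`, or
both `2M` and `x/M` are at least `U`, which turns the error `R` and the diagonal pairs into `R/U`.
-/
lemma HasIntervalBounds.dyadic_block_le {κ : ℕ → ℂ} {P : ℕ} {D η R : ℝ}
    (h : HasIntervalBounds κ P D η R) {x X M U : ℕ} (hM : 0 < M) (hU : 0 < U) (hxX : x ≤ X)
    (hUM : U ≤ 2 * M) {f g : ℕ → ℝ} {F : ℝ} (hf : ∀ m ∈ Ico M (2 * M), |f m| ≤ F)
    (hg : ∀ n, |g n| ≤ 1) (hg0 : ∀ n ≤ U, g n = 0) :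
    ‖∑ m ∈ Ico M (2 * M), (f m : ℂ) * ∑ n ∈ Ioc 0 (x / m), (g n : ℂ) * κ (m * n)‖ ^ 2
      ≤ F ^ 2 * (D * X ^ 2 * (2 * η + 3 * R / U)) := by
  have hD : 0 ≤ D := zero_le_one.trans h.one_le_D
  have hη := h.eta_pos
  have hR := h.one_le_R
  have hU' : (0 : ℝ) < U := by exact_mod_cast hU
  by_cases hN : x / M ≤ U
  · have : ∑ m ∈ Ico M (2 * M), (f m : ℂ) * ∑ n ∈ Ioc 0 (x / m), (g n : ℂ) * κ (m * n) = 0 := by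
      refine sum_eq_zero fun m hm => ?_
      rw [sum_eq_zero, mul_zero]
      intro n hn
      have h1 : x / m ≤ x / M := Nat.div_le_div_left (mem_Ico.1 hm).1 hM
      rw [hg0 n (by have := mem_Ioc.1 hn; lia)]
      simp
    rw [this, norm_zero, zero_pow two_ne_zero]
    positivity
  push Not at hN
  have h1 := h.mean_square_le (x := x) hM hg
  have h2 : ‖∑ m ∈ Ico M (2 * M), (f m : ℂ) * ∑ n ∈ Ioc 0 (x / m), (g n : ℂ) * κ (m * n)‖
      ≤ F * ∑ m ∈ Ico M (2 * M), ‖∑ n ∈ Ioc 0 (x / m), (g n : ℂ) * κ (m * n)‖ := by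
    rw [mul_sum]
    refine norm_sum_le_of_le _ fun m hm => ?_
    rw [norm_mul, Complex.norm_real]
    exact mul_le_mul_of_nonneg_right (hf m hm) (norm_nonneg _)
  have h3 := sq_sum_le_card_mul_sum_sq (s := Ico M (2 * M))
    (f := fun m => ‖∑ n ∈ Ioc 0 (x / m), (g n : ℂ) * κ (m * n)‖)
  rw [Nat.card_Ico, show 2 * M - M = M by lia] at h3
  obtain ⟨N, hNdef⟩ : ∃ N : ℝ, N = ((x / M : ℕ) : ℝ) := ⟨_, rfl⟩
  have hMN : (M : ℝ) * N ≤ X := by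
    rw [hNdef]
    exact_mod_cast (Nat.mul_div_le x M).trans hxX
  have hNU : (U : ℝ) ≤ N := by rw [hNdef]; exact_mod_cast hN.le
  have hUM' : (U : ℝ) ≤ 2 * M := by exact_mod_cast hUM
  have hM' : (0 : ℝ) < M := by exact_mod_cast hM
  have hN0 : 0 < N := hU'.trans_le hNU
  have hMN2 : ((M : ℝ) * N) ^ 2 ≤ X ^ 2 := pow_le_pow_left₀ (by positivity) hMN 2
  rw [← hNdef] at h1
  have e1 : (M : ℝ) * N ^ 2 * R ≤ 2 * X ^ 2 * R / U := by
    rw [le_div_iff₀ hU']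
    have : (M : ℝ) * N ^ 2 * U ≤ 2 * X ^ 2 := by
      calc (M : ℝ) * N ^ 2 * U ≤ M * N ^ 2 * (2 * M) := by gcongr
        _ = 2 * (M * N) ^ 2 := by ring
        _ ≤ _ := by gcongr
    nlinarith
  have e2 : (M : ℝ) ^ 2 * N ≤ X ^ 2 * R / U := by
    rw [le_div_iff₀ hU']
    calc (M : ℝ) ^ 2 * N * U ≤ M ^ 2 * N * N := by gcongr
      _ = (M * N) ^ 2 := by ring
      _ ≤ X ^ 2 := hMN2
      _ ≤ X ^ 2 * R := le_mul_of_one_le_right (by positivity) hR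
  have e3 : (M : ℝ) * N ^ 2 * M / P ≤ X ^ 2 * η := by
    calc (M : ℝ) * N ^ 2 * M / P = (M * N) ^ 2 * (1 / P) := by ring
      _ ≤ X ^ 2 * η := by gcongr; exact h.inv_le
  have e4 : (M : ℝ) * N ^ 2 * (η * M) ≤ X ^ 2 * η := by
    calc (M : ℝ) * N ^ 2 * (η * M) = (M * N) ^ 2 * η := by ring
      _ ≤ X ^ 2 * η := by gcongr
  calc _ ≤ (F * ∑ m ∈ Ico M (2 * M), ‖∑ n ∈ Ioc 0 (x / m), (g n : ℂ) * κ (m * n)‖) ^ 2 :=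
        pow_le_pow_left₀ (norm_nonneg _) h2 2
    _ = F ^ 2 * (∑ m ∈ Ico M (2 * M), ‖∑ n ∈ Ioc 0 (x / m), (g n : ℂ) * κ (m * n)‖) ^ 2 :=
        mul_pow _ _ _
    _ ≤ F ^ 2 * (M * (D * (N ^ 2 * (η * M + R) + N * (N / P + 1) * M))) := by
        gcongr
        exact h3.trans (mul_le_mul_of_nonneg_left h1 hM'.le)
    _ = F ^ 2 * (D * (M * N ^ 2 * (η * M) + M * N ^ 2 * R + M * N ^ 2 * M / P
          + M ^ 2 * N)) := by ring
    _ ≤ F ^ 2 * (D * (X ^ 2 * η + 2 * X ^ 2 * R / U + X ^ 2 * η + X ^ 2 * R / U)) := by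
        gcongr
    _ = _ := by ring

lemma natLog_two_add_one_le {x X : ℕ} (hX : 1 ≤ X) (hx : x ≤ X) :
    ((Nat.log 2 x + 1 : ℕ) : ℝ) ≤ 2 * (1 + Real.log X) := by
  have hX' : (1 : ℝ) ≤ X := by exact_mod_cast hX
  have h0 : 0 ≤ Real.log X := Real.log_natCast_nonneg X
  have h1 : ((Nat.log 2 X : ℕ) : ℝ) * Real.log 2 ≤ Real.log X := by
    rw [← Real.log_pow]
    refine Real.log_le_log (by positivity) ?_
    exact_mod_cast Nat.pow_log_le_self 2 (by lia)
  have h2 := Real.log_two_gt_d9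
  have h3 : ((Nat.log 2 X : ℕ) : ℝ) ≤ 2 * Real.log X := by
    have : (0 : ℝ) ≤ (Nat.log 2 X : ℕ) := Nat.cast_nonneg _
    nlinarith
  have h4 : ((Nat.log 2 x : ℕ) : ℝ) ≤ (Nat.log 2 X : ℕ) := by
    exact_mod_cast Nat.log_mono_right hx
  push_cast
  linarith

lemma sum_Ico_one_two_pow (a : ℕ → ℂ) (J : ℕ) :
    ∑ m ∈ Ico 1 (2 ^ J), a m = ∑ i ∈ range J, ∑ m ∈ Ico (2 ^ i) (2 * 2 ^ i), a m := by
  induction J with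
  | zero => simp
  | succ J ih =>
    rw [sum_range_succ, ← ih, pow_succ', sum_Ico_consecutive _ Nat.one_le_two_pow (by lia)]

/-- Dyadic decomposition in `m`. The last block may overshoot `x`, where the inner sum is empty;
this is why `f` is bounded up to `2X`. Blocks below `U/2` vanish with `f`. -/
lemma HasIntervalBounds.type_two_le {κ : ℕ → ℂ} {P : ℕ} {D η R : ℝ}
    (h : HasIntervalBounds κ P D η R) {x X U : ℕ} (hx : 1 ≤ x) (hU : 0 < U) (hxX : x ≤ X)
    {f g : ℕ → ℝ} {F : ℝ} (hF : 0 ≤ F) (hf : ∀ m, 1 ≤ m → m ≤ 2 * X → |f m| ≤ F)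
    (hf0 : ∀ m ≤ U, f m = 0)
    (hg : ∀ n, |g n| ≤ 1) (hg0 : ∀ n ≤ U, g n = 0) :
    ‖∑ m ∈ Ioc 0 x, (f m : ℂ) * ∑ n ∈ Ioc 0 (x / m), (g n : ℂ) * κ (m * n)‖
      ≤ 2 * (1 + Real.log X) * (F * (X * √(D * (2 * η + 3 * R / U)))) := by
  have hD : 0 ≤ D := zero_le_one.trans h.one_le_D
  have hη := h.eta_pos
  have hR := h.one_le_R
  have h1 : ∑ m ∈ Ioc 0 x, (f m : ℂ) * ∑ n ∈ Ioc 0 (x / m), (g n : ℂ) * κ (m * n)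
      = ∑ m ∈ Ico 1 (2 ^ (Nat.log 2 x + 1)),
        (f m : ℂ) * ∑ n ∈ Ioc 0 (x / m), (g n : ℂ) * κ (m * n) := by
    have hlt : x < 2 ^ (Nat.log 2 x + 1) := Nat.lt_pow_succ_log_self (by norm_num) x
    refine sum_subset (fun m hm => ?_) fun m _ hm' => ?_
    · have := mem_Ioc.1 hm
      exact mem_Ico.2 ⟨this.1, by lia⟩
    · rw [mem_Ioc] at hm'
      have : x / m = 0 := by
        rcases Nat.eq_zero_or_pos m with rfl | hm0
        · simp
        · exact Nat.div_eq_of_lt (by lia)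
      simp [this]
  rw [h1, sum_Ico_one_two_pow]
  have h2 : ∀ i ∈ range (Nat.log 2 x + 1),
      ‖∑ m ∈ Ico (2 ^ i) (2 * 2 ^ i), (f m : ℂ) * ∑ n ∈ Ioc 0 (x / m), (g n : ℂ) * κ (m * n)‖
        ≤ F * (X * √(D * (2 * η + 3 * R / U))) := by
    intro i hi
    by_cases hiU : U ≤ 2 * 2 ^ i
    · have hix : 2 ^ i ≤ x := (Nat.pow_le_pow_right (by norm_num)
        (Nat.lt_succ_iff.1 (mem_range.1 hi))).trans (Nat.pow_log_le_self 2 (by lia))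
      have hpos : 0 < 2 ^ i := by positivity
      have h3 := h.dyadic_block_le (x := x) (f := f) (F := F) hpos hU hxX hiU
        (fun m hm => hf m (by have := mem_Ico.1 hm; lia) (by have := mem_Ico.1 hm; lia)) hg hg0
      refine le_of_sq_le_sq (h3.trans (le_of_eq ?_)) (by positivity)
      rw [mul_pow, mul_pow, Real.sq_sqrt (by positivity)]
      ring
    · rw [sum_eq_zero, norm_zero]
      · positivity
      · intro m hm
        rw [hf0 m (by have := mem_Ico.1 hm; lia)]
        simp
  refine (norm_sum_le_of_le _ h2).trans ?_
  rw [sum_const, card_range, nsmul_eq_mul]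
  exact mul_le_mul_of_nonneg_right (natLog_two_add_one_le (hx.trans hxX) hxX) (by positivity)

lemma sum_inv_le_one_add_log {x X : ℕ} (hx : 1 ≤ x) (hxX : x ≤ X) :
    ∑ m ∈ Ioc 0 x, (1 / (m : ℝ)) ≤ 1 + Real.log X := by
  have h1 := harmonic_le_one_add_log x
  have h2 : ((harmonic x : ℚ) : ℝ) = ∑ m ∈ Ioc 0 x, (1 / (m : ℝ)) := by
    rw [harmonic_eq_sum_Icc]
    push_cast
    refine sum_congr ?_ fun _ _ => by rw [one_div]
    ext; simp; lia
  rw [← h2]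
  refine h1.trans (add_le_add_right (Real.log_le_log ?_ ?_) _)
  · exact_mod_cast hx
  · exact_mod_cast hxX

/-- Sums of type I with smooth inner sums. -/
lemma type_one_le {x X V : ℕ} (hx : 1 ≤ x) (hxX : x ≤ X) {f : ℕ → ℝ} {G : ℕ → ℂ} {F E η R : ℝ}
    (hF : 0 ≤ F) (hE : 0 ≤ E) (hη : 0 ≤ η) (hR : 0 ≤ R)
    (hf : ∀ m, 1 ≤ m → m ≤ X → |f m| ≤ F) (hf0 : ∀ m, V < m → f m = 0)
    (hG : ∀ m, 1 ≤ m → m ≤ x → ‖G m‖ ≤ E * (η * (x / m : ℕ) + R)) :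
    ‖∑ m ∈ Ioc 0 x, (f m : ℂ) * G m‖ ≤ F * E * (η * X * (1 + Real.log X) + R * V) := by
  have h1 : ∀ m ∈ Ioc 0 x, ‖(f m : ℂ) * G m‖
      ≤ F * E * (η * X * (1 / (m : ℝ))) + if m ∈ Ioc 0 V then F * E * R else 0 := by
    intro m hm
    have hm' := mem_Ioc.1 hm
    by_cases hmV : m ∈ Ioc 0 V
    · rw [if_pos hmV, norm_mul, Complex.norm_real, Real.norm_eq_abs]
      have h2 : ((x / m : ℕ) : ℝ) ≤ X * (1 / (m : ℝ)) := by
        refine Nat.cast_div_le.trans ?_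
        rw [mul_one_div]
        gcongr
      calc |f m| * ‖G m‖ ≤ F * (E * (η * (x / m : ℕ) + R)) :=
            mul_le_mul (hf m hm'.1 (hm'.2.trans hxX)) (hG m hm'.1 hm'.2) (norm_nonneg _) hF
        _ ≤ F * (E * (η * (X * (1 / (m : ℝ))) + R)) := by gcongr
        _ = _ := by ring
    · rw [if_neg hmV, hf0 m (by rw [mem_Ioc] at hmV; lia)]
      simp only [Complex.ofReal_zero, zero_mul, norm_zero, add_zero]
      positivity
  refine (norm_sum_le_of_le _ h1).trans ?_
  rw [sum_add_distrib, ← mul_sum, ← mul_sum, ← sum_filter, sum_const, nsmul_eq_mul]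
  have h3 : (#{m ∈ Ioc 0 x | m ∈ Ioc 0 V} : ℝ) ≤ V := by
    have : #{m ∈ Ioc 0 x | m ∈ Ioc 0 V} ≤ #(Ioc 0 V) :=
      card_le_card fun m hm => (mem_filter.1 hm).2
    rw [Nat.card_Ioc] at this
    exact_mod_cast this
  have h4 := sum_inv_le_one_add_log hx hxX
  calc _ ≤ F * E * (η * X * (1 + Real.log X)) + V * (F * E * R) := by gcongr
    _ = _ := by ring

/-! ### The sum over the von Mangoldt function and the sum over primes. -/

lemma arithmeticFunction_sub_apply (f g : ArithmeticFunction ℝ) (n : ℕ) :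
    (f - g) n = f n - g n := rfl

lemma abs_truncate_le {f : ArithmeticFunction ℝ} {U n : ℕ} {B : ℝ} (h : |f n| ≤ B) :
    |truncate f U n| ≤ B := by
  rw [truncate_apply]
  split_ifs
  · exact h
  · rw [abs_zero]; exact (abs_nonneg _).trans h

lemma abs_sub_truncate_le {f : ArithmeticFunction ℝ} {U n : ℕ} {B : ℝ} (h : |f n| ≤ B) :
    |(f - truncate f U) n| ≤ B := by
  rw [arithmeticFunction_sub_apply, truncate_apply]
  split_ifs
  · rw [sub_self, abs_zero]; exact (abs_nonneg _).trans h
  · rwa [sub_zero]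

lemma sub_truncate_eq_zero {f : ArithmeticFunction ℝ} {U n : ℕ} (h : n ≤ U) :
    (f - truncate f U) n = 0 := by
  rw [arithmeticFunction_sub_apply, truncate_apply, if_pos h, sub_self]

lemma abs_moebius_real_le_one (n : ℕ) :
    |(ArithmeticFunction.moebius : ArithmeticFunction ℝ) n| ≤ 1 := by
  rw [ArithmeticFunction.intCoe_apply]
  exact_mod_cast ArithmeticFunction.abs_moebius_le_one

open ArithmeticFunction in
-- The convolution is dominated by `ζ * Λ = log`.
lemma abs_mul_le_log {f g : ArithmeticFunction ℝ} (hf : ∀ n, |f n| ≤ 1) (hg : ∀ n, |g n| ≤ Λ n)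
    (n : ℕ) : |(f * g) n| ≤ Real.log n := by
  rw [← log_apply, ← zeta_mul_vonMangoldt, mul_apply, mul_apply]
  refine (abs_sum_le_sum_abs _ _).trans (sum_le_sum fun x hx => ?_)
  have : x.1 ≠ 0 := by
    rintro h0
    have := Nat.mem_divisorsAntidiagonal.1 hx
    simp [h0] at this
    lia
  rw [natCoe_apply, zeta_apply_ne this, abs_mul, Nat.cast_one]
  exact mul_le_mul (hf _) (hg _) (abs_nonneg _) zero_le_one

open ArithmeticFunction in
/-- Sums over the von Mangoldt function, by Vaughan's identity. -/
lemma HasIntervalBounds.vonMangoldt_le {κ : ℕ → ℂ} {P : ℕ} {D η R : ℝ}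
    (h : HasIntervalBounds κ P D η R) {x X U : ℕ} (hx : 1 ≤ x) (hxX : x ≤ X) (hU : 0 < U)
    (hRU : R ≤ η * U) (hRX : R * U ^ 2 ≤ η * X) :
    ‖∑ n ∈ Ioc 0 x, (Λ n : ℂ) * κ n‖ ≤ 13 * ((1 + Real.log X) ^ 2 * D * X * √η) := by
  have hD := h.one_le_D
  have hD0 : 0 ≤ D := zero_le_one.trans hD
  have hη := h.eta_pos
  have hη1 := h.eta_le
  have hR := h.one_le_R
  have hX : (1 : ℝ) ≤ X := by exact_mod_cast hx.trans hxX
  have hlog : 0 ≤ Real.log X := Real.log_natCast_nonneg X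
  have hlogle : ∀ m : ℕ, m ≤ X → Real.log m ≤ 1 + Real.log X := by
    intro m hm
    rcases Nat.eq_zero_or_pos m with rfl | hm0
    · simp; linarith
    · have : Real.log m ≤ Real.log X :=
        Real.log_le_log (by exact_mod_cast hm0) (by exact_mod_cast hm)
      linarith
  have hlogle' : ∀ m : ℕ, 1 ≤ m → m ≤ 2 * X → Real.log m ≤ 1 + Real.log X := by
    intro m hm0 hm
    have : Real.log m ≤ Real.log (2 * X) :=
      Real.log_le_log (by exact_mod_cast hm0) (by exact_mod_cast hm)
    rw [Real.log_mul two_ne_zero (by linarith)] at this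
    have := Real.log_two_lt_d9
    linarith
  obtain ⟨L, hL⟩ : ∃ L, L = 1 + Real.log X := ⟨_, rfl⟩
  rw [← hL] at hlogle hlogle' ⊢
  have hL1 : 1 ≤ L := by linarith
  have hUR : (1 : ℝ) ≤ U := by exact_mod_cast hU
  have hΛ : ∀ n : ℕ, |(Λ n : ℝ)| ≤ Λ n := fun n => (abs_of_nonneg vonMangoldt_nonneg).le
  obtain ⟨μ', hμ'⟩ : ∃ μ' : ArithmeticFunction ℝ, μ' = (moebius : ArithmeticFunction ℝ) := ⟨_, rfl⟩
  have hμ1 : ∀ n, |μ' n| ≤ 1 := hμ' ▸ abs_moebius_real_le_one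
  have hUX : (U : ℝ) ≤ η * X := by
    refine le_trans ?_ hRX
    nlinarith [sq_nonneg (U : ℝ)]
  have hRUX : R * U ≤ η * X := by
    refine le_trans ?_ hRX
    gcongr
    nlinarith
  have hsq : η ≤ √η := Real.le_sqrt_of_sq_le (by nlinarith)
  have hκ : ∀ (m N : ℕ), ‖∑ n ∈ Ioc 0 N, κ (m * n)‖ ≤ D * (η * N + R) := fun m N =>
    h.linear_Ioc m N
  have b1 : ‖∑ n ∈ Ioc 0 x, (truncate Λ U n : ℂ) * κ n‖ ≤ L ^ 2 * D * X * η := by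
    have h1 : ∀ n ∈ Ioc 0 x, ‖(truncate Λ U n : ℂ) * κ n‖
        ≤ if n ∈ Ioc 0 U then L * D else 0 := by
      intro n hn
      rw [norm_mul, Complex.norm_real, Real.norm_eq_abs]
      split_ifs with hnU
      · refine mul_le_mul ?_ (h.norm_le n) (norm_nonneg _) (by linarith)
        exact abs_truncate_le
          (((hΛ n).trans vonMangoldt_le_log).trans (hlogle n ((mem_Ioc.1 hn).2.trans hxX)))
      · rw [truncate_apply, if_neg, abs_zero, zero_mul]
        intro h'
        exact hnU (mem_Ioc.2 ⟨(mem_Ioc.1 hn).1, h'⟩)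
    refine (norm_sum_le_of_le _ h1).trans ?_
    rw [← sum_filter, sum_const, nsmul_eq_mul]
    have h3 : (#{m ∈ Ioc 0 x | m ∈ Ioc 0 U} : ℝ) ≤ U := by
      have : #{m ∈ Ioc 0 x | m ∈ Ioc 0 U} ≤ #(Ioc 0 U) :=
        card_le_card fun m hm => (mem_filter.1 hm).2
      rw [Nat.card_Ioc] at this
      exact_mod_cast this
    calc _ ≤ (η * X) * (L * D) :=
          mul_le_mul_of_nonneg_right (h3.trans hUX) (by positivity)
      _ ≤ (η * X) * (L ^ 2 * D) := by gcongr; nlinarith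
      _ = _ := by ring
  have b2 : ‖∑ m ∈ Ioc 0 x, (truncate μ' U m : ℂ)
      * ∑ n ∈ Ioc 0 (x / m), (Real.log n : ℂ) * κ (m * n)‖ ≤ 4 * (L ^ 2 * D * X * η) := by
    have h1 := type_one_le (f := truncate μ' U) (V := U) (F := 1) (E := 2 * L * D) (η := η) (R := R)
      (G := fun m => ∑ n ∈ Ioc 0 (x / m), (Real.log n : ℂ) * κ (m * n)) hx hxX zero_le_one
      (by positivity) hη.le (by linarith) (fun m _ _ => abs_truncate_le (hμ1 m))
      (fun m hm => by rw [truncate_apply, if_neg (by lia)])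
      (by
        intro m hm0 hm
        have h2 := norm_sum_log_mul_le (f := fun n => κ (m * n)) (N := x / m)
          (B := D * (η * (x / m : ℕ) + R)) (by
            intro n hn
            refine (hκ m n).trans ?_
            gcongr)
        refine h2.trans ?_
        have h3 := hlogle (x / m) ((Nat.div_le_self _ _).trans hxX)
        rw [mul_assoc (2 * L)]
        gcongr)
    refine h1.trans ?_
    rw [← hL]
    calc 1 * (2 * L * D) * (η * X * L + R * U) ≤ 1 * (2 * L * D) * (η * X * L + η * X * L) := by
          refine mul_le_mul_of_nonneg_left (add_le_add_right ?_ _) (by positivity)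
          exact hRUX.trans (le_mul_of_one_le_right (by positivity) hL1)
      _ = _ := by ring
  have b3 : ‖∑ m ∈ Ioc 0 x, ((truncate μ' U * truncate Λ U) m : ℂ)
      * ∑ n ∈ Ioc 0 (x / m), ((zeta : ArithmeticFunction ℝ) n : ℂ) * κ (m * n)‖
        ≤ 2 * (L ^ 2 * D * X * η) := by
    -- The convolution of two functions supported up to `U` is supported up to `U²`; this is what
    -- the hypothesis on `R * U ^ 2` pays for.
    have h1 := type_one_le (f := fun m => (truncate μ' U * truncate Λ U) m) (V := U ^ 2) (F := L)
      (E := D) (η := η) (R := R)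
      (G := fun m => ∑ n ∈ Ioc 0 (x / m), ((zeta : ArithmeticFunction ℝ) n : ℂ) * κ (m * n)) hx hxX
      (by linarith) hD0 hη.le (by linarith)
      (fun m _ hm => (abs_mul_le_log (fun n => abs_truncate_le (hμ1 n))
        (fun n => abs_truncate_le (hΛ n)) m).trans (hlogle m hm))
      (by
        intro m hm
        simp only [mul_apply]
        refine sum_eq_zero fun y hy => ?_
        rw [truncate_apply, truncate_apply]
        by_cases c1 : y.1 ≤ U
        · by_cases c2 : y.2 ≤ U
          · have := (Nat.mem_divisorsAntidiagonal.1 hy).1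
            have := Nat.mul_le_mul c1 c2
            nlinarith
          · simp [c2]
        · simp [c1])
      (by
        intro m hm0 hm
        refine le_trans (le_of_eq ?_) (hκ m (x / m))
        congr 1
        refine sum_congr rfl fun n hn => ?_
        rw [natCoe_apply, zeta_apply_ne (by have := mem_Ioc.1 hn; lia)]
        simp)
    refine h1.trans ?_
    rw [← hL]
    push_cast
    calc L * D * (η * X * L + R * U ^ 2) ≤ L * D * (η * X * L + η * X * L) := by
          refine mul_le_mul_of_nonneg_left (add_le_add_right ?_ _) (by positivity)
          exact hRX.trans (le_mul_of_one_le_right (by positivity) hL1)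
      _ = _ := by ring
  have b4 : ‖∑ m ∈ Ioc 0 x, (((Λ - truncate Λ U) * (zeta : ArithmeticFunction ℝ)) m : ℂ)
      * ∑ n ∈ Ioc 0 (x / m), ((μ' - truncate μ' U) n : ℂ) * κ (m * n)‖
        ≤ 6 * (L ^ 2 * D * X * √η) := by
    have h1 := h.type_two_le (f := fun m => ((Λ - truncate Λ U) * (zeta : ArithmeticFunction ℝ)) m)
      (g := fun n => (μ' - truncate μ' U) n) (F := L) hx hU hxX (by linarith)
      (by
        intro m hm0 hm
        rw [mul_comm (Λ - truncate Λ U)]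
        refine (abs_mul_le_log (fun n => ?_) (fun n => abs_sub_truncate_le (hΛ n)) m).trans
          (hlogle' m hm0 hm)
        rw [natCoe_apply, zeta_apply]
        split_ifs <;> simp)
      (by
        intro m hm
        simp only [mul_apply]
        refine sum_eq_zero fun y hy => ?_
        rw [sub_truncate_eq_zero, zero_mul]
        have h3 := Nat.mem_divisorsAntidiagonal.1 hy
        exact (Nat.le_of_dvd (Nat.pos_of_ne_zero h3.2) ⟨y.2, h3.1.symm⟩).trans hm)
      (fun n => abs_sub_truncate_le (hμ1 n)) (fun n hn => sub_truncate_eq_zero hn)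
    refine h1.trans ?_
    rw [← hL]
    have h4 : √(D * (2 * η + 3 * R / U)) ≤ 3 * D * √η := by
      rw [Real.sqrt_le_left (by positivity), mul_pow, mul_pow, Real.sq_sqrt hη.le]
      have h5 : 3 * R / U ≤ 3 * η := by
        rw [div_le_iff₀ (by linarith)]; linarith
      calc D * (2 * η + 3 * R / U) ≤ D * (2 * η + 3 * η) := by gcongr
        _ ≤ _ := by nlinarith [mul_pos (lt_of_lt_of_le one_pos hD) hη]
    calc 2 * L * (L * (X * √(D * (2 * η + 3 * R / U)))) ≤ 2 * L * (L * (X * (3 * D * √η))) := by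
          gcongr
      _ = _ := by ring
  have hsum : ∑ n ∈ Ioc 0 x, (Λ n : ℂ) * κ n
      = (∑ n ∈ Ioc 0 x, (truncate Λ U n : ℂ) * κ n)
        + (∑ m ∈ Ioc 0 x, (truncate μ' U m : ℂ)
            * ∑ n ∈ Ioc 0 (x / m), (Real.log n : ℂ) * κ (m * n))
        - (∑ m ∈ Ioc 0 x, ((truncate μ' U * truncate Λ U) m : ℂ)
            * ∑ n ∈ Ioc 0 (x / m), ((zeta : ArithmeticFunction ℝ) n : ℂ) * κ (m * n))
        + (∑ m ∈ Ioc 0 x, (((Λ - truncate Λ U) * (zeta : ArithmeticFunction ℝ)) m : ℂ)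
            * ∑ n ∈ Ioc 0 (x / m), ((μ' - truncate μ' U) n : ℂ) * κ (m * n)) := by
    have e2 := sum_convolution_mul (truncate μ' U) log κ x
    simp only [log_apply] at e2
    rw [← e2, ← sum_convolution_mul, ← sum_convolution_mul, ← sum_add_distrib, ← sum_sub_distrib,
      ← sum_add_distrib]
    refine sum_congr rfl fun n _ => ?_
    have := congrArg (fun f : ArithmeticFunction ℝ => f n) (vaughan_identity U)
    simp only [ArithmeticFunction.add_apply, arithmeticFunction_sub_apply, ← hμ'] at this
    rw [this]
    push_cast
    ring
  rw [hsum]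
  have t1 := norm_add_le ((∑ n ∈ Ioc 0 x, (truncate Λ U n : ℂ) * κ n)
        + (∑ m ∈ Ioc 0 x, (truncate μ' U m : ℂ)
            * ∑ n ∈ Ioc 0 (x / m), (Real.log n : ℂ) * κ (m * n))
        - (∑ m ∈ Ioc 0 x, ((truncate μ' U * truncate Λ U) m : ℂ)
            * ∑ n ∈ Ioc 0 (x / m), ((zeta : ArithmeticFunction ℝ) n : ℂ) * κ (m * n)))
        (∑ m ∈ Ioc 0 x, (((Λ - truncate Λ U) * (zeta : ArithmeticFunction ℝ)) m : ℂ)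
            * ∑ n ∈ Ioc 0 (x / m), ((μ' - truncate μ' U) n : ℂ) * κ (m * n))
  have t2 := norm_sub_le ((∑ n ∈ Ioc 0 x, (truncate Λ U n : ℂ) * κ n)
        + (∑ m ∈ Ioc 0 x, (truncate μ' U m : ℂ)
            * ∑ n ∈ Ioc 0 (x / m), (Real.log n : ℂ) * κ (m * n)))
        (∑ m ∈ Ioc 0 x, ((truncate μ' U * truncate Λ U) m : ℂ)
            * ∑ n ∈ Ioc 0 (x / m), ((zeta : ArithmeticFunction ℝ) n : ℂ) * κ (m * n))
  have t3 := norm_add_le (∑ n ∈ Ioc 0 x, (truncate Λ U n : ℂ) * κ n)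
        (∑ m ∈ Ioc 0 x, (truncate μ' U m : ℂ)
            * ∑ n ∈ Ioc 0 (x / m), (Real.log n : ℂ) * κ (m * n))
  have t4 : L ^ 2 * D * X * η ≤ L ^ 2 * D * X * √η := by gcongr
  -- The four parts contribute `1 + 4 + 2 + 6 = 13`; only the Type II part loses `√η` in place of
  -- `η`.
  linarith

open ArithmeticFunction in
lemma sum_vonMangoldt_not_prime_le {n X : ℕ} (hn : 1 ≤ n) (hnX : n ≤ X) :
    ∑ i ∈ Ioc 0 n with ¬ i.Prime, (Λ i : ℝ) ≤ 2 * √X * Real.log X := by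
  have h1 := Chebyshev.psi_sub_theta_eq_sum_not_prime (n : ℝ)
  rw [Nat.floor_natCast] at h1
  rw [← h1]
  have hn' : (1 : ℝ) ≤ n := by exact_mod_cast hn
  have hnX' : (n : ℝ) ≤ X := by exact_mod_cast hnX
  refine (Chebyshev.psi_sub_theta_le hn').trans ?_
  have := Real.log_nonneg hn'
  gcongr

/-- Abel's inequality with the weight `1 / log (max n 2)`, whose first value `1 / log 2` is below
`2`. -/
lemma norm_sum_prime_le_of_log {κ : ℕ → ℂ} {X : ℕ} {B : ℝ}
    (hB : ∀ n ≤ X, ‖∑ i ∈ Ioc 0 n, if i.Prime then (Real.log i : ℂ) * κ i else 0‖ ≤ B) :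
    ‖∑ i ∈ Icc 1 X with i.Prime, κ i‖ ≤ 2 * B := by
  have hpos : ∀ n : ℕ, 0 < Real.log (max n 2 : ℕ) := fun n =>
    Real.log_pos (by exact_mod_cast (by lia : 1 < max n 2))
  have hanti : Antitone fun n : ℕ => (Real.log (max n 2 : ℕ))⁻¹ := by
    intro a b hab
    refine inv_anti₀ (hpos a) (Real.log_le_log ?_ ?_)
    · exact_mod_cast (by lia : 0 < max a 2)
    · exact_mod_cast max_le_max hab le_rfl
  have h1 := norm_sum_antitone_mul_le hanti (fun n => (inv_pos.2 (hpos n)).le) hB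
  have hB0 : 0 ≤ B := (norm_nonneg _).trans (hB 0 (Nat.zero_le _))
  have h2 : (Real.log (max 1 2 : ℕ))⁻¹ ≤ 2 := by
    have := Real.log_two_gt_d9
    have h3 : ((max 1 2 : ℕ) : ℝ) = 2 := by norm_num
    rw [h3, inv_le_comm₀ (by linarith) (by norm_num)]
    linarith
  have h4 : ∑ i ∈ Icc 1 X with i.Prime, κ i = ∑ i ∈ Ioc 0 X, ((Real.log (max i 2 : ℕ))⁻¹ : ℝ)
      * (if i.Prime then (Real.log i : ℂ) * κ i else 0) := by
    rw [sum_filter]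
    refine sum_congr (by ext; simp; lia) fun i _ => ?_
    split_ifs with hi
    · have h5 : max i 2 = i := max_eq_left hi.two_le
      have h6 := (hpos i).ne'
      rw [h5] at h6 ⊢
      rw [← mul_assoc, ← Complex.ofReal_mul, inv_mul_cancel₀ h6, Complex.ofReal_one, one_mul]
    · rw [mul_zero]
  rw [h4]
  refine h1.trans ?_
  rw [mul_comm 2 B]
  exact mul_le_mul_of_nonneg_left h2 hB0

open ArithmeticFunction in
/-- Sums over primes, from interval bounds. -/
lemma HasIntervalBounds.prime_sum_le {κ : ℕ → ℂ} {P : ℕ} {D η R : ℝ}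
    (h : HasIntervalBounds κ P D η R) {X : ℕ} (hX : 4 * R ^ 3 ≤ η ^ 3 * X) :
    ‖∑ i ∈ Icc 1 X with i.Prime, κ i‖ ≤ 30 * ((1 + Real.log X) ^ 2 * D * X * √η) := by
  have hD := h.one_le_D
  have hη := h.eta_pos
  have hη1 := h.eta_le
  have hR := h.one_le_R
  have hRη : 1 ≤ R / η := by rw [le_div_iff₀ hη]; linarith
  -- The least integer `U` with `R ≤ ηU`. The other condition `R U² ≤ ηX` then follows from `4R³ ≤
  -- η³X`.
  obtain ⟨U, hUdef⟩ : ∃ U, U = ⌈R / η⌉₊ := ⟨_, rfl⟩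
  have hU1 : R / η ≤ U := hUdef ▸ Nat.le_ceil _
  have hU2 : (U : ℝ) ≤ 2 * (R / η) := by
    have := (Nat.ceil_lt_add_one (zero_le_one.trans hRη)).le
    rw [← hUdef] at this
    linarith
  have hU : 0 < U := by
    have : (0 : ℝ) < U := by linarith
    exact_mod_cast this
  have hRU : R ≤ η * U := by rw [div_le_iff₀ hη] at hU1; linarith
  have hRX : R * U ^ 2 ≤ η * X := by
    calc R * (U : ℝ) ^ 2 ≤ R * (2 * (R / η)) ^ 2 := by gcongr
      _ = 4 * R ^ 3 / η ^ 2 := by ring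
      _ ≤ η ^ 3 * X / η ^ 2 := by gcongr
      _ = η * X := by field_simp
  have hηX : 1 ≤ η * X := by
    refine le_trans ?_ hRX
    have : (1 : ℝ) ≤ U := by exact_mod_cast hU
    nlinarith [sq_nonneg (U : ℝ)]
  have hX0 : (0 : ℝ) < X := by
    by_contra! h0
    nlinarith
  have hXnat : 1 ≤ X := by exact_mod_cast hX0
  have hlog : 0 ≤ Real.log X := Real.log_natCast_nonneg X
  have hsqrt : √X ≤ X * √η := by
    refine Real.sqrt_le_iff.2 ⟨by positivity, ?_⟩
    rw [mul_pow, Real.sq_sqrt hη.le]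
    nlinarith
  obtain ⟨L, hL⟩ : ∃ L, L = 1 + Real.log X := ⟨_, rfl⟩
  have hL1 : 1 ≤ L := by linarith
  have key := norm_sum_prime_le_of_log (κ := κ) (X := X)
    (B := 15 * ((1 + Real.log X) ^ 2 * D * X * √η)) (by
      intro n hn
      rw [← hL]
      rcases Nat.eq_zero_or_pos n with rfl | hn0
      · simp; positivity
      have h1 := h.vonMangoldt_le (x := n) hn0 hn hU hRU hRX
      rw [← hL] at h1
      have h2 : ‖∑ i ∈ Ioc 0 n with ¬ i.Prime, (Λ i : ℂ) * κ i‖ ≤ 2 * (L ^ 2 * D * X * √η) := by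
        have h3 : ‖∑ i ∈ Ioc 0 n with ¬ i.Prime, (Λ i : ℂ) * κ i‖
            ≤ ∑ i ∈ Ioc 0 n with ¬ i.Prime, (Λ i : ℝ) * D := by
          refine norm_sum_le_of_le _ fun i _ => ?_
          rw [norm_mul, Complex.norm_real, Real.norm_of_nonneg vonMangoldt_nonneg]
          exact mul_le_mul_of_nonneg_left (h.norm_le i) vonMangoldt_nonneg
        rw [← sum_mul] at h3
        have h4 := sum_vonMangoldt_not_prime_le hn0 hn
        calc _ ≤ (2 * √X * Real.log X) * D := h3.trans (by gcongr)
          _ ≤ (2 * (X * √η) * L ^ 2) * D := by gcongr; nlinarith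
          _ = _ := by ring
      have h5 : ∑ i ∈ Ioc 0 n, (if i.Prime then (Real.log i : ℂ) * κ i else 0)
          = ∑ i ∈ Ioc 0 n, (Λ i : ℂ) * κ i - ∑ i ∈ Ioc 0 n with ¬ i.Prime, (Λ i : ℂ) * κ i := by
        rw [sum_filter, ← sum_sub_distrib]
        refine sum_congr rfl fun i _ => ?_
        by_cases hi : i.Prime
        · simp [hi, vonMangoldt_apply_prime hi]
        · simp [hi]
      rw [h5]
      refine (norm_sub_le _ _).trans ?_
      linarith)
  linarith

/-! ### Kloosterman sums over primes -/

lemma sum_Ico_natCast_eq (f : ℤ → ℂ) {A B : ℕ} :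
    ∑ m ∈ Ico A B, f m = ∑ m ∈ Ico (A : ℤ) B, f m := by
  refine sum_nbij' (fun m => (m : ℤ)) Int.toNat ?_ ?_ ?_ ?_ ?_
  · intro m hm
    have := mem_Ico.1 hm
    exact mem_Ico.2 ⟨by lia, by lia⟩
  · intro m hm
    have := mem_Ico.1 hm
    exact mem_Ico.2 ⟨by lia, by lia⟩
  · intro m _; simp
  · intro m hm
    have := mem_Ico.1 hm
    exact Int.toNat_of_nonneg (by lia)
  · intro m _; rfl

lemma savingExp_pos {n : ℕ} (hn : 0 < n) : 0 < savingExp n := by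
  unfold savingExp; positivity

lemma savingExp_le_one {n : ℕ} (hn : 0 < n) : savingExp n ≤ 1 := by
  unfold savingExp
  have : (1 : ℝ) ≤ n := by exact_mod_cast hn
  rw [div_le_one (by positivity)]
  nlinarith

/-- Kloosterman sums of large prime power modulus have interval bounds. -/
lemma kloosterman_hasIntervalBounds {n : ℕ} (hn : 128 ≤ n) :
    ∃ C : ℝ, 0 < C ∧ ∀ p g k : ℕ, p.Prime → Odd p → 1 ≤ g → 16 * n * g ≤ k →
      k ≤ (16 * n + 2) * g → ∀ a : ℤ, (a : ZMod p) ≠ 0 →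
        HasIntervalBounds (fun m : ℕ => kloostermanSum (m : ℤ) a (p ^ k)) (p ^ g) (C * p ^ 3)
          (((p : ℝ) ^ g) ^ (-savingExp n)) (((p : ℝ) ^ g) ^ 4) := by
  obtain ⟨C, hC, h⟩ := kloosterman_interval_bounds hn
  refine ⟨4 * (C + 2), by positivity, fun p g k hp hodd hg hk hk' a ha => ?_⟩
  have hp1 : (1 : ℝ) ≤ p := by exact_mod_cast hp.one_lt.le
  have hP1 : 1 ≤ (p : ℝ) ^ g := one_le_pow₀ hp1
  have hp3 : (1 : ℝ) ≤ (p : ℝ) ^ 3 := one_le_pow₀ hp1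
  have hp23 : (p : ℝ) ^ 2 ≤ (p : ℝ) ^ 3 := pow_le_pow_right₀ hp1 (by norm_num)
  have hk2 : 2 ≤ k := by nlinarith
  have hη : 0 < ((p : ℝ) ^ g) ^ (-savingExp n) := by positivity
  have hB : ∀ A B : ℕ, A ≤ B → 4 * (p : ℝ) ^ 3 * intervalBound C n (p ^ g) (((B : ℤ) - A : ℤ) : ℝ)
      ≤ 4 * (C + 2) * p ^ 3 * (((p : ℝ) ^ g) ^ (-savingExp n) * (B - A) + ((p : ℝ) ^ g) ^ 4) := by
    intro A B hAB
    unfold intervalBound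
    push_cast
    have hL : (0 : ℝ) ≤ B - A := sub_nonneg.2 (by exact_mod_cast hAB)
    calc _ = 4 * (p : ℝ) ^ 3 * (C * (((p : ℝ) ^ g) ^ (-savingExp n) * (B - A))
          + 2 * ((p : ℝ) ^ g) ^ 4) := by ring
      _ ≤ 4 * (p : ℝ) ^ 3 * ((C + 2) * (((p : ℝ) ^ g) ^ (-savingExp n) * (B - A))
          + (C + 2) * ((p : ℝ) ^ g) ^ 4) := by gcongr <;> linarith
      _ = _ := by ring
  have hB0 : ∀ A B : ℕ, A ≤ B → 0 ≤ intervalBound C n (p ^ g) (((B : ℤ) - A : ℤ) : ℝ) := by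
    intro A B hAB
    unfold intervalBound
    have hL : (0 : ℝ) ≤ (((B : ℤ) - A : ℤ) : ℝ) := by
      push_cast
      exact sub_nonneg.2 (by exact_mod_cast hAB)
    positivity
  refine ⟨pow_pos hp.pos g, ?_, ?_, ?_, one_le_pow₀ hP1, ?_, ?_, ?_⟩
  · nlinarith
  · push_cast
    rw [one_div, ← Real.rpow_neg_one]
    exact Real.rpow_le_rpow_of_exponent_le hP1 (neg_le_neg (savingExp_le_one (by lia)))
  · exact Real.rpow_le_one_of_one_le_of_nonpos hP1 (neg_nonpos.2 (savingExp_pos (by lia)).le)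
  · intro m
    calc ‖kloostermanSum (m : ℤ) a (p ^ k)‖ ^ 2 ≤ (2 * p) ^ 2 :=
          pow_le_pow_left₀ (norm_nonneg _) (norm_kloostermanSum_le hp hodd hk2 ha m) 2
      _ = 4 * 1 * (p : ℝ) ^ 2 := by ring
      _ ≤ 4 * (C + 2) * p ^ 3 := by gcongr; linarith
  · intro t A B hAB
    have h1 := (h p g k hp hodd hg hk hk' a ha A B (by exact_mod_cast hAB)).1 t
    have h3 := sum_Ico_natCast_eq (fun m => kloostermanSum (m * t) a (p ^ k)) (A := A) (B := B)
    simp only [Nat.cast_mul]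
    rw [h3]
    refine h1.trans (le_trans ?_ (hB A B hAB))
    refine mul_le_mul_of_nonneg_right ?_ (hB0 A B hAB)
    linarith [sq_nonneg (p : ℝ)]
  · intro t₁ t₂ A B hAB ht
    have h1 := (h p g k hp hodd hg hk hk' a ha A B (by exact_mod_cast hAB)).2 t₁ t₂ (by
      intro hd
      refine ht (Nat.ModEq.symm ((Nat.modEq_iff_dvd).2 ?_))
      push_cast
      exact hd)
    have h3 := sum_Ico_natCast_eq (fun m => kloostermanSum (m * t₁) a (p ^ k) *
          (starRingEnd ℂ) (kloostermanSum (m * t₂) a (p ^ k))) (A := A) (B := B)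
    simp only [Nat.cast_mul]
    rw [h3]
    exact h1.trans (hB A B hAB)

/-- The prime sum in terms of `P = p ^ g`. -/
lemma kloosterman_prime_sum_le {n : ℕ} (hn : 128 ≤ n) :
    ∃ C : ℝ, 0 < C ∧ ∀ p g k : ℕ, p.Prime → Odd p → 1 ≤ g → 16 * n * g ≤ k →
      k ≤ (16 * n + 2) * g → ∀ a : ℤ, (a : ZMod p) ≠ 0 → ∀ X : ℕ, (p ^ g) ^ 17 ≤ X →
        ‖∑ l ∈ Icc 1 X with l.Prime, kloostermanSum (l : ℤ) a (p ^ k)‖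
          ≤ C * ((1 + Real.log X) ^ 2 * p ^ 3 * X * ((p : ℝ) ^ g) ^ (-(savingExp n / 2))) := by
  obtain ⟨C, hC, h⟩ := kloosterman_hasIntervalBounds hn
  refine ⟨30 * C, by positivity, fun p g k hp hodd hg hk hk' a ha X hX => ?_⟩
  have hp3 : (3 : ℝ) ≤ p := by
    have h2 := hp.two_le
    have h3 : p ≠ 2 := by rintro rfl; exact absurd hodd (by decide)
    exact_mod_cast (by lia : 3 ≤ p)
  obtain ⟨P, hP⟩ : ∃ P : ℝ, P = (p : ℝ) ^ g := ⟨_, rfl⟩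
  have hP3 : 3 ≤ P := by
    rw [hP]
    exact hp3.trans (le_self_pow₀ (by linarith) (by lia))
  have hX' : P ^ 17 ≤ X := by rw [hP]; exact_mod_cast hX
  have hη : P⁻¹ ≤ P ^ (-savingExp n) := by
    rw [← Real.rpow_neg_one]
    exact Real.rpow_le_rpow_of_exponent_le (by linarith) (neg_le_neg (savingExp_le_one (by lia)))
  -- With `R = P⁴`, `η ≥ 1/P` and `X ≥ P^17` the condition becomes `4P^12 ≤ P^14`, which holds since
  -- `P ≥ 3`.
  have h1 := (h p g k hp hodd hg hk hk' a ha).prime_sum_le (X := X) (by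
    rw [← hP]
    calc 4 * (P ^ 4) ^ 3 ≤ P ^ 2 * (P ^ 4) ^ 3 := by gcongr; nlinarith
      _ = P⁻¹ ^ 3 * P ^ 17 := by field_simp
      _ ≤ (P ^ (-savingExp n)) ^ 3 * X := by gcongr)
  rw [← hP] at h1 ⊢
  refine h1.trans (le_of_eq ?_)
  rw [Real.sqrt_eq_rpow, ← Real.rpow_mul (by linarith),
    show -savingExp n * (1 / 2) = -(savingExp n / 2) by ring]
  ring

/-! ### Choice of parameters. -/

/-- The logarithms are absorbed into an arbitrarily small power of `P` through `log P ≤ P^s / s`. -/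
lemma one_add_log_sq_le {P Y s K : ℝ} (hs : 0 < s) (hP : 1 ≤ P) (hY : 1 ≤ Y) (hK : 0 ≤ K)
    (hYP : Real.log Y ≤ K * Real.log P) :
    (1 + Real.log Y) ^ 2 ≤ (1 + K / s) ^ 2 * P ^ (2 * s) := by
  have h1 : Real.log P ≤ P ^ s / s := Real.log_le_rpow_div (by linarith) hs
  have h2 : 1 ≤ P ^ s := Real.one_le_rpow hP hs.le
  have h3 : 0 ≤ Real.log Y := Real.log_nonneg hY
  have h4 : 1 + Real.log Y ≤ (1 + K / s) * P ^ s := by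
    calc 1 + Real.log Y ≤ P ^ s + K * (P ^ s / s) :=
          add_le_add h2 (hYP.trans (mul_le_mul_of_nonneg_left h1 hK))
      _ = _ := by ring
  calc _ ≤ ((1 + K / s) * P ^ s) ^ 2 := pow_le_pow_left₀ (by linarith) h4 2
    _ = _ := by
      rw [mul_pow, ← Real.rpow_natCast (P ^ s), ← Real.rpow_mul (by linarith)]
      congr 2
      push_cast; ring

/-- Here `n ≍ 1/ε`. The lower bound yields `q^ε ≥ P^(16nε) ≥ P^32`, more than the length `P^17`
required; the upper bound keeps the saving, of order `n^(-2)`, as large as a multiple of `ε²`. -/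
lemma exists_level {ε : ℝ} (hε : 0 < ε) (hε1 : ε ≤ 1) :
    ∃ n : ℕ, 128 ≤ n ∧ 2 ≤ n * ε ∧ n * ε ≤ 128 := by
  refine ⟨max 128 ⌈2 / ε⌉₊, le_max_left _ _, ?_, ?_⟩
  · have h1 : 2 / ε ≤ (max 128 ⌈2 / ε⌉₊ : ℕ) :=
      (Nat.le_ceil _).trans (by exact_mod_cast le_max_right _ _)
    rwa [div_le_iff₀ hε] at h1
  · have h2 : ((max 128 ⌈2 / ε⌉₊ : ℕ) : ℝ) ≤ 128 / ε := by
      push_cast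
      refine max_le ?_ ?_
      · rw [le_div_iff₀ hε]; linarith
      · refine (Nat.ceil_lt_add_one (by positivity)).le.trans ?_
        rw [le_div_iff₀ hε, add_mul, div_mul_cancel₀ _ hε.ne']
        linarith
    rwa [le_div_iff₀ hε] at h2

/-- One has `θ/4 = 1/(3211264 n²)` and `16n + 2 ≤ 17n`, so a power of `q ≤ P^(16n+2)` costs one more
factor `n`; then `n ≤ 128/ε` produces the cube. -/
lemma saving_exponent_le {ε : ℝ} (hε : 0 < ε) {n : ℕ} (hn : 128 ≤ n) (h : n * ε ≤ 128) :
    1 / (3211264 * 17 * 128 ^ 3) * ε ^ 3 * (16 * n + 2) ≤ savingExp n / 4 := by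
  have hn' : (128 : ℝ) ≤ n := by exact_mod_cast hn
  have h3 : ((n : ℝ) * ε) ^ 3 ≤ 128 ^ 3 := pow_le_pow_left₀ (by positivity) h 3
  unfold savingExp
  rw [div_div, le_div_iff₀ (by positivity)]
  calc 1 / (3211264 * 17 * 128 ^ 3) * ε ^ 3 * (16 * n + 2) * (802816 * (n : ℝ) ^ 2 * 4)
      ≤ 1 / (3211264 * 17 * 128 ^ 3) * ε ^ 3 * (17 * n) * (802816 * (n : ℝ) ^ 2 * 4) := by
        gcongr; linarith
    _ = ((n : ℝ) * ε) ^ 3 / 128 ^ 3 := by field_simp; ring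
    _ ≤ 1 := by rw [div_le_one (by positivity)]; exact h3

end KloostermanPrimes


open Finset KloostermanPrimes in
theorem theorem1p3 :
    ∃ c : ℝ, 0 < c ∧
      ∀ ε : ℝ, 0 < ε →
        ∃ H : ℝ, 0 < H ∧ ∃ C : ℝ, 0 < C ∧
          ∀ (p k q : ℕ), p.Prime → Odd p → H < (k : ℝ) → q = p ^ k →
            ∀ X : ℝ, (q : ℝ) ^ ε < X → X ≤ (q : ℝ) →
              ∀ a : ℤ, Int.gcd a (p : ℤ) = 1 →
                ‖∑ l ∈ (Finset.Icc 1 ⌊X⌋₊).filter Nat.Prime, kloostermanSum (l : ℤ) a q‖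
                  ≤ C * X * (q : ℝ) ^ (-(c * ε ^ 3)) := by
  refine ⟨1 / (3211264 * 17 * 128 ^ 3), by positivity, fun ε hε => ?_⟩
  -- For `ε > 1` the range `q^ε < X ≤ q` is empty.
  rcases lt_or_ge 1 ε with hε1 | hε1
  · refine ⟨1, one_pos, 1, one_pos, fun p k q hp _ _ hq X hX1 hX2 => ?_⟩
    exfalso
    have hq1 : (1 : ℝ) ≤ q := by
      rw [hq]; exact_mod_cast Nat.one_le_pow _ _ hp.pos
    have := Real.rpow_le_rpow_of_exponent_le hq1 hε1.le
    rw [Real.rpow_one] at this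
    linarith
  obtain ⟨n, hn, hnε, hnε'⟩ := exists_level hε hε1
  obtain ⟨C, hC, hbound⟩ := kloosterman_prime_sum_le hn
  obtain ⟨θ, hθ⟩ : ∃ θ, θ = savingExp n := ⟨_, rfl⟩
  have hθ0 : 0 < θ := hθ ▸ savingExp_pos (by lia)
  have hc := saving_exponent_le hε hn hnε'
  have hnr : (128 : ℝ) ≤ n := by exact_mod_cast hn
  rw [← hθ] at hc hbound
  -- This forces `g = ⌊k/(16n)⌋` above `8n + 24/θ`, the `+ 1` paying for the floor. From `g ≥ 8n`
  -- comes `k ≤ (16n+2)g`; from `g ≥ 24/θ` comes `p³ ≤ P^(θ/8)`.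
  refine ⟨16 * n * (8 * n + 24 / θ + 1), by positivity,
    C * (1 + (16 * n + 2) / (θ / 16)) ^ 2, by positivity,
    fun p k q hp hodd hk hq X hX1 hX2 a ha => ?_⟩
  have hpr : (1 : ℝ) ≤ p := by exact_mod_cast hp.one_lt.le
  obtain ⟨g, hg⟩ : ∃ g, g = k / (16 * n) := ⟨_, rfl⟩
  have hgk : 16 * n * g ≤ k := hg ▸ Nat.mul_div_le k (16 * n)
  have hgk1 : k < 16 * n * g + 16 * n := by
    have := Nat.lt_mul_div_succ k (show 0 < 16 * n by lia)
    rw [← hg] at this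
    linarith
  have hgr : 8 * n + 24 / θ < (g : ℝ) := by
    have h1 : (k : ℝ) < 16 * n * (g + 1) := by
      have : ((k : ℕ) : ℝ) < ((16 * n * g + 16 * n : ℕ) : ℝ) := by exact_mod_cast hgk1
      push_cast at this
      linarith
    have h2 := lt_of_mul_lt_mul_left (hk.trans h1) (by positivity)
    linarith
  have hg8 : 8 * n ≤ g := by
    have : (8 * n : ℝ) ≤ g := by
      have : 0 < 24 / θ := by positivity
      linarith
    exact_mod_cast this
  have hgk2 : k ≤ (16 * n + 2) * g := by nlinarith
  obtain ⟨P, hP⟩ : ∃ P : ℝ, P = (p : ℝ) ^ g := ⟨_, rfl⟩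
  have hP1 : 1 ≤ P := hP ▸ one_le_pow₀ hpr
  have hP0 : 0 < P := by linarith
  have hqP1 : P ^ (16 * n) ≤ q := by
    rw [hP, ← pow_mul, hq, Nat.cast_pow]
    exact pow_le_pow_right₀ hpr (by linarith)
  have hqP2 : (q : ℝ) ≤ P ^ (16 * n + 2) := by
    rw [hP, ← pow_mul, hq, Nat.cast_pow]
    exact pow_le_pow_right₀ hpr (by linarith)
  have hq1 : (1 : ℝ) ≤ q := (one_le_pow₀ hP1).trans hqP1
  have hX17 : P ^ 17 ≤ X := by
    refine le_trans ?_ hX1.le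
    calc P ^ 17 = P ^ (17 : ℝ) := by rw [← Real.rpow_natCast]; norm_num
      _ ≤ P ^ ((16 * n : ℕ) * ε : ℝ) := by
        refine Real.rpow_le_rpow_of_exponent_le hP1 ?_
        push_cast; linarith
      _ = (P ^ (16 * n)) ^ ε := by rw [Real.rpow_mul hP0.le, Real.rpow_natCast]
      _ ≤ (q : ℝ) ^ ε := Real.rpow_le_rpow (by positivity) hqP1 hε.le
  have hXfloor : (p ^ g) ^ 17 ≤ ⌊X⌋₊ := by
    refine Nat.le_floor ?_
    push_cast
    rw [← hP]; exact hX17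
  have hX0 : 0 < X := lt_of_lt_of_le (by positivity) hX17
  have hfl : (⌊X⌋₊ : ℝ) ≤ X := Nat.floor_le hX0.le
  have hfl1 : (1 : ℝ) ≤ ⌊X⌋₊ := by
    exact_mod_cast (Nat.one_le_pow _ _ (pow_pos hp.pos g)).trans hXfloor
  have main := hbound p g k hp hodd (by lia) hgk hgk2 a (intCast_ne_zero_of_gcd hp ha) ⌊X⌋₊ hXfloor
  rw [← hq, ← hP] at main
  have hlog : (1 + Real.log ⌊X⌋₊) ^ 2
      ≤ (1 + (16 * n + 2) / (θ / 16)) ^ 2 * P ^ (2 * (θ / 16)) := by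
    refine one_add_log_sq_le (by positivity) hP1 hfl1 (by positivity) ?_
    calc Real.log ⌊X⌋₊ ≤ Real.log (P ^ (16 * n + 2)) :=
          Real.log_le_log (by linarith) (hfl.trans (hX2.trans hqP2))
      _ = _ := by rw [Real.log_pow]; push_cast; ring
  have hp3 : (p : ℝ) ^ 3 ≤ P ^ (θ / 8) := by
    rw [hP, ← Real.rpow_natCast, ← Real.rpow_natCast, ← Real.rpow_mul (by linarith)]
    refine Real.rpow_le_rpow_of_exponent_le hpr ?_
    have h1 : 24 / θ ≤ g := by linarith
    rw [div_le_iff₀ hθ0] at h1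
    push_cast; linarith
  have hsave : P ^ (-(θ / 4)) ≤ (q : ℝ) ^ (-(1 / (3211264 * 17 * 128 ^ 3) * ε ^ 3)) := by
    obtain ⟨δ, hδ⟩ : ∃ δ : ℝ, δ = 1 / (3211264 * 17 * 128 ^ 3) * ε ^ 3 := ⟨_, rfl⟩
    rw [← hδ] at hc ⊢
    have hδ0 : 0 ≤ δ := by rw [hδ]; positivity
    calc P ^ (-(θ / 4)) ≤ P ^ (((16 * n + 2 : ℕ) : ℝ) * (-δ)) := by
          refine Real.rpow_le_rpow_of_exponent_le hP1 ?_
          push_cast; linarith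
      _ = (P ^ (16 * n + 2)) ^ (-δ) := by rw [Real.rpow_mul hP0.le, Real.rpow_natCast]
      _ ≤ (q : ℝ) ^ (-δ) :=
          Real.rpow_le_rpow_of_nonpos (by linarith) hqP2 (neg_nonpos.2 hδ0)
  obtain ⟨K, hK⟩ : ∃ K : ℝ, K = (1 + (16 * n + 2) / (θ / 16)) ^ 2 := ⟨_, rfl⟩
  rw [← hK] at hlog ⊢
  have hK0 : 0 ≤ K := by rw [hK]; positivity
  refine main.trans ?_
  -- The saving `θ/2` is spent as `θ/8` on the logarithms and `θ/8` on `p³`, which leaves `θ/4`.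
  calc C * ((1 + Real.log ⌊X⌋₊) ^ 2 * p ^ 3 * ⌊X⌋₊ * P ^ (-(θ / 2)))
      ≤ C * ((K * P ^ (2 * (θ / 16))) * P ^ (θ / 8) * X * P ^ (-(θ / 2))) := by gcongr
    _ = C * K * X * (P ^ (2 * (θ / 16)) * P ^ (θ / 8) * P ^ (-(θ / 2))) := by ring
    _ = C * K * X * P ^ (-(θ / 4)) := by
        rw [← Real.rpow_add hP0, ← Real.rpow_add hP0]
        congr 2
        ring
    _ ≤ C * K * X * (q : ℝ) ^ (-(1 / (3211264 * 17 * 128 ^ 3) * ε ^ 3)) := by gcongr
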